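/- **Setting.** Let $X=T\times\check T=\mathbb R^{2n}/\mathbb Z^{2n}$, with periodic coordinates $(x,y)$, $x,y\in\mathbb R^n$, and the symplectic form $\omega=\sum_{i=1}^n dy^i\wedge dx^i$; $\mathcal C^\infty(X,\mathbb C)$ is the space of smooth $\mathbb Z^{2n}$-periodic functions on $\mathbb R^{2n}$. $X$ carries the symplectic orientation and $\int_X f e^{\omega}=\int_X f\,\omega^n/n!=\int_{[0,1]^{2n}}f\,dx\,dy$. For an integer $k\ge 1$ put $\hbar=1/k$. Smooth sections of the $k$-th power $L^{\otimes k}$ of the prequantum line bundle are the smooth $s:\mathbb R^{2n}\to\mathbb C$ with $s(u+\lambda)=\alpha(\lambda)^k e^{-k\pi\sqrt{-1}\,\omega(u,\lambda)}s(u)$ for $\lambda\in\mathbb Z^{2n}$, where $\alpha(\lambda)=(-1)^{\sum_i\lambda_i\lambda_{n+i}}$ and $\omega(u,v)=\sum_i(u_{n+i}v_i-u_iv_{n+i})$; the connection is $\nabla^\hbar=d-k\pi\sqrt{-1}\sum_i(y^idx^i-x^idy^i)$. Distributional sections are the continuous conjugate-linear functionals $\tau\mapsto\langle s,\tau\rangle$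 on smooth sections. The quantum space $\mathcal H^\hbar$ consists of the $s\otimes\rho$ with $s$ a distributional section such that $\nabla^\hbar_{\partial/\partial x^i}s=0$ for all $i$, where $\rho$ generates the half-form line of the polarization spanned by the $\partial/\partial x^i$; $\check\rho$ generates that of the polarization spanned by the $\partial/\partial y^i$, and $\langle\rho,\check\rho\rangle=2^{n/2}k^{-n/2}$. For $m\in\mathbb Z^n$ the Weil–Brezin coefficient of a smooth section $\tau$ is $(\tau)_{[m]}(y)=\int_{[0,1]^n}e^{k\pi\sqrt{-1}\,x\cdot(y+\hbar m)}\tau(x,y+\hbar m)e^{-2\pi\sqrt{-1}\,m\cdot x}\,dx$; it depends only on $[m]\in\mathbb Z_k^n=\mathbb Z^n/k\mathbb Z^n$. Put $\langle\vartheta^m,\tau\rangle=(2k)^{-n/2}\,\overline{(\tau)_{[m]}(0)}$, $\langle\check\vartheta^m,\tau\rangle=2^{-n/2}\int_{\mathbb R^n}\overline{(\tau)_{[m]}(y)}\,dy$, $\sigma^m=2^{n/4}k^{n/2}\vartheta^m\otimes\rho$ and $\check\sigma^m=2^{n/4}k^{n/2}\check\vartheta^m\otimes\check\rho$. The Toeplitz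 operator of $f\in\mathcal C^\infty(X,\mathbb C)$ is $$Q_f^\hbar:\mathcal H^\hbar\to\mathcal H^\hbar,\qquad Q_f^\hbar s=\Pi^\hbar(fs),\qquad \Pi^\hbar t=\sum_{m\in\mathbb Z_k^n}\langle t,\check\sigma^m\rangle\,\sigma^m,$$ where the pairing is the product of the half-form pairing and the extension of the $L^2$ pairing to distributional sections with transversal wavefront sets: $\langle u,v\rangle=\int_{\mathbb R^{2n}}\widehat{\chi_1u}\,\overline{\widehat{\chi_2v}}$ (absolutely convergent) for all $\chi_1,\chi_2\in\mathcal C_c^\infty(\mathbb R^{2n},\mathbb R)$ with $\sum_{\lambda\in\mathbb Z^{2n}}(\chi_1\chi_2)(\cdot-\lambda)=1$. On $\mathcal C^\infty(X,\mathbb C)[[\hbar]]$ let $\star$ be the $\mathbb C[[\hbar]]$-bilinear star product with $$f\star g=\sum_{l\ge 0}\frac{\hbar^l}{l!\,(2\pi\sqrt{-1})^l}\sum_{i_1,\dots,i_l=1}^n\frac{\partial^lf}{\partial y^{i_1}\cdots\partial y^{i_l}}\,\frac{\partial^lg}{\partial x^{i_1}\cdots\partial x^{i_l}},\qquad f,g\in\mathcal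 C^\infty(X,\mathbb C),$$ and let $\operatorname{Tr}(F)=\int_XF e^{\omega/\hbar}=\sum_{j\ge0}\hbar^{j-n}\int_XF_j\,\frac{\omega^n}{n!}$ for $F=\sum_j\hbar^jF_j$. **Theorem 1.3.** For every $k\ge1$ the space $\mathcal H^\hbar$ is finite dimensional, and for every $f\in\mathcal C^\infty(X,\mathbb C)$ the operator $Q_f^\hbar$ is well defined and linear. For every $f\in\mathcal C^\infty(X,\mathbb C)$, $$\operatorname{tr}(Q_f^\hbar)=\hbar^{-n}\Big(\int_Xf e^\omega+O(\hbar^\infty)\Big),$$ that is, for every $r\in\mathbb N$ there is a constant $C$ with $\big|\operatorname{tr}(Q_f^\hbar)-\hbar^{-n}\int_Xfe^\omega\big|\le C\hbar^{r-n}$ for all $k\ge1$, $\hbar=1/k$. Hence the asymptotic expansion of $\operatorname{tr}(Q_f^\hbar)$ as $\hbar\to0^+$ is $\operatorname{Tr}(f)$, and $\operatorname{Tr}$ is a trace map for $\star$: a continuous $\mathbb C[[\hbar]]$-linear map $\mathcal C^\infty(X,\mathbb C)[[\hbar]]\to\hbar^{-n}\mathbb C[[\hbar]]$ with $\operatorname{Tr}(F\star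 G)=\operatorname{Tr}(G\star F)$ for all $F,G$ and $\operatorname{Tr}(f)=\int_Xfe^{\omega/\hbar}+O(\hbar^{1-n})$ for all $f\in\mathcal C^\infty(X,\mathbb C)$. -/

import Mathlib

open scoped ContDiff PowerSeries LaurentSeries

noncomputable section

namespace TorusQuant

/-! ### The symplectic torus

`X = ℝ²ⁿ / ℤ²ⁿ` with periodic coordinates `(x, y)`, `x, y ∈ ℝⁿ`, and symplectic form
`ω = ∑ i, dy i ∧ dx i`. Everything on `X` is described on the universal cover `ℝⁿ × ℝⁿ`. -/

/-- The universal cover `ℝⁿ × ℝⁿ` of `X`, with coordinates `(x, y)`. -/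
abbrev Cov (n : ℕ) : Type := (Fin n → ℝ) × (Fin n → ℝ)

/-- The lattice `ℤⁿ × ℤⁿ`. -/
abbrev Lat (n : ℕ) : Type := (Fin n → ℤ) × (Fin n → ℤ)

/-- The inclusion of the lattice in the universal cover. -/
def Lat.toCov {n : ℕ} (l : Lat n) : Cov n := (fun i => (l.1 i : ℝ), fun i => (l.2 i : ℝ))

theorem Lat.toCov_add {n : ℕ} (l m : Lat n) : (l + m).toCov = l.toCov + m.toCov := by
  ext i <;> simp [Lat.toCov]

/-- The (closed) unit cube `[0,1]ⁿ × [0,1]ⁿ`, whose interior is a fundamental domain of `X`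
up to measure zero and which meets every lattice orbit. -/
def unitCube (n : ℕ) : Set (Cov n) := Set.Icc 0 1

/-- The symplectic bilinear form `ω(u, v) = ∑ i, (u_{n+i} v_i - u_i v_{n+i})`. -/
def sympForm {n : ℕ} (u v : Cov n) : ℝ := ∑ i, (u.2 i * v.1 i - u.1 i * v.2 i)

theorem sympForm_add_left {n : ℕ} (u v w : Cov n) :
    sympForm (u + v) w = sympForm u w + sympForm v w := by
  simp only [sympForm, ← Finset.sum_add_distrib]
  exact Finset.sum_congr rfl fun i _ => by simp; ring

theorem sympForm_add_right {n : ℕ} (u v w : Cov n) :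
    sympForm u (v + w) = sympForm u v + sympForm u w := by
  simp only [sympForm, ← Finset.sum_add_distrib]
  exact Finset.sum_congr rfl fun i _ => by simp; ring

theorem sympForm_swap {n : ℕ} (u v : Cov n) : sympForm u v = -sympForm v u := by
  simp only [sympForm, ← Finset.sum_neg_distrib]
  exact Finset.sum_congr rfl fun i _ => by ring

theorem sympForm_smul_left {n : ℕ} (c : ℝ) (u w : Cov n) :
    sympForm (c • u) w = c * sympForm u w := by
  simp only [sympForm, Finset.mul_sum]
  exact Finset.sum_congr rfl fun i _ => by simp; ring

/-- `ω(·, w)` as a continuous linear form. -/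
def sympCLM {n : ℕ} (w : Cov n) : Cov n →L[ℝ] ℝ :=
  LinearMap.toContinuousLinearMap
    { toFun := fun u => sympForm u w
      map_add' := fun u v => sympForm_add_left u v w
      map_smul' := fun c u => sympForm_smul_left c u w }

@[simp] theorem sympCLM_apply {n : ℕ} (u w : Cov n) : sympCLM w u = sympForm u w := rfl

/-- The unit coordinate vector `∂/∂x i`. -/
def ex {n : ℕ} (i : Fin n) : Cov n := (Pi.single i 1, 0)

/-- The unit coordinate vector `∂/∂y i`. -/
def ey {n : ℕ} (i : Fin n) : Cov n := (0, Pi.single i 1)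

/-! ### Smooth functions on `X` -/

/-- `C^∞(X, ℂ)`, as the algebra of smooth `ℤ²ⁿ`-periodic functions on `ℝ²ⁿ`. -/
def smoothFun (n : ℕ) : Subalgebra ℂ (Cov n → ℂ) where
  carrier := {f | ContDiff ℝ ∞ f ∧ ∀ (l : Lat n) (u : Cov n), f (u + l.toCov) = f u}
  mul_mem' := fun {f g} hf hg =>
    ⟨hf.1.mul hg.1, fun l u => by simp only [Pi.mul_apply, hf.2 l u, hg.2 l u]⟩
  add_mem' := fun {f g} hf hg =>
    ⟨hf.1.add hg.1, fun l u => by simp only [Pi.add_apply, hf.2 l u, hg.2 l u]⟩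
  algebraMap_mem' := fun c => ⟨contDiff_const, fun _ _ => rfl⟩

/-- The complex conjugate of a smooth function on `X`. -/
def conjFun {n : ℕ} (f : smoothFun n) : smoothFun n :=
  ⟨fun u => (starRingEnd ℂ) (f.1 u),
    Complex.conjCLE.contDiff.comp f.2.1, fun l u => by simp only [f.2.2 l u]⟩

/-- The derivative of a smooth function on `X` along the constant vector field `w`. -/
def dirDeriv {n : ℕ} (w : Cov n) (f : smoothFun n) : smoothFun n :=
  ⟨fun u => fderiv ℝ f.1 u w,
    (f.2.1.fderiv_right (m := ∞) (by simp)).clm_apply contDiff_const, fun l u => by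
      have h : (fun v => f.1 (v + l.toCov)) = f.1 := funext fun v => f.2.2 l v
      change fderiv ℝ f.1 (u + l.toCov) w = fderiv ℝ f.1 u w
      rw [← fderiv_comp_add_right, h]⟩

/-- The integral `∫_X f ωⁿ/n!` of a function against the Liouville measure. As
`ωⁿ/n! = dx dy` for the symplectic orientation, this is the Lebesgue integral of `f` over the
unit cube. The component of degree `2n` of `e^ω` is `ωⁿ/n!`, so this is `∫_X f e^ω`, and
`∫_X f e^{ω/ħ} = ħ⁻ⁿ ∫_X f ωⁿ/n!`. -/
def liouvilleIntegral {n : ℕ} (f : smoothFun n) : ℂ := ∫ u in unitCube n, f.1 u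

/-! ### The star product and trace maps -/

/-- The bidifferential operator
`C_l(f, g) = (1 / (l! (2πi)^l)) ∑_{i₁, …, i_l} ∂^l f/∂y^{i₁}⋯∂y^{i_l} · ∂^l g/∂x^{i₁}⋯∂x^{i_l}`. -/
def starCoeff {n : ℕ} (l : ℕ) (f g : smoothFun n) : smoothFun n :=
  (1 / ((l.factorial : ℂ) * (2 * Real.pi * Complex.I) ^ l)) •
    ∑ ι : Fin l → Fin n,
      ((List.ofFn ι).foldr (fun i h => dirDeriv (ey i) h) f) *
        ((List.ofFn ι).foldr (fun i h => dirDeriv (ex i) h) g)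

/-- The star product `f ⋆ g = ∑ l, ħ^l C_l(f, g)` on `C^∞(X, ℂ)[[ħ]]`, extended
`ℂ[[ħ]]`-bilinearly from `C^∞(X, ℂ)`:
`(∑ ħ^a F_a) ⋆ (∑ ħ^b G_b) = ∑_N ħ^N ∑_{l + a + b = N} C_l(F_a, G_b)`. -/
def starProduct {n : ℕ} (F G : (smoothFun n)⟦X⟧) : (smoothFun n)⟦X⟧ :=
  PowerSeries.mk fun N =>
    ∑ p ∈ Finset.HasAntidiagonal.antidiagonal N,
      ∑ q ∈ Finset.HasAntidiagonal.antidiagonal p.2,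
      starCoeff p.1 (PowerSeries.coeff q.1 F) (PowerSeries.coeff q.2 G)

/-- `∫_X F e^{ω/ħ}` for `F = ∑ ħ^j F_j ∈ C^∞(X, ℂ)[[ħ]]`, i.e. the formal Laurent series
`∑ j, ħ^{j-n} ∫_X F_j ωⁿ/n!`. -/
def formalTrace (n : ℕ) (F : (smoothFun n)⟦X⟧) : ℂ⸨X⸩ :=
  HahnSeries.single (-(n : ℤ)) (1 : ℂ) *
    HahnSeries.ofPowerSeries ℤ ℂ
      (PowerSeries.mk fun j => liouvilleIntegral (PowerSeries.coeff j F))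

/-- Trace maps for a product `star` on `C^∞(X, ℂ)[[ħ]]`: the `ℂ[[ħ]]`-linear continuous
functionals `C^∞(X, ℂ)[[ħ]] → ħ⁻ⁿ ℂ[[ħ]]` with `Tr(F ⋆ G) = Tr(G ⋆ F)` and
`Tr(f) = ∫_X f e^{ω/ħ} + O(ħ^{1-n})` for `f ∈ C^∞(X, ℂ)`. Continuity is for the product topologies
on formal series (the `C^∞` topology on coefficients in `C^∞(X, ℂ)`), stated with seminorms. -/
structure IsTraceMap {n : ℕ} (star : (smoothFun n)⟦X⟧ → (smoothFun n)⟦X⟧ → (smoothFun n)⟦X⟧)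
    (T : (smoothFun n)⟦X⟧ → ℂ⸨X⸩) : Prop where
  map_add : ∀ F G, T (F + G) = T F + T G
  map_smul : ∀ (c : ℂ⟦X⟧) (F : (smoothFun n)⟦X⟧), T (c • F) = c • T F
  range : ∀ (F : (smoothFun n)⟦X⟧) (j : ℤ), j < -(n : ℤ) → (T F).coeff j = 0
  continuous : ∀ j : ℤ, ∃ (N : ℕ) (C : ℝ), ∀ (F : (smoothFun n)⟦X⟧) (B : ℝ),
    (∀ a ≤ N, ∀ l ≤ N, ∀ u ∈ unitCube n,
      ‖iteratedFDeriv ℝ l (PowerSeries.coeff a F).1 u‖ ≤ B) → ‖(T F).coeff j‖ ≤ C * B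
  trace : ∀ F G, T (star F G) = T (star G F)
  leading : ∀ (f : smoothFun n) (j : ℤ), j < 1 - (n : ℤ) →
    (T (PowerSeries.C f)).coeff j = (formalTrace n (PowerSeries.C f)).coeff j

/-- `L ∈ ħ⁻ⁿ ℂ[[ħ]]` is the asymptotic expansion of the sequence `a k` as `ħ = 1/k → 0⁺`:
for every `N`, `a k - ∑_{-n ≤ j < N} L_j ħ^j = O(ħ^N)`. -/
def HasAsymptoticExpansion (n : ℕ) (a : ℕ → ℂ) (L : ℂ⸨X⸩) : Prop :=
  (∀ j : ℤ, j < -(n : ℤ) → L.coeff j = 0) ∧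
    ∀ N : ℤ, (fun k : ℕ => a k - ∑ j ∈ Finset.Ico (-(n : ℤ)) N, L.coeff j * ((k : ℂ)⁻¹) ^ j)
      =O[Filter.atTop] fun k : ℕ => ((k : ℝ)⁻¹) ^ N

/-! ### Sections of the prequantum line bundle `L^{⊗k}` -/

/-- The factor of automorphy `α(λ)^k e^{-kπi ω(u, λ)}` of `L^{⊗k}`, with the semi-character
`α(λ) = (-1)^{∑ λ_i λ_{n+i}}`. -/
def automorphy {n : ℕ} (k : ℕ) (l : Lat n) (u : Cov n) : ℂ :=
  ((-1 : ℂ) ^ (∑ i, l.1 i * l.2 i)) ^ k *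
    Complex.exp (-(k * Real.pi * sympForm u l.toCov : ℝ) * Complex.I)

/-- `Γ^∞(X, L^{⊗k})`: smooth functions on `ℝ²ⁿ` with
`s(u + λ) = α(λ)^k e^{-kπi ω(u, λ)} s(u)`. -/
def smoothSection (n k : ℕ) : Submodule ℂ (Cov n → ℂ) where
  carrier := {s | ContDiff ℝ ∞ s ∧
    ∀ (l : Lat n) (u : Cov n), s (u + l.toCov) = automorphy k l u * s u}
  add_mem' := fun {s t} hs ht =>
    ⟨hs.1.add ht.1, fun l u => by simp only [Pi.add_apply, hs.2 l u, ht.2 l u, mul_add]⟩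
  zero_mem' := ⟨contDiff_const, fun l u => by simp⟩
  smul_mem' := fun c s hs =>
    ⟨hs.1.const_smul c, fun l u => by
      simp only [Pi.smul_apply, hs.2 l u, smul_eq_mul]; ring⟩

/-- The product of a smooth function on `X` and a smooth section of `L^{⊗k}`. -/
def mulSection {n k : ℕ} (f : smoothFun n) (s : smoothSection n k) : smoothSection n k :=
  ⟨fun u => f.1 u * s.1 u, f.2.1.mul s.2.1, fun l u => by
    simp only [f.2.2 l u, s.2.2 l u]; ring⟩

theorem hasFDerivAt_automorphy {n : ℕ} (k : ℕ) (l : Lat n) (u : Cov n) :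
    HasFDerivAt (automorphy k l)
      ((sympCLM l.toCov).smulRight (-(k * Real.pi : ℝ) * Complex.I * automorphy k l u)) u := by
  have h1 : HasFDerivAt (fun v : Cov n => ((sympForm v l.toCov : ℝ) : ℂ))
      (Complex.ofRealCLM.comp (sympCLM l.toCov)) u :=
    (Complex.ofRealCLM.comp (sympCLM l.toCov)).hasFDerivAt
  have h2 := ((h1.const_mul (-(k * Real.pi : ℝ) * Complex.I : ℂ)).cexp).const_mul
    (((-1 : ℂ) ^ (∑ i, l.1 i * l.2 i)) ^ k)
  have e : automorphy k l = fun v => ((-1 : ℂ) ^ (∑ i, l.1 i * l.2 i)) ^ k *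
      Complex.exp ((-(k * Real.pi : ℝ) * Complex.I : ℂ) * ((sympForm v l.toCov : ℝ) : ℂ)) := by
    funext v
    simp only [automorphy]
    congr 2
    push_cast
    ring
  have e2 : (sympCLM l.toCov).smulRight (-(k * Real.pi : ℝ) * Complex.I * automorphy k l u) =
      (((-1 : ℂ) ^ (∑ i, l.1 i * l.2 i)) ^ k) •
        (Complex.exp ((-(k * Real.pi : ℝ) * Complex.I : ℂ) * ((sympForm u l.toCov : ℝ) : ℂ)) •
          ((-(k * Real.pi : ℝ) * Complex.I : ℂ) • (Complex.ofRealCLM.comp (sympCLM l.toCov)))) := by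
    refine ContinuousLinearMap.ext fun v => ?_
    rw [e]
    simp
    ring
  rw [e2, e]
  exact h2

theorem contDiff_automorphy {n : ℕ} (k : ℕ) (l : Lat n) : ContDiff ℝ ∞ (automorphy k l) := by
  have h1 : ContDiff ℝ ∞ (fun v : Cov n => ((sympForm v l.toCov : ℝ) : ℂ)) :=
    (Complex.ofRealCLM.comp (sympCLM l.toCov)).contDiff
  have e : automorphy k l = fun v => ((-1 : ℂ) ^ (∑ i, l.1 i * l.2 i)) ^ k *
      Complex.exp ((-(k * Real.pi : ℝ) * Complex.I : ℂ) * ((sympForm v l.toCov : ℝ) : ℂ)) := by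
    funext v
    simp only [automorphy]
    congr 2
    push_cast
    ring
  rw [e]
  exact contDiff_const.mul (contDiff_const.mul h1).cexp

/-- The covariant derivative `∇^ħ_w = ∂_w - kπi ∑ (y_i dx_i - x_i dy_i)(w)` along the constant
vector field `w`, on smooth sections of `L^{⊗k}`; note `∑ (y_i dx_i - x_i dy_i)(w) = ω(u, w)`
at the point `u = (x, y)`. -/
def covDeriv {n k : ℕ} (w : Cov n) (s : smoothSection n k) : smoothSection n k :=
  ⟨fun u => fderiv ℝ s.1 u w - (k * Real.pi * sympForm u w : ℝ) * Complex.I * s.1 u, by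
    refine ((s.2.1.fderiv_right (m := ∞) (by simp)).clm_apply contDiff_const).sub
      (ContDiff.mul (ContDiff.mul ?_ contDiff_const) s.2.1)
    exact Complex.ofRealCLM.contDiff.comp (contDiff_const.mul (sympCLM w).contDiff), by
    intro l u
    have hs : DifferentiableAt ℝ s.1 u := (s.2.1.differentiable (by simp)) u
    have h : (fun v => s.1 (v + l.toCov)) = fun v => automorphy k l v * s.1 v :=
      funext fun v => s.2.2 l v
    have h1 : fderiv ℝ s.1 (u + l.toCov) w = automorphy k l u * fderiv ℝ s.1 u w
        - (k * Real.pi : ℝ) * sympForm w l.toCov * Complex.I * automorphy k l u * s.1 u := by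
      rw [← fderiv_comp_add_right, h]
      have h2 := ((hasFDerivAt_automorphy k l u).mul hs.hasFDerivAt).fderiv
      have h3 : (automorphy k l * s.1) = fun v => automorphy k l v * s.1 v := rfl
      rw [h3] at h2
      rw [h2]
      simp
      ring
    simp only [h1, s.2.2 l u, sympForm_add_left, sympForm_swap w l.toCov]
    push_cast
    ring⟩

/-- `Γ^{-∞}(X, L^{⊗k})`: distributional sections `s`, as the continuous conjugate-linear functionals
`τ ↦ ⟨s, τ⟩` on `Γ^∞(X, L^{⊗k})`. Continuity is that for the `C^∞` topology: the functional is
bounded by finitely many derivatives on a compact set that covers `X`. -/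
def distSection (n k : ℕ) : Submodule ℂ (smoothSection n k →ₛₗ[starRingEnd ℂ] ℂ) where
  carrier := {s | ∃ (N : ℕ) (C : ℝ), ∀ (τ : smoothSection n k) (B : ℝ),
    (∀ l ≤ N, ∀ u ∈ unitCube n, ‖iteratedFDeriv ℝ l τ.1 u‖ ≤ B) → ‖s τ‖ ≤ C * B}
  add_mem' := by
    rintro s t ⟨N, C, h⟩ ⟨N', C', h'⟩
    refine ⟨max N N', C + C', fun τ B hB => ?_⟩
    have h1 := h τ B fun l hl => hB l (hl.trans (le_max_left _ _))
    have h2 := h' τ B fun l hl => hB l (hl.trans (le_max_right _ _))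
    calc ‖(s + t) τ‖ ≤ ‖s τ‖ + ‖t τ‖ := norm_add_le _ _
      _ ≤ (C + C') * B := by linarith
  zero_mem' := ⟨0, 0, fun τ B _ => by simp⟩
  smul_mem' := by
    rintro c s ⟨N, C, h⟩
    refine ⟨N, ‖c‖ * C, fun τ B hB => ?_⟩
    have h1 := h τ B hB
    calc ‖(c • s) τ‖ = ‖c‖ * ‖s τ‖ := by simp
      _ ≤ ‖c‖ * (C * B) := by gcongr
      _ = ‖c‖ * C * B := by ring

/-- The product `f s` of a smooth function and a distributional section:
`⟨f s, τ⟩ = ⟨s, f̄ τ⟩`. -/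
def mulDist {n k : ℕ} (f : smoothFun n) (s : distSection n k) : distSection n k :=
  ⟨{ toFun := fun τ => s.1 (mulSection (conjFun f) τ)
     map_add' := fun τ τ' => by
      rw [← map_add]; congr 1; apply Subtype.ext; funext u
      simp [mulSection, mul_add]
     map_smul' := fun c τ => by
      rw [← map_smulₛₗ]; congr 1; apply Subtype.ext; funext u
      simp [mulSection]; ring }, by
    obtain ⟨N, C, h⟩ := s.2
    have hbd : ∀ l : ℕ, ∃ M : ℝ, 0 ≤ M ∧ ∀ u ∈ unitCube n,
        ‖iteratedFDeriv ℝ l (conjFun f).1 u‖ ≤ M := fun l => by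
      obtain ⟨M, hM⟩ := (isCompact_Icc (a := (0 : Cov n)) (b := 1)).exists_bound_of_continuousOn
        (((conjFun f).2.1.continuous_iteratedFDeriv (m := l)
          (by exact_mod_cast le_top)).continuousOn)
      exact ⟨max M 0, le_max_right _ _, fun u hu => (hM u hu).trans (le_max_left _ _)⟩
    choose M hM0 hM using hbd
    set K : ℝ := ∑ l ∈ Finset.range (N + 1), ∑ i ∈ Finset.range (l + 1), (l.choose i : ℝ) * M i
      with hK
    refine ⟨N, C * K, fun τ B hB => ?_⟩
    have hB0 : 0 ≤ B := (norm_nonneg _).trans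
      (hB 0 (Nat.zero_le _) 0 (by simp [unitCube]))
    have := h (mulSection (conjFun f) τ) (K * B) fun l hl u hu => by
      refine (norm_iteratedFDeriv_mul_le (N := ∞) (conjFun f).2.1 τ.2.1 u
        (n := l) (by exact_mod_cast le_top)).trans ?_
      calc ∑ i ∈ Finset.range (l + 1), (l.choose i : ℝ) * ‖iteratedFDeriv ℝ i (conjFun f).1 u‖
              * ‖iteratedFDeriv ℝ (l - i) τ.1 u‖
          ≤ ∑ i ∈ Finset.range (l + 1), (l.choose i : ℝ) * M i * B := by
            refine Finset.sum_le_sum fun i _ => ?_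
            have h1 := hM i u hu
            have h2 := hB (l - i) ((Nat.sub_le _ _).trans hl) u hu
            have h3 := hM0 i
            gcongr
        _ = (∑ i ∈ Finset.range (l + 1), (l.choose i : ℝ) * M i) * B := by
            rw [Finset.sum_mul]
        _ ≤ K * B := by
            refine mul_le_mul_of_nonneg_right ?_ hB0
            exact Finset.single_le_sum
              (f := fun l : ℕ => ∑ i ∈ Finset.range (l + 1), (l.choose i : ℝ) * M i)
              (fun l _ => Finset.sum_nonneg fun i _ => mul_nonneg (Nat.cast_nonneg _) (hM0 i))
              (Finset.mem_range.mpr (Nat.lt_succ_of_le hl))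
    calc _ ≤ C * (K * B) := this
      _ = C * K * B := by ring⟩

/-- The quantum Hilbert space `ℋ^ħ` in the real polarization `𝒫^T`, `ħ = 1/k`: distributional
sections `s` of `L^{⊗k}` with `∇^ħ_{∂/∂x_i} s = 0` for all `i`, where
`⟨∇^ħ_{∂/∂x_i} s, τ⟩ = -⟨s, ∇^ħ_{∂/∂x_i} τ⟩`. (The polarization `𝒫^T` is framed by the real,
divergence-free vector fields `∂/∂x_i`.) The half-form line `ℂρ` is trivialized by its generator
`ρ`: an element `s` here stands for `s ⊗ ρ`. -/
def quantumSpace (n k : ℕ) : Submodule ℂ (distSection n k) where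
  carrier := {s | ∀ (i : Fin n) (τ : smoothSection n k), s.1 (covDeriv (ex i) τ) = 0}
  add_mem' := fun {s t} hs ht i τ => by
    simp [hs i τ, ht i τ]
  zero_mem' := fun i τ => by simp
  smul_mem' := fun c s hs i τ => by
    simp [hs i τ]

/-! ### The Bohr–Sommerfeld bases -/

/-- The Weil–Brezin coefficient
`(τ)_{[m]}(y) = ∫_{[0,1]ⁿ} τ̃(x, y + ħm) e^{-2πi m·x} dx`, `τ̃(x, y) = e^{kπi x·y} τ(x, y)`,
for an integer vector `m`; it depends on `m` modulo `k` only. -/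
def weilBrezin {n k : ℕ} (τ : smoothSection n k) (m : Fin n → ℤ) (y : Fin n → ℝ) : ℂ :=
  ∫ x in Set.Icc (0 : Fin n → ℝ) 1,
    Complex.exp ((k * Real.pi * ∑ i, x i * (y i + (m i : ℝ) / k) : ℝ) * Complex.I) *
      τ.1 (x, fun i => y i + (m i : ℝ) / k) *
        Complex.exp (-(2 * Real.pi * ∑ i, (m i : ℝ) * x i : ℝ) * Complex.I)

/-- The integer vector representing an element of `ℤ_kⁿ = {0, …, k-1}ⁿ`. -/
def intRep {n k : ℕ} (m : Fin n → Fin k) : Fin n → ℤ := fun i => ((m i : ℕ) : ℤ)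

/-- `ϑ^m`, the distributional section whose Weil–Brezin coefficients are
`(ϑ^m)_{m'} = δ_{m,m'} (2k)^{-n/2} δ_0`, as the functional `τ ↦ ⟨ϑ^m, τ⟩`. The pairing is
`⟨s, τ⟩ = ∑_{m'} ⟨(s)_{m'}, (τ)_{m'}⟩`, the Weil–Brezin transform being unitary. -/
def theta {n k : ℕ} (m : Fin n → Fin k) (τ : smoothSection n k) : ℂ :=
  (((2 * k : ℝ) ^ (-(n : ℝ) / 2) : ℝ) : ℂ) * (starRingEnd ℂ) (weilBrezin τ (intRep m) 0)

/-- `ϑ̌^m`, the distributional section whose Weil–Brezin coefficients are the constants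
`(ϑ̌^m)_{m'} = δ_{m,m'} 2^{-n/2}`, as the functional `τ ↦ ⟨ϑ̌^m, τ⟩`. -/
def thetaCheck {n k : ℕ} (m : Fin n → Fin k) (τ : smoothSection n k) : ℂ :=
  (((2 : ℝ) ^ (-(n : ℝ) / 2) : ℝ) : ℂ) *
    ∫ y : Fin n → ℝ, (starRingEnd ℂ) (weilBrezin τ (intRep m) y)

/-- The normalization `2^{n/4} k^{n/2}` of the bases. -/
def basisNorm (n k : ℕ) : ℝ := (2 : ℝ) ^ ((n : ℝ) / 4) * (k : ℝ) ^ ((n : ℝ) / 2)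

/-- `σ^m = 2^{n/4} k^{n/2} ϑ^m ⊗ ρ` (with `ρ` omitted). -/
def sigma {n k : ℕ} (m : Fin n → Fin k) (τ : smoothSection n k) : ℂ :=
  (basisNorm n k : ℂ) * theta m τ

/-- `σ̌^m = 2^{n/4} k^{n/2} ϑ̌^m ⊗ ρ̌` (with `ρ̌` omitted). -/
def sigmaCheck {n k : ℕ} (m : Fin n → Fin k) (τ : smoothSection n k) : ℂ :=
  (basisNorm n k : ℂ) * thetaCheck m τ

/-- The pairing `⟨ρ, ρ̌⟩ = 2^{n/2} k^{-n/2}` of the half-form generators. -/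
def halfFormPairing (n k : ℕ) : ℝ := (2 : ℝ) ^ ((n : ℝ) / 2) * (k : ℝ) ^ (-(n : ℝ) / 2)

/-! ### The pairing of distributional sections with transversal wavefront sets -/

/-- Smooth real functions with compact support on the universal cover. -/
structure Cutoff (n : ℕ) where
  /-- the underlying function -/
  toFun : Cov n → ℝ
  smooth : ContDiff ℝ ∞ toFun
  compact : HasCompactSupport toFun

theorem automorphy_add {n : ℕ} (k : ℕ) (l m : Lat n) (u : Cov n) :
    automorphy k (l + m) (u + m.toCov) = automorphy k m u * automorphy k l u := by
  have hω : ∀ v : Cov n, sympForm v v = 0 := fun v => by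
    simp only [sympForm]; exact Finset.sum_eq_zero fun i _ => by ring
  have hint : (sympForm m.toCov l.toCov : ℝ) =
      ((∑ i, (m.2 i * l.1 i - m.1 i * l.2 i) : ℤ) : ℝ) := by
    simp [sympForm, Lat.toCov]
  set z : ℤ := ∑ i, (m.2 i * l.1 i - m.1 i * l.2 i) with hz
  set w : ℤ := ∑ i, m.1 i * l.2 i with hw
  have hsum : (∑ i, (l + m).1 i * (l + m).2 i : ℤ) =
      (∑ i, l.1 i * l.2 i) + (∑ i, m.1 i * m.2 i) + (z + 2 * w) := by
    simp only [hz, hw, Finset.mul_sum, ← Finset.sum_add_distrib]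
    exact Finset.sum_congr rfl fun i _ => by simp; ring
  have hexp : Complex.exp (-(k * Real.pi * (z : ℝ) : ℝ) * Complex.I) = ((-1 : ℂ) ^ z) ^ k := by
    have h0 : Complex.exp (-(Real.pi * Complex.I)) = -1 := by
      rw [Complex.exp_neg, Complex.exp_pi_mul_I]; norm_num
    rw [← h0, ← Complex.exp_int_mul, ← Complex.exp_nat_mul]
    congr 1
    push_cast
    ring
  have hsq : (((-1 : ℂ) ^ z) ^ k) * (((-1 : ℂ) ^ z) ^ k) = 1 := by
    rw [← mul_pow, ← mul_zpow]; simp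
  have hw2 : ((-1 : ℂ) ^ (2 * w)) = 1 := by
    rw [zpow_mul]; simp
  have hne : (-1 : ℂ) ≠ 0 := by norm_num
  unfold automorphy
  rw [hsum, zpow_add₀ hne, zpow_add₀ hne, zpow_add₀ hne, hw2, mul_one, mul_pow, mul_pow]
  rw [Lat.toCov_add, sympForm_add_left, sympForm_add_right, sympForm_add_right, hω, add_zero, hint]
  have hsplit : Complex.exp (-(k * Real.pi *
        (sympForm u l.toCov + sympForm u m.toCov + (z : ℝ)) : ℝ) * Complex.I) =
      Complex.exp (-(k * Real.pi * sympForm u l.toCov : ℝ) * Complex.I) *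
      Complex.exp (-(k * Real.pi * sympForm u m.toCov : ℝ) * Complex.I) *
      Complex.exp (-(k * Real.pi * (z : ℝ) : ℝ) * Complex.I) := by
    rw [← Complex.exp_add, ← Complex.exp_add]
    congr 1
    push_cast
    ring
  rw [hsplit, hexp]
  linear_combination (((-1 : ℂ) ^ (∑ i, l.1 i * l.2 i)) ^ k *
    ((-1 : ℂ) ^ (∑ i, m.1 i * m.2 i)) ^ k *
      Complex.exp (-(k * Real.pi * sympForm u l.toCov : ℝ) * Complex.I) *
      Complex.exp (-(k * Real.pi * sympForm u m.toCov : ℝ) * Complex.I)) * hsq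

theorem automorphy_sub_self {n : ℕ} (k : ℕ) (l : Lat n) (u : Cov n) :
    automorphy k l (u - l.toCov) = automorphy k l u := by
  have hω : sympForm l.toCov l.toCov = 0 := by
    simp only [sympForm]; exact Finset.sum_eq_zero fun i _ => by ring
  have h := sympForm_add_left (u - l.toCov) l.toCov l.toCov
  rw [sub_add_cancel, hω, add_zero] at h
  simp only [automorphy, h]

theorem locallyFinite_translates {n : ℕ} {ψ : Cov n → ℂ} (hc : HasCompactSupport ψ) (k : ℕ) :
    LocallyFinite fun l : Lat n =>
      Function.support fun u : Cov n => automorphy k l u * ψ (u - l.toCov) := by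
  obtain ⟨R, hR⟩ := hc.isCompact.isBounded.subset_closedBall (0 : Cov n)
  intro u0
  refine ⟨Metric.ball u0 1, Metric.ball_mem_nhds _ one_pos, ?_⟩
  obtain ⟨M, hM⟩ := exists_nat_ge (R + ‖u0‖ + 1)
  refine ((Set.finite_Icc (fun _ : Fin n => -(M : ℤ)) (fun _ => (M : ℤ))).prod
    (Set.finite_Icc (fun _ : Fin n => -(M : ℤ)) (fun _ => (M : ℤ)))).subset ?_
  rintro (l : Lat n) ⟨u, hu, hub⟩
  have h1 : ψ (u - l.toCov) ≠ 0 := right_ne_zero_of_mul hu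
  have h2 : ‖u - l.toCov‖ ≤ R := by
    simpa using hR (subset_tsupport _ h1)
  have h3 : ‖u - u0‖ < 1 := by simpa [dist_eq_norm] using hub
  have h4 : ‖l.toCov‖ ≤ M := by
    have e : l.toCov = -(u - l.toCov) + (u - u0) + u0 := by abel
    have := norm_add₃_le (a := -(u - l.toCov)) (b := u - u0) (c := u0)
    rw [← e, norm_neg] at this
    linarith
  have hx : ∀ i, |(l.1 i : ℝ)| ≤ M := fun i =>
    (norm_le_pi_norm l.toCov.1 i).trans ((norm_fst_le _).trans h4)
  have hy : ∀ i, |(l.2 i : ℝ)| ≤ M := fun i =>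
    (norm_le_pi_norm l.toCov.2 i).trans ((norm_snd_le _).trans h4)
  refine ⟨⟨fun i => ?_, fun i => ?_⟩, ⟨fun i => ?_, fun i => ?_⟩⟩
  · exact_mod_cast (abs_le.mp (hx i)).1
  · exact_mod_cast (abs_le.mp (hx i)).2
  · exact_mod_cast (abs_le.mp (hy i)).1
  · exact_mod_cast (abs_le.mp (hy i)).2

/-- The push-forward to `X` of a compactly supported smooth section `ψ` of the trivial line bundle on
the universal cover: `u ↦ ∑_λ (λ · ψ)(u)`, where `λ · (u, ξ) = (u + λ, α(λ)^k e^{-kπi ω(u, λ)} ξ)`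
is the action of the lattice that defines `L^{⊗k}`. -/
def pushForward {n : ℕ} (k : ℕ) (ψ : Cov n → ℂ) (hs : ContDiff ℝ ∞ ψ)
    (hc : HasCompactSupport ψ) : smoothSection n k :=
  ⟨fun u => ∑ᶠ l : Lat n, automorphy k l u * ψ (u - l.toCov), by
    rw [← contMDiff_iff_contDiff]
    refine contMDiff_finsum (fun l => ?_) (locallyFinite_translates hc k)
    rw [contMDiff_iff_contDiff]
    exact (contDiff_automorphy k l).mul (hs.comp (contDiff_id.sub contDiff_const)), by
    intro m u
    change ∑ᶠ l : Lat n, automorphy k l (u + m.toCov) * ψ (u + m.toCov - l.toCov) =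
      automorphy k m u * ∑ᶠ l : Lat n, automorphy k l u * ψ (u - l.toCov)
    rw [← finsum_comp_equiv (Equiv.addRight m), mul_finsum]
    refine finsum_congr fun l => ?_
    simp only [Equiv.coe_addRight]
    rw [automorphy_add, Lat.toCov_add, mul_assoc]
    congr 3
    abel⟩

/-- The function `χ(u) e^{2πi ζ·u}` on the universal cover. -/
def cutoffChar {n : ℕ} (χ : Cutoff n) (ζ u : Cov n) : ℂ :=
  (χ.toFun u : ℂ) *
    Complex.exp ((2 * Real.pi * (∑ i, ζ.1 i * u.1 i + ∑ i, ζ.2 i * u.2 i) : ℝ) * Complex.I)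

theorem contDiff_cutoffChar {n : ℕ} (χ : Cutoff n) (ζ : Cov n) :
    ContDiff ℝ ∞ (cutoffChar χ ζ) := by
  have := χ.smooth
  unfold cutoffChar
  refine (Complex.ofRealCLM.contDiff.comp this).mul (ContDiff.cexp (ContDiff.mul ?_ contDiff_const))
  refine Complex.ofRealCLM.contDiff.comp (contDiff_const.mul (ContDiff.add ?_ ?_))
  · exact ContDiff.sum fun i _ => contDiff_const.mul ((contDiff_apply ℝ ℝ i).comp contDiff_fst)
  · exact ContDiff.sum fun i _ => contDiff_const.mul ((contDiff_apply ℝ ℝ i).comp contDiff_snd)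

theorem hasCompactSupport_cutoffChar {n : ℕ} (χ : Cutoff n) (ζ : Cov n) :
    HasCompactSupport (cutoffChar χ ζ) := by
  refine HasCompactSupport.mul_right ?_
  exact χ.compact.comp_left (g := fun t : ℝ => (t : ℂ)) Complex.ofReal_zero

/-- The Fourier transform at `ζ` of the localization `χ u` to the universal cover of a distributional
section, `(χu)^(ζ) = ⟨χu, e^{2πi ζ·}⟩`. For a smooth section `u` it is
`∫_{ℝ²ⁿ} χ(p) u(p) e^{-2πi ζ·p} dp`. -/
def localFourier {n k : ℕ} (χ : Cutoff n) (u : smoothSection n k → ℂ) (ζ : Cov n) : ℂ :=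
  u (pushForward k (cutoffChar χ ζ) (contDiff_cutoffChar χ ζ) (hasCompactSupport_cutoffChar χ ζ))

/-- The pairing `⟨u, v⟩` of two distributional sections exists and equals `c`. It extends the `L²`
pairing `∫_X u v̄` of smooth sections, through the Parseval formula
`⟨u, v⟩ = ∫ (χ₁u)^(ζ) conj((χ₂v)^(ζ)) dζ` for localizations with `∑_λ (χ₁χ₂)(· - λ) = 1`, the
integral being required to converge absolutely. If the wavefront sets of `u` and `v` lie in the
conormal bundles of fibres of the two projections of `X`, then, locally uniformly, `(χ₁u)^` decays
rapidly off every conic neighbourhood of `{(0, η)}`, and `(χ₂v)^` off every conic neighbourhood of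
`{(ξ, 0)}`, which is how Hörmander's criterion provides the pairing. -/
def HasPairing {n k : ℕ} (u v : smoothSection n k → ℂ) (c : ℂ) : Prop :=
  ∀ χ₁ χ₂ : Cutoff n,
    (∀ p : Cov n, ∑ᶠ l : Lat n, χ₁.toFun (p - l.toCov) * χ₂.toFun (p - l.toCov) = 1) →
    MeasureTheory.Integrable
        (fun ζ : Cov n => localFourier χ₁ u ζ * (starRingEnd ℂ) (localFourier χ₂ v ζ)) ∧
      ∫ ζ : Cov n, localFourier χ₁ u ζ * (starRingEnd ℂ) (localFourier χ₂ v ζ) = c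

/-! ### Toeplitz operators -/

/-- `A` is the Toeplitz operator `s ↦ Π^ħ(f s)` on `ℋ^ħ`, where
`Π^ħ t = ∑_{m ∈ ℤ_kⁿ} ⟨t, σ̌^m⟩ σ^m`, the pairing being that of distributional sections times that
of half-forms. -/
def IsToeplitz {n k : ℕ} (f : smoothFun n) (A : Module.End ℂ (quantumSpace n k)) : Prop :=
  ∀ s : quantumSpace n k, ∃ c : (Fin n → Fin k) → ℂ,
    (∀ m, HasPairing (fun τ => (mulDist f s.1).1 τ) (sigmaCheck m) (c m)) ∧
      ∀ τ : smoothSection n k,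
        (A s).1.1 τ = ∑ m, (halfFormPairing n k : ℂ) * c m * sigma m τ

/-- The Toeplitz operator `Q_f^ħ` on `ℋ^ħ`, `ħ = 1/k`, for the pair of polarizations
`(𝒫^Ť, 𝒫^T)`: the operator singled out by `IsToeplitz`. -/
def toeplitz {n : ℕ} (k : ℕ) (f : smoothFun n) : Module.End ℂ (quantumSpace n k) :=
  Classical.epsilon fun A => IsToeplitz f A

end TorusQuant

end

open TorusQuant

/-!
The trace of a Toeplitz operator is computed exactly: with respect to a basis of `ℋ^ħ` indexed by
`ℤ_kⁿ` it is `k⁻ⁿ` times the sum of the values of `f` at the `k²ⁿ` points `(j / k, m / k)`, i.e. `kⁿ`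
times a Riemann sum of a smooth periodic function (`trace_toeplitz`). By aliasing, the error of such
a sum consists of the Fourier coefficients of `f` at the non-zero points of `kℤ²ⁿ`, hence is
`O(k^{-∞})` (`exists_trapezoid_le`).

*The quantum space.* Parallel transport once around the circle in the direction `∂/∂x i` multiplies
a section by the holonomy `e^{-2πi k y_i}`. Averaging transports along this circle shows that a
covariantly constant distributional section `s` does not see the difference between a section and its
average, and is annihilated by `e^{-2πi k y_i} - 1` (`quantumSpace_apply_avg`,
`quantumSpace_apply_holonomy`). The common zeros of these functions are the Bohr–Sommerfeld leaves
`y = m / k`, on which averaged sections are covariantly constant. If the integrals of `τ` over the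
leaves vanish, then its average vanishes on the leaves, and by Hadamard's lemma, with the functions
`y_i - m_i / k` replaced by `e^{-2πi k y_i} - 1`, it is a combination of these, so that `s` kills it
(`quantumSpace_apply_eq_zero`). Thus the integrations over the leaves `y = m / k`, `m ∈ ℤ_kⁿ`, span
`ℋ^ħ`; sections concentrated near a single leaf show that they are independent (`leafEquiv`).

*The pairing.* Up to normalization `ϑ^m` is integration over the leaf `y = m / k` (`theta_eq`), and by
unfolding and aliasing `ϑ̌^m` is a combination with coefficients `e^{2πi m·j/k}` of the integrations
over the leaves `x = j / k` (`thetaCheck_eq`). The Fourier transform of a localized density on a leaf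
of one family is a character in the conormal direction times a rapidly decaying function of the
other variable, so the integral that defines the pairing of two transversal leaves factors, and
Fourier inversion evaluates it at their intersection point (`hasPairing_theta_sigmaCheck`). The
pairing is unique because cutoffs that test it exist (`HasPairing.unique`). This gives the matrix of
the Toeplitz operator (`isToeplitz_iff`).

*The formal trace.* The star product commutes under the integral after integrating by parts `l` times
in `x` and `l` times in `y` (`liouvilleIntegral_listDeriv`, `isTraceMap_formalTrace`).
-/

noncomputable section

namespace TorusQuant

open MeasureTheory


/-! ### Smooth parametric integrals -/

section Parametric

variable {E Y : Type} [NormedAddCommGroup E] [NormedSpace ℝ E] [FiniteDimensional ℝ E]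
  [NormedAddCommGroup Y] [NormedSpace ℝ Y] [FiniteDimensional ℝ Y] [MeasureSpace Y] [BorelSpace Y]
  [IsLocallyFiniteMeasure (volume : Measure Y)]

theorem hasFDerivAt_setIntegral {F : E × Y → ℂ} (hF : ContDiff ℝ 1 F) {K : Set Y}
    (hK : IsCompact K) (u : E) :
    HasFDerivAt (fun u => ∫ y in K, F (u, y))
      (∫ y in K, (fderiv ℝ F (u, y)).comp (ContinuousLinearMap.inl ℝ E Y)) u := by
  have hc : Continuous fun p : E × Y =>
      (fderiv ℝ F p).comp (ContinuousLinearMap.inl ℝ E Y) :=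
    (hF.continuous_fderiv one_ne_zero).clm_comp continuous_const
  obtain ⟨M, hM⟩ := ((isCompact_closedBall u 1).prod hK).exists_bound_of_continuousOn
    hc.continuousOn
  have hfin : volume K < ⊤ := hK.measure_lt_top
  refine hasFDerivAt_integral_of_dominated_of_fderiv_le (bound := fun _ => M)
    (F' := fun u y => (fderiv ℝ F (u, y)).comp (ContinuousLinearMap.inl ℝ E Y))
    (Metric.ball_mem_nhds u one_pos) ?_ ?_ ?_ ?_ ?_ ?_
  · exact .of_forall fun v => (hF.continuous.comp (by fun_prop)).aestronglyMeasurable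
  · exact (hF.continuous.comp (by fun_prop)).continuousOn.integrableOn_compact hK
  · exact (hc.comp (by fun_prop)).aestronglyMeasurable
  · refine (ae_restrict_iff' hK.measurableSet).mpr (.of_forall fun y hy v hv => ?_)
    exact hM (v, y) ⟨Metric.ball_subset_closedBall hv, hy⟩
  · exact integrableOn_const hfin.ne
  · refine .of_forall fun y v _ => ?_
    exact ((hF.differentiable one_ne_zero (v, y)).hasFDerivAt).comp v
      ((hasFDerivAt_id v).prodMk (hasFDerivAt_const y v))

theorem fderiv_setIntegral {F : E × Y → ℂ} (hF : ContDiff ℝ 1 F) {K : Set Y}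
    (hK : IsCompact K) (u v : E) :
    fderiv ℝ (fun u => ∫ y in K, F (u, y)) u v = ∫ y in K, fderiv ℝ F (u, y) (v, 0) := by
  rw [(hasFDerivAt_setIntegral hF hK u).fderiv, ContinuousLinearMap.integral_apply]
  · simp
  · have hc : Continuous fun p : E × Y =>
        (fderiv ℝ F p).comp (ContinuousLinearMap.inl ℝ E Y) :=
      (hF.continuous_fderiv one_ne_zero).clm_comp continuous_const
    exact (hc.comp (by fun_prop : Continuous fun y : Y => (u, y))).continuousOn.integrableOn_compact
      hK

theorem contDiff_setIntegral {F : E × Y → ℂ} (hF : ContDiff ℝ ∞ F) {K : Set Y}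
    (hK : IsCompact K) : ContDiff ℝ ∞ fun u => ∫ y in K, F (u, y) := by
  refine contDiff_infty.mpr fun N => ?_
  induction N generalizing F with
  | zero =>
    have h1 : ContDiff ℝ 1 F := hF.of_le (by exact_mod_cast le_top)
    exact contDiff_zero.mpr (continuous_iff_continuousAt.mpr fun u =>
      (hasFDerivAt_setIntegral h1 hK u).continuousAt)
  | succ N ih =>
    have h1 : ContDiff ℝ 1 F := hF.of_le (by exact_mod_cast le_top)
    push_cast
    refine contDiff_succ_iff_fderiv_apply.mpr
      ⟨fun u => (hasFDerivAt_setIntegral h1 hK u).differentiableAt, by simp, fun v => ?_⟩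
    simp only [fderiv_setIntegral h1 hK]
    exact ih (F := fun p => fderiv ℝ F p (v, 0))
      ((hF.fderiv_right (m := ∞) (by simp)).clm_apply contDiff_const)

end Parametric

/-! ### Periodic functions and their Fourier coefficients -/

section Periodic

variable {ι : Type}

/-- The inclusion of `ℤ^ι` in `ℝ^ι`. -/
def intVec (p : ι → ℤ) : ι → ℝ := fun i => (p i : ℝ)

theorem intVec_neg (p : ι → ℤ) : intVec (-p) = -intVec p := by
  ext i; simp [intVec]

/-- `g` is a `ℤ^ι`-periodic function on `ℝ^ι`. -/
def IsPeriodic (g : (ι → ℝ) → ℂ) : Prop := ∀ (p : ι → ℤ) (x : ι → ℝ), g (x + intVec p) = g x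

/-- The function on the torus induced by a periodic function on `ℝ^ι`. -/
def torusLift (g : (ι → ℝ) → ℂ) (t : UnitAddTorus ι) : ℂ :=
  g fun i => (AddCircle.equivIoc 1 0 (t i)).1

theorem torusLift_coe {g : (ι → ℝ) → ℂ} (hg : IsPeriodic g) (x : ι → ℝ) :
    torusLift g (fun i => (x i : UnitAddCircle)) = g x := by
  have h : ∀ i, ∃ p : ℤ, x i = (AddCircle.equivIoc 1 0 (x i : UnitAddCircle)).1 + p := by
    intro i
    have h1 : (((AddCircle.equivIoc 1 0 (x i : UnitAddCircle)).1 : ℝ) : UnitAddCircle) = x i :=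
      AddCircle.coe_equivIoc
    obtain ⟨p, hp⟩ := AddSubgroup.mem_zmultiples_iff.mp (QuotientAddGroup.eq.mp h1)
    refine ⟨p, ?_⟩
    simp only [zsmul_eq_mul, mul_one] at hp
    linarith
  choose p hp using h
  have : x = (fun i => (AddCircle.equivIoc 1 0 (x i : UnitAddCircle)).1) + intVec p := by
    ext i; exact hp i
  conv_rhs => rw [this, hg]
  rfl

theorem iUnion_unit_cubes :
    ⋃ p : ι → ℤ, {x : ι → ℝ | ∀ i, x i ∈ Set.Ioc (intVec p i) (intVec p i + 1)} = Set.univ := by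
  refine Set.eq_univ_of_forall fun x => Set.mem_iUnion.mpr ⟨fun i => ⌈x i⌉ - 1, fun i => ?_⟩
  have h1 := Int.ceil_lt_add_one (x i)
  have h2 := Int.le_ceil (x i)
  constructor <;> simp only [intVec] <;> push_cast <;> linarith

theorem continuous_torusLift {g : (ι → ℝ) → ℂ} (hg : IsPeriodic g) (hc : Continuous g) :
    Continuous (torusLift g) := by
  have hq : IsOpenQuotientMap (Pi.map fun (_ : ι) (x : ℝ) => (x : UnitAddCircle)) :=
    IsOpenQuotientMap.piMap fun _ => QuotientAddGroup.isOpenQuotientMap_mk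
  rw [hq.isQuotientMap.continuous_iff]
  exact hc.congr fun x => (torusLift_coe hg x).symm

variable [Fintype ι]

theorem Icc_ae_eq_Ioc (a : ι → ℝ) :
    (Set.Icc a (a + 1) : Set (ι → ℝ)) =ᵐ[volume] {x | ∀ i, x i ∈ Set.Ioc (a i) (a i + 1)} := by
  have h := Measure.univ_pi_Ioc_ae_eq_Icc (μ := fun _ : ι => (volume : Measure ℝ)) (f := a)
    (g := a + 1)
  refine (h.symm.trans (Filter.EventuallyEq.of_eq ?_))
  ext x
  exact (Set.mem_univ_pi )

theorem setIntegral_Icc_eq_torus {g : (ι → ℝ) → ℂ} (hg : IsPeriodic g) (a b : ι → ℝ) :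
    ∫ x in Set.Icc a (a + 1), g x = ∫ x in Set.Icc b (b + 1), g x := by
  rw [setIntegral_congr_set (Icc_ae_eq_Ioc a), setIntegral_congr_set (Icc_ae_eq_Ioc b)]
  have h := (UnitAddTorus.integral_preimage (torusLift g) a).symm.trans
    (UnitAddTorus.integral_preimage (torusLift g) b)
  simpa only [torusLift_coe hg] using h

theorem setIntegral_Icc_add {g : (ι → ℝ) → ℂ} (hg : IsPeriodic g) (v : ι → ℝ) :
    ∫ x in Set.Icc (0 : ι → ℝ) 1, g (x + v) = ∫ x in Set.Icc (0 : ι → ℝ) 1, g x := by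
  have h := (measurePreserving_add_right (volume : Measure (ι → ℝ)) v).setIntegral_preimage_emb
    (measurableEmbedding_addRight v) g (Set.Icc v (v + 1))
  have h2 : (fun x : ι → ℝ => x + v) ⁻¹' Set.Icc v (v + 1) = Set.Icc 0 1 := by
    ext x; simp [add_comm v]
  rw [h2] at h
  rw [h, setIntegral_Icc_eq_torus hg v 0, zero_add]

/-- The integral over a period of a derivative of a periodic function vanishes. -/
theorem setIntegral_Icc_fderiv {g : (ι → ℝ) → ℂ} (hg : IsPeriodic g) (hs : ContDiff ℝ 1 g)
    (v : ι → ℝ) : ∫ x in Set.Icc (0 : ι → ℝ) 1, fderiv ℝ g x v = 0 := by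
  let F : ℝ × (ι → ℝ) → ℂ := fun p => g (p.2 + p.1 • v)
  have hF : ContDiff ℝ 1 F := hs.comp (by fun_prop)
  have h1 := fderiv_setIntegral hF (isCompact_Icc (a := (0 : ι → ℝ)) (b := 1)) 0 1
  have h2 : (fun t : ℝ => ∫ x in Set.Icc (0 : ι → ℝ) 1, F (t, x)) =
      fun _ => ∫ x in Set.Icc (0 : ι → ℝ) 1, g x :=
    funext fun t => setIntegral_Icc_add hg (t • v)
  rw [h2] at h1
  simp only [fderiv_fun_const, Pi.zero_apply, zero_apply] at h1
  rw [h1]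
  refine integral_congr_ae (.of_forall fun x => ?_)
  have hd := (hs.differentiable one_ne_zero (x + (0 : ℝ) • v)).hasFDerivAt
  have h3 : HasFDerivAt (fun p : ℝ × (ι → ℝ) => p.2 + p.1 • v)
      (ContinuousLinearMap.snd ℝ ℝ (ι → ℝ) +
        (ContinuousLinearMap.fst ℝ ℝ (ι → ℝ)).smulRight v) (0, x) :=
    hasFDerivAt_snd.add (hasFDerivAt_fst.smul_const v)
  have h4 := (HasFDerivAt.comp (0, x) hd h3).fderiv
  change _ = fderiv ℝ F (0, x) (1, 0)
  rw [show F = g ∘ fun p : ℝ × (ι → ℝ) => p.2 + p.1 • v from rfl, h4]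
  simp

/-- The phase `e^{2πi m·x}`. -/
def phase (m : ι → ℤ) (x : ι → ℝ) : ℂ :=
  Complex.exp ((2 * Real.pi * ∑ i, (m i : ℝ) * x i : ℝ) * Complex.I)

theorem norm_phase (m : ι → ℤ) (x : ι → ℝ) : ‖phase m x‖ = 1 :=
  Complex.norm_exp_ofReal_mul_I _

theorem phase_neg (m : ι → ℤ) (x : ι → ℝ) :
    phase (-m) x = Complex.exp (-(2 * Real.pi * ∑ i, (m i : ℝ) * x i : ℝ) * Complex.I) := by
  simp [phase]

theorem phase_add (m p : ι → ℤ) (x : ι → ℝ) : phase (m + p) x = phase m x * phase p x := by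
  simp only [phase, ← Complex.exp_add, Pi.add_apply, Int.cast_add, add_mul,
    Finset.sum_add_distrib]
  congr 1; push_cast; ring

theorem phase_add_right (m : ι → ℤ) (x y : ι → ℝ) :
    phase m (x + y) = phase m x * phase m y := by
  simp only [phase, ← Complex.exp_add, Pi.add_apply, mul_add, Finset.sum_add_distrib]
  congr 1; push_cast; ring

theorem phase_intVec (m p : ι → ℤ) : phase m (intVec p) = 1 := by
  rw [phase, Complex.exp_eq_one_iff]
  exact ⟨∑ i, m i * p i, by simp [intVec]; ring⟩

theorem isPeriodic_phase (m : ι → ℤ) : IsPeriodic (phase m) := fun p x => by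
  rw [phase_add_right, phase_intVec, mul_one]

theorem contDiff_phase (m : ι → ℤ) : ContDiff ℝ ∞ (phase m) := by
  unfold phase
  refine ContDiff.cexp (ContDiff.mul (Complex.ofRealCLM.contDiff.comp
    (contDiff_const.mul (ContDiff.sum fun i _ => contDiff_const.mul ?_))) contDiff_const)
  exact contDiff_apply ℝ ℝ i

theorem fderiv_phase (m : ι → ℤ) (x v : ι → ℝ) :
    fderiv ℝ (phase m) x v = (2 * Real.pi * ∑ i, (m i : ℝ) * v i : ℝ) * Complex.I * phase m x := by
  let L : (ι → ℝ) →L[ℝ] ℝ := ∑ i, (m i : ℝ) • ContinuousLinearMap.proj i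
  have hL : ∀ y, L y = ∑ i, (m i : ℝ) * y i := fun y => by simp [L]
  have h1 : HasFDerivAt (fun y => ((L y : ℝ) : ℂ)) (Complex.ofRealCLM.comp L) x :=
    (Complex.ofRealCLM.comp L).hasFDerivAt
  have h2 := (h1.const_mul ((2 * Real.pi : ℝ) * Complex.I : ℂ)).cexp
  have h3 : phase m = fun y => Complex.exp ((2 * Real.pi : ℝ) * Complex.I * ((L y : ℝ) : ℂ)) := by
    funext y; rw [phase, hL]; congr 1; push_cast; ring
  rw [h3, h2.fderiv]
  simp only [smul_apply, ContinuousLinearMap.comp_apply, hL,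
    Complex.ofRealCLM_apply, smul_eq_mul]
  push_cast; ring

/-- The Fourier coefficient `∫_{[0,1]^ι} g(x) e^{-2πi m·x} dx`. -/
def fourierCoef (g : (ι → ℝ) → ℂ) (m : ι → ℤ) : ℂ :=
  ∫ x in Set.Icc (0 : ι → ℝ) 1, g x * phase (-m) x

theorem mFourier_coe (m : ι → ℤ) (x : ι → ℝ) :
    UnitAddTorus.mFourier m (fun i => (x i : UnitAddCircle)) = phase m x := by
  simp only [UnitAddTorus.mFourier, ContinuousMap.coe_mk, fourier_coe_apply, phase,
    ← Complex.exp_sum]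
  congr 1
  push_cast
  rw [Finset.mul_sum, Finset.sum_mul]
  exact Finset.sum_congr rfl fun i _ => by ring

theorem mFourierCoeff_torusLift {g : (ι → ℝ) → ℂ} (hg : IsPeriodic g) (m : ι → ℤ) :
    UnitAddTorus.mFourierCoeff (torusLift g) m = fourierCoef g m := by
  rw [UnitAddTorus.mFourierCoeff_eq_integral _ _ 0, fourierCoef]
  have := setIntegral_congr_set (Icc_ae_eq_Ioc (0 : ι → ℝ)) (f := fun x => g x * phase (-m) x)
  rw [zero_add] at this
  rw [this]
  simp only [torusLift_coe hg, mFourier_coe, smul_eq_mul, mul_comm]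

theorem hasSum_fourierCoef {g : (ι → ℝ) → ℂ} (hg : IsPeriodic g) (hc : Continuous g)
    (hs : Summable (fourierCoef g)) (x : ι → ℝ) :
    HasSum (fun m => fourierCoef g m * phase m x) (g x) := by
  have h := UnitAddTorus.hasSum_mFourier_series_apply_of_summable
    (f := ⟨torusLift g, continuous_torusLift hg hc⟩)
    (by
      have : UnitAddTorus.mFourierCoeff (torusLift g) = fourierCoef g :=
        funext fun m => mFourierCoeff_torusLift hg m
      simpa [this] using hs) (fun i => (x i : UnitAddCircle))
  simpa [mFourier_coe, torusLift_coe hg, mFourierCoeff_torusLift hg] using h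

/-! ### Rapid decay of Fourier coefficients -/

theorem norm_fourierCoef_le {g : (ι → ℝ) → ℂ} {B : ℝ}
    (hB : ∀ x ∈ Set.Icc (0 : ι → ℝ) 1, ‖g x‖ ≤ B) (m : ι → ℤ) : ‖fourierCoef g m‖ ≤ B := by
  have hv : volume.real (Set.Icc (0 : ι → ℝ) 1) = 1 := by
    simp [measureReal_def, Real.volume_Icc_pi]
  have h := norm_setIntegral_le_of_norm_le_const (μ := volume) (s := Set.Icc (0 : ι → ℝ) 1)
    (f := fun x => g x * phase (-m) x) (C := B) (by simp [Real.volume_Icc_pi]) fun x hx => by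
      rw [norm_mul, norm_phase, mul_one]; exact hB x hx
  rwa [hv, mul_one] at h

theorem integrableOn_mul_phase {g : (ι → ℝ) → ℂ} (hg : Continuous g) (m : ι → ℤ) :
    IntegrableOn (fun x => g x * phase m x) (Set.Icc (0 : ι → ℝ) 1) :=
  (hg.mul (contDiff_phase m).continuous).continuousOn.integrableOn_compact isCompact_Icc

theorem fourierCoef_fderiv {g : (ι → ℝ) → ℂ} (hg : IsPeriodic g) (hs : ContDiff ℝ 1 g)
    (m : ι → ℤ) (v : ι → ℝ) :
    fourierCoef (fun x => fderiv ℝ g x v) m =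
      (2 * Real.pi * ∑ i, (m i : ℝ) * v i : ℝ) * Complex.I * fourierCoef g m := by
  have hp : ContDiff ℝ 1 (phase (-m)) := (contDiff_phase (-m)).of_le (by exact_mod_cast le_top)
  have h := setIntegral_Icc_fderiv (g := fun x => g x * phase (-m) x)
    (fun p x => congrArg₂ (· * ·) (hg p x) (isPeriodic_phase (-m) p x)) (hs.mul hp) v
  have h1 : ∀ x, fderiv ℝ (fun x => g x * phase (-m) x) x v =
      fderiv ℝ g x v * phase (-m) x -
        (2 * Real.pi * ∑ i, (m i : ℝ) * v i : ℝ) * Complex.I * (g x * phase (-m) x) := fun x => by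
    have h2 := ((hs.differentiable one_ne_zero x).hasFDerivAt.mul
      (hp.differentiable one_ne_zero x).hasFDerivAt).fderiv
    have h3 : (fun x => g x * phase (-m) x) = g * phase (-m) := rfl
    rw [h3, h2]
    simp only [add_apply, smul_apply, smul_eq_mul, fderiv_phase]
    simp
    ring
  simp only [h1] at h
  rw [integral_sub, integral_const_mul, sub_eq_zero] at h
  · exact h
  · exact integrableOn_mul_phase
      ((hs.continuous_fderiv one_ne_zero).clm_apply continuous_const) (-m)
  · exact (integrableOn_mul_phase hs.continuous (-m)).const_mul _

/-- The symbol `1 + 4π² |m|²` of `1 - Δ`. -/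
def symbolWeight (m : ι → ℤ) : ℝ := 1 + 4 * Real.pi ^ 2 * ∑ i, (m i : ℝ) ^ 2

theorem one_le_symbolWeight (m : ι → ℤ) : 1 ≤ symbolWeight m := by
  have : 0 ≤ 4 * Real.pi ^ 2 * ∑ i, (m i : ℝ) ^ 2 := by positivity
  unfold symbolWeight; linarith

theorem summable_prod_of_summable {f : ℤ → ℝ} (hf : ∀ a, 0 ≤ f a) (hs : Summable f) :
    Summable fun m : ι → ℤ => ∏ i, f (m i) := by
  classical
  refine summable_of_sum_le (c := ∏ _i : ι, ∑' a, f a)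
    (fun m => Finset.prod_nonneg fun i _ => hf _) fun u => ?_
  let t : ι → Finset ℤ := fun i => u.image fun m => m i
  calc ∑ m ∈ u, ∏ i, f (m i) ≤ ∑ m ∈ Fintype.piFinset t, ∏ i, f (m i) := by
        refine Finset.sum_le_sum_of_subset_of_nonneg (fun m hm => ?_)
          fun m _ _ => Finset.prod_nonneg fun i _ => hf _
        exact Fintype.mem_piFinset.mpr fun i => Finset.mem_image_of_mem (fun m => m i) hm
    _ = ∏ i, ∑ a ∈ t i, f a := (Finset.prod_univ_sum t fun _ a => f a).symm
    _ ≤ ∏ _i : ι, ∑' a, f a := Finset.prod_le_prod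
        (fun i _ => Finset.sum_nonneg fun a _ => hf a)
        fun i _ => hs.sum_le_tsum _ fun a _ => hf a

/-- The exponent `card ι` is sufficient: `symbolWeight m ^ card ι` dominates `∏ i, (1 + m i ^ 2)`. -/
theorem summable_symbolWeight :
    Summable fun m : ι → ℤ => (symbolWeight m ^ Fintype.card ι)⁻¹ := by
  have h0 : Summable fun a : ℤ => (1 + (a : ℝ) ^ 2)⁻¹ := by
    refine Summable.of_norm_bounded_eventually (g := fun a : ℤ => 1 / (a : ℝ) ^ 2)
      (Real.summable_one_div_int_pow.mpr one_lt_two) ?_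
    have : ∀ᶠ a : ℤ in Filter.cofinite, a ≠ 0 := by
      simpa using (Set.finite_singleton (0 : ℤ)).compl_mem_cofinite
    filter_upwards [this] with a ha
    have ha' : (0 : ℝ) < (a : ℝ) ^ 2 := by positivity
    rw [Real.norm_of_nonneg (by positivity), one_div]
    exact inv_anti₀ ha' (by linarith)
  refine Summable.of_nonneg_of_le (fun m => ?_) (fun m => ?_)
    (summable_prod_of_summable (fun a => by positivity) h0)
  · have := one_le_symbolWeight m; positivity
  · rw [Finset.prod_inv_distrib]
    refine inv_anti₀ (Finset.prod_pos fun i _ => by positivity) ?_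
    rw [← Finset.card_univ, ← Finset.prod_const]
    refine Finset.prod_le_prod (fun i _ => by positivity) fun i _ => ?_
    have h1 : (m i : ℝ) ^ 2 ≤ ∑ i, (m i : ℝ) ^ 2 :=
      Finset.single_le_sum (f := fun i => (m i : ℝ) ^ 2) (fun i _ => sq_nonneg _)
        (Finset.mem_univ i)
    have h2 : (1 : ℝ) ≤ 4 * Real.pi ^ 2 := by nlinarith [Real.pi_gt_three]
    have h3 : 0 ≤ ∑ i, (m i : ℝ) ^ 2 := Finset.sum_nonneg fun i _ => sq_nonneg _
    unfold symbolWeight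
    nlinarith

section Family

variable {E : Type} [NormedAddCommGroup E] [NormedSpace ℝ E]

theorem fderiv_slice {F : (ι → ℝ) × E → ℂ} (hF : ContDiff ℝ ∞ F) (y : E) (x v : ι → ℝ) :
    fderiv ℝ (fun x => F (x, y)) x v = fderiv ℝ F (x, y) (v, 0) := by
  have h := HasFDerivAt.comp x (f := fun x : ι → ℝ => (x, y))
    (hF.differentiable (by simp) (x, y)).hasFDerivAt
    ((hasFDerivAt_id x).prodMk (hasFDerivAt_const y x))
  change fderiv ℝ (F ∘ fun x => (x, y)) x v = _
  rw [h.fderiv]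
  simp

/-- The Fourier coefficients of a smooth family of smooth periodic functions decay rapidly,
uniformly on compact sets of parameters. -/
theorem exists_fourierCoef_le {F : (ι → ℝ) × E → ℂ} (hF : ContDiff ℝ ∞ F)
    (hp : ∀ y, IsPeriodic fun x => F (x, y)) {K : Set E} (hK : IsCompact K) (r : ℕ) :
    ∃ C : ℝ, ∀ y ∈ K, ∀ m : ι → ℤ,
      ‖fourierCoef (fun x => F (x, y)) m‖ ≤ C * (symbolWeight m ^ r)⁻¹ := by
  classical
  induction r generalizing F with
  | zero =>
    obtain ⟨B, hB⟩ := ((isCompact_Icc (a := (0 : ι → ℝ)) (b := 1)).prod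
      hK).exists_bound_of_continuousOn hF.continuous.continuousOn
    refine ⟨B, fun y hy m => ?_⟩
    simpa using norm_fourierCoef_le (fun x hx => hB (x, y) ⟨hx, hy⟩) m
  | succ r ih =>
    let D : ι → ((ι → ℝ) × E → ℂ) → ((ι → ℝ) × E → ℂ) :=
      fun i G p => fderiv ℝ G p (Pi.single i 1, 0)
    have hDs : ∀ i {G : (ι → ℝ) × E → ℂ}, ContDiff ℝ ∞ G → ContDiff ℝ ∞ (D i G) := fun i G hG =>
      (hG.fderiv_right (m := ∞) (by simp)).clm_apply contDiff_const
    have hDp : ∀ i {G : (ι → ℝ) × E → ℂ}, ContDiff ℝ ∞ G → (∀ y, IsPeriodic fun x => G (x, y)) →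
        ∀ y, IsPeriodic fun x => D i G (x, y) := fun i G hG h y p x => by
      have h1 : (fun x => G (x + intVec p, y)) = fun x => G (x, y) := funext fun x => h y p x
      change fderiv ℝ G (x + intVec p, y) _ = fderiv ℝ G (x, y) _
      rw [← fderiv_slice hG, ← fderiv_slice hG,
        ← fderiv_comp_add_right (f := fun x => G (x, y)), h1]
    have hDc : ∀ i {G : (ι → ℝ) × E → ℂ}, ContDiff ℝ ∞ G → (∀ y, IsPeriodic fun x => G (x, y)) →
        ∀ y m, fourierCoef (fun x => D i G (x, y)) m =
          (2 * Real.pi * (m i : ℝ) : ℝ) * Complex.I * fourierCoef (fun x => G (x, y)) m :=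
      fun i G hG h y m => by
        have h1 : ContDiff ℝ 1 fun x => G (x, y) :=
          (hG.comp (contDiff_id.prodMk contDiff_const)).of_le (by exact_mod_cast le_top)
        have h2 := fourierCoef_fderiv (h y) h1 m (Pi.single i 1)
        simp only [fderiv_slice hG] at h2
        simpa [Pi.single_apply] using h2
    -- `G = (1 - Δ) F`, with the Laplacian in the periodic variables
    let G : (ι → ℝ) × E → ℂ := fun p => F p - ∑ i, D i (D i F) p
    have hG : ContDiff ℝ ∞ G := hF.sub (ContDiff.sum fun i _ => hDs i (hDs i hF))
    obtain ⟨C, hC⟩ := ih hG fun y p x => by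
      change F _ - _ = F _ - _
      refine congrArg₂ (· - ·) (hp y p x) ?_
      exact Finset.sum_congr rfl fun i _ => hDp i (hDs i hF) (hDp i hF hp) y p x
    refine ⟨C, fun y hy m => ?_⟩
    have h1 : fourierCoef (fun x => G (x, y)) m =
        symbolWeight m * fourierCoef (fun x => F (x, y)) m := by
      have hsl : ∀ {H : (ι → ℝ) × E → ℂ}, ContDiff ℝ ∞ H → Continuous fun x => H (x, y) :=
        fun hH => hH.continuous.comp (by fun_prop)
      have h2 : fourierCoef (fun x => G (x, y)) m = fourierCoef (fun x => F (x, y)) m -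
          ∑ i, fourierCoef (fun x => D i (D i F) (x, y)) m := by
        simp only [fourierCoef, G, sub_mul, Finset.sum_mul]
        rw [integral_sub (integrableOn_mul_phase (hsl hF) _)
          (integrable_finsetSum _ fun i _ => integrableOn_mul_phase (hsl (hDs i (hDs i hF))) _),
          integral_finsetSum _ fun i _ => integrableOn_mul_phase (hsl (hDs i (hDs i hF))) _]
      rw [h2]
      simp only [hDc _ (hDs _ hF) (hDp _ hF hp), hDc _ hF hp, symbolWeight]
      push_cast
      rw [add_mul, one_mul, sub_eq_add_neg, Finset.mul_sum, Finset.sum_mul,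
        ← Finset.sum_neg_distrib]
      congr 1
      refine Finset.sum_congr rfl fun i _ => ?_
      linear_combination -(4 * (Real.pi : ℂ) ^ 2 * (m i : ℂ) ^ 2 *
        fourierCoef (fun x => F (x, y)) m) * Complex.I_sq
    have h3 := hC y hy m
    have h4 := one_le_symbolWeight m
    rw [h1, norm_mul, Complex.norm_real, Real.norm_of_nonneg (by linarith)] at h3
    rw [pow_succ, mul_inv, ← mul_assoc, ← div_eq_mul_inv, le_div_iff₀ (by linarith), mul_comm]
    exact h3

theorem summable_fourierCoef {g : (ι → ℝ) → ℂ} (hg : IsPeriodic g) (hs : ContDiff ℝ ∞ g) :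
    Summable (fourierCoef g) := by
  obtain ⟨C, hC⟩ := exists_fourierCoef_le (E := ℝ) (F := fun p => g p.1) (hs.comp contDiff_fst)
    (fun _ => hg) (isCompact_singleton (x := 0)) (Fintype.card ι)
  exact Summable.of_norm_bounded (summable_symbolWeight.mul_left C) fun m => hC 0 rfl m

end Family

/-! ### Aliasing -/

section Aliasing

variable [DecidableEq ι]

/-- The point `j / k` of the grid `(ℤ/k)^ι`. -/
def gridPt (k : ℕ) (j : ι → ℤ) : ι → ℝ := fun i => (j i : ℝ) / k

/-- The integer representatives of the grid points of the unit cube. -/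
def finVec {k : ℕ} (j : ι → Fin k) : ι → ℤ := fun i => ((j i : ℕ) : ℤ)

/-- Orthogonality of the characters of `(ℤ/k)^ι`. -/
theorem sum_phase_gridPt {k : ℕ} (hk : 0 < k) (m : ι → ℤ) [Decidable (∀ i, (k : ℤ) ∣ m i)] :
    ∑ j : ι → Fin k, phase m (gridPt k (finVec j)) =
      if ∀ i, (k : ℤ) ∣ m i then (k : ℂ) ^ Fintype.card ι else 0 := by
  classical
  have hk' : (k : ℂ) ≠ 0 := by exact_mod_cast hk.ne'
  let z : ι → ℂ := fun i => Complex.exp (2 * Real.pi * Complex.I * ((m i : ℂ) / k))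
  have h1 : ∀ j : ι → Fin k, phase m (gridPt k (finVec j)) = ∏ i, z i ^ (j i : ℕ) := fun j => by
    simp only [phase, z, ← Complex.exp_nat_mul, ← Complex.exp_sum]
    congr 1
    push_cast [gridPt, finVec]
    rw [Finset.mul_sum, Finset.sum_mul]
    exact Finset.sum_congr rfl fun i _ => by ring
  have h2 : ∑ j : ι → Fin k, phase m (gridPt k (finVec j)) =
      ∏ i, ∑ a : Fin k, z i ^ (a : ℕ) := by
    rw [Finset.prod_univ_sum, Fintype.piFinset_univ]
    exact Finset.sum_congr rfl fun j _ => h1 j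
  have hz : ∀ i, z i = 1 ↔ (k : ℤ) ∣ m i := fun i => by
    rw [Complex.exp_eq_one_iff]
    have hpi : (2 * Real.pi * Complex.I : ℂ) ≠ 0 := Complex.two_pi_I_ne_zero
    constructor
    · rintro ⟨a, ha⟩
      rw [mul_comm, mul_left_inj' hpi, div_eq_iff hk'] at ha
      exact ⟨a, by rw [mul_comm]; exact_mod_cast ha⟩
    · rintro ⟨a, ha⟩
      exact ⟨a, by rw [ha]; push_cast; field_simp⟩
  have hzk : ∀ i, z i ^ k = 1 := fun i => by
    rw [← Complex.exp_nat_mul, Complex.exp_eq_one_iff]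
    exact ⟨m i, by field_simp⟩
  rw [h2]
  split_ifs with h
  · simp [(hz _).mpr (h _)]
  · push Not at h
    obtain ⟨i, hi⟩ := h
    refine Finset.prod_eq_zero (Finset.mem_univ i) ?_
    rw [Fin.sum_univ_eq_sum_range (fun a => z i ^ a), geom_sum_eq (mt (hz i).mp hi), hzk, sub_self,
      zero_div]

/-- Aliasing: the sum of the Fourier coefficients over a residue class modulo `k` is a discrete
Fourier coefficient on the grid of mesh `1 / k`. -/
theorem hasSum_aliasing {g : (ι → ℝ) → ℂ} (hg : IsPeriodic g) (hs : ContDiff ℝ ∞ g) {k : ℕ}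
    (hk : 0 < k) (m : ι → ℤ) :
    HasSum (fun q : ι → ℤ => fourierCoef g (m + (k : ℤ) • q))
      (((k : ℂ) ^ Fintype.card ι)⁻¹ *
        ∑ j : ι → Fin k, phase (-m) (gridPt k (finVec j)) * g (gridPt k (finVec j))) := by
  classical
  have hk' : (k : ℂ) ≠ 0 := by exact_mod_cast hk.ne'
  have h1 : HasSum (fun l => ((k : ℂ) ^ Fintype.card ι)⁻¹ * ∑ j : ι → Fin k,
      phase (-m) (gridPt k (finVec j)) * (fourierCoef g l * phase l (gridPt k (finVec j))))
      (((k : ℂ) ^ Fintype.card ι)⁻¹ *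
        ∑ j : ι → Fin k, phase (-m) (gridPt k (finVec j)) * g (gridPt k (finVec j))) :=
    (hasSum_sum fun j _ => (hasSum_fourierCoef hg hs.continuous (summable_fourierCoef hg hs)
      (gridPt k (finVec j))).mul_left _).mul_left _
  have h2 : ∀ l, (((k : ℂ) ^ Fintype.card ι)⁻¹ * ∑ j : ι → Fin k,
      phase (-m) (gridPt k (finVec j)) * (fourierCoef g l * phase l (gridPt k (finVec j)))) =
      if ∀ i, (k : ℤ) ∣ (l - m) i then fourierCoef g l else 0 := fun l => by
    have h3 : ∀ j : ι → Fin k, phase (-m) (gridPt k (finVec j)) *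
        (fourierCoef g l * phase l (gridPt k (finVec j))) =
        fourierCoef g l * phase (l - m) (gridPt k (finVec j)) := fun j => by
      rw [sub_eq_add_neg, phase_add]; ring
    simp only [h3]
    rw [← Finset.mul_sum, sum_phase_gridPt hk]
    split_ifs
    · field_simp
    · simp
  simp only [h2] at h1
  have hinj : Function.Injective fun q : ι → ℤ => m + (k : ℤ) • q := fun q q' h => by
    funext i
    have := congrFun h i
    simpa [hk.ne'] using this
  rw [← hinj.hasSum_iff] at h1
  · refine h1.congr_fun fun q => ?_
    simp
  · intro l hl
    rw [if_neg]
    intro h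
    choose q hq using h
    refine hl ⟨q, ?_⟩
    funext i
    simp only [Pi.add_apply, Pi.smul_apply, smul_eq_mul, ← hq i, Pi.sub_apply]
    ring

end Aliasing

/-! ### Unfolding -/

theorem measurableSet_unit_cube (a : ι → ℝ) :
    MeasurableSet {x : ι → ℝ | ∀ i, x i ∈ Set.Ioc (a i) (a i + 1)} := by
  have := MeasurableSet.univ_pi (t := fun i => Set.Ioc (a i) (a i + 1)) fun i => measurableSet_Ioc
  convert this using 1
  ext x; simp [Set.mem_pi]

theorem setIntegral_unit_cube (H : (ι → ℝ) → ℂ) (a : ι → ℝ) :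
    ∫ x in {x : ι → ℝ | ∀ i, x i ∈ Set.Ioc (a i) (a i + 1)}, H x =
      ∫ x in Set.Icc (0 : ι → ℝ) 1, H (x + a) := by
  rw [← setIntegral_congr_set (Icc_ae_eq_Ioc a)]
  have h := (measurePreserving_add_right (volume : Measure (ι → ℝ)) a).setIntegral_preimage_emb
    (measurableEmbedding_addRight a) H (Set.Icc a (a + 1))
  have h2 : (fun x : ι → ℝ => x + a) ⁻¹' Set.Icc a (a + 1) = Set.Icc 0 1 := by
    ext x; simp [add_comm a]
  rw [← h, h2]

/-- The integral over `ℝ^ι` is the sum of the integrals over the translates of the unit cube. -/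
theorem hasSum_unfold {H : (ι → ℝ) → ℂ} (hH : Integrable H) :
    HasSum (fun p : ι → ℤ => ∫ x in Set.Icc (0 : ι → ℝ) 1, H (x + intVec p)) (∫ x, H x) := by
  have h := hasSum_integral_iUnion (μ := volume) (f := H)
    (s := fun p : ι → ℤ => {x : ι → ℝ | ∀ i, x i ∈ Set.Ioc (intVec p i) (intVec p i + 1)})
    (fun p => measurableSet_unit_cube _) ?_ hH.integrableOn
  · rw [iUnion_unit_cubes, setIntegral_univ] at h
    simpa only [setIntegral_unit_cube] using h
  · intro p q hpq
    refine Set.disjoint_left.mpr fun x hx hy => hpq ?_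
    funext i
    have h1 := hx i
    have h2 := hy i
    simp only [intVec, Set.mem_Ioc] at h1 h2
    have h3 : (p i : ℝ) < q i + 1 := by linarith
    have h4 : (q i : ℝ) < p i + 1 := by linarith
    norm_cast at h3 h4
    omega

theorem integrable_of_summable_cubes {H : (ι → ℝ) → ℂ} (hH : Continuous H) {b : (ι → ℤ) → ℝ}
    (hb : Summable b)
    (hle : ∀ p : ι → ℤ, ∀ x ∈ Set.Icc (0 : ι → ℝ) 1, ‖H (x + intVec p)‖ ≤ b p) :
    Integrable H := by
  rw [← integrableOn_univ, ← iUnion_unit_cubes]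
  refine integrableOn_iUnion_of_summable_integral_norm (fun p => ?_) ?_
  · refine IntegrableOn.congr_set_ae ?_ (Icc_ae_eq_Ioc (intVec p)).symm
    exact hH.continuousOn.integrableOn_compact isCompact_Icc
  · refine Summable.of_nonneg_of_le (fun p => integral_nonneg fun x => norm_nonneg _)
      (fun p => ?_) hb
    have hle' : ∀ x ∈ {x : ι → ℝ | ∀ i, x i ∈ Set.Ioc (intVec p i) (intVec p i + 1)},
        ‖‖H x‖‖ ≤ b p := fun x hx => by
      rw [norm_norm]
      have := hle p (x - intVec p) ⟨fun i => ?_, fun i => ?_⟩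
      · simpa using this
      · have := (hx i).1; simp; linarith
      · have := (hx i).2; simp; linarith
    have hv : volume {x : ι → ℝ | ∀ i, x i ∈ Set.Ioc (intVec p i) (intVec p i + 1)} = 1 := by
      rw [← measure_congr (Icc_ae_eq_Ioc (intVec p))]
      simp [Real.volume_Icc_pi]
    have h := norm_setIntegral_le_of_norm_le_const (μ := volume) (by rw [hv]; simp) hle'
    rw [measureReal_def, hv] at h
    simpa using (le_abs_self _).trans h

/-! ### Fourier inversion -/

/-- The Fourier transform `∫ g(x) e^{-2πi ξ·x} dx` on `ℝ^ι`, in coordinates. -/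
def coordFourier (g : (ι → ℝ) → ℂ) (ξ : ι → ℝ) : ℂ :=
  ∫ x : ι → ℝ, g x * Complex.exp (-(2 * Real.pi * ∑ i, ξ i * x i : ℝ) * Complex.I)

open FourierTransform in
/-- Fourier inversion for smooth functions with compact support. The functions live on `ι → ℝ`, and
the proof transports the result for Schwartz functions from `EuclideanSpace ℝ ι`. -/
theorem integrable_coordFourier_and_inversion {g : (ι → ℝ) → ℂ} (hs : ContDiff ℝ ∞ g)
    (hc : HasCompactSupport g) :
    Integrable (coordFourier g) ∧ ∀ a : ι → ℝ,
      ∫ ξ : ι → ℝ, Complex.exp ((2 * Real.pi * ∑ i, ξ i * a i : ℝ) * Complex.I) *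
        coordFourier g ξ = g a := by
  let e := PiLp.continuousLinearEquiv 2 ℝ (fun _ : ι => ℝ)
  have hvp : MeasurePreserving (WithLp.ofLp : EuclideanSpace ℝ ι → ι → ℝ) :=
    PiLp.volume_preserving_ofLp ι
  have hme : MeasurableEmbedding (WithLp.ofLp : EuclideanSpace ℝ ι → ι → ℝ) :=
    (MeasurableEquiv.toLp 2 (ι → ℝ)).symm.measurableEmbedding
  let φ : SchwartzMap (EuclideanSpace ℝ ι) ℂ :=
    HasCompactSupport.toSchwartzMap (f := fun v : EuclideanSpace ℝ ι => g v.ofLp)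
      (hc.comp_homeomorph e.toHomeomorph) (hs.comp e.contDiff)
  have hinner : ∀ v w : EuclideanSpace ℝ ι, inner ℝ v w = ∑ i, w.ofLp i * v.ofLp i :=
    fun v w => by simp [PiLp.inner_apply]
  have hφ : ∀ w : EuclideanSpace ℝ ι, 𝓕 φ w = coordFourier g w.ofLp := fun w => by
    rw [SchwartzMap.fourier_coe, Real.fourier_eq', coordFourier, ← hvp.integral_comp hme]
    refine integral_congr_ae (.of_forall fun v => ?_)
    change Complex.exp _ • g v.ofLp = _
    simp only [hinner, smul_eq_mul]
    rw [mul_comm]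
    congr 2
    push_cast
    ring
  have hφ' : ((𝓕 φ : SchwartzMap (EuclideanSpace ℝ ι) ℂ) : EuclideanSpace ℝ ι → ℂ) = coordFourier g ∘ WithLp.ofLp := funext hφ
  refine ⟨?_, fun a => ?_⟩
  · rw [← hvp.integrable_comp_emb hme, ← hφ']
    exact (𝓕 φ).integrable
  · have h1 : 𝓕⁻ (𝓕 φ) = φ := FourierTransform.fourierInv_fourier_eq φ
    have h2 : 𝓕⁻ (𝓕 φ) (WithLp.toLp 2 a) = g a := by rw [h1]; rfl
    rw [← h2, SchwartzMap.fourierInv_coe, Real.fourierInv_eq', ← hvp.integral_comp hme]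
    refine integral_congr_ae (.of_forall fun v => ?_)
    simp only [hφ, hinner, smul_eq_mul]
    congr 3
    norm_cast
    exact congrArg _ (Finset.sum_congr rfl fun i _ => mul_comm _ _)

end Periodic

/-! ### The Liouville integral -/

/-- The coordinates `(x, y)` on the universal cover, as a single family of `2n` real numbers. -/
def covEquiv (n : ℕ) : (Fin n ⊕ Fin n → ℝ) ≃L[ℝ] Cov n :=
  ContinuousLinearEquiv.sumPiEquivProdPi ℝ (Fin n) (Fin n) fun _ => ℝ

theorem covEquiv_intVec {n : ℕ} (p : Fin n ⊕ Fin n → ℤ) :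
    covEquiv n (intVec p) = Lat.toCov (fun i => p (Sum.inl i), fun i => p (Sum.inr i)) := rfl

theorem isPeriodic_comp_covEquiv {n : ℕ} (f : smoothFun n) : IsPeriodic (f.1 ∘ covEquiv n) :=
  fun p x => by
    simp only [Function.comp_apply, map_add, covEquiv_intVec, f.2.2]

theorem liouvilleIntegral_eq {n : ℕ} (f : smoothFun n) :
    liouvilleIntegral f = ∫ x in Set.Icc (0 : Fin n ⊕ Fin n → ℝ) 1, f.1 (covEquiv n x) := by
  have h := (volume_measurePreserving_sumPiEquivProdPi
    (fun _ : Fin n ⊕ Fin n => ℝ)).setIntegral_preimage_emb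
      (MeasurableEquiv.sumPiEquivProdPi _).measurableEmbedding f.1 (unitCube n)
  rw [liouvilleIntegral, ← h]
  congr 2
  ext x
  simp only [unitCube, Set.mem_preimage, Set.mem_Icc, Prod.le_def, Pi.le_def, Sum.forall]
  rfl

theorem integrableOn_unitCube {n : ℕ} {g : Cov n → ℂ} (hg : Continuous g) :
    IntegrableOn g (unitCube n) := hg.continuousOn.integrableOn_compact isCompact_Icc

theorem liouvilleIntegral_add {n : ℕ} (f g : smoothFun n) :
    liouvilleIntegral (f + g) = liouvilleIntegral f + liouvilleIntegral g :=
  integral_add (integrableOn_unitCube f.2.1.continuous) (integrableOn_unitCube g.2.1.continuous)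

theorem liouvilleIntegral_smul {n : ℕ} (c : ℂ) (f : smoothFun n) :
    liouvilleIntegral (c • f) = c * liouvilleIntegral f :=
  integral_const_mul c _

/-- The Liouville integral as a linear functional. -/
def liouvilleLin (n : ℕ) : smoothFun n →ₗ[ℂ] ℂ where
  toFun := liouvilleIntegral
  map_add' := liouvilleIntegral_add
  map_smul' := liouvilleIntegral_smul

theorem liouvilleLin_apply {n : ℕ} (f : smoothFun n) : liouvilleLin n f = liouvilleIntegral f := rfl

theorem norm_liouvilleIntegral_le {n : ℕ} (f : smoothFun n) {B : ℝ}
    (hB : ∀ u ∈ unitCube n, ‖f.1 u‖ ≤ B) : ‖liouvilleIntegral f‖ ≤ B := by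
  have hv : volume.real (Set.Icc (0 : Fin n ⊕ Fin n → ℝ) 1) = 1 := by
    simp [measureReal_def, Real.volume_Icc_pi]
  rw [liouvilleIntegral_eq]
  have h := norm_setIntegral_le_of_norm_le_const (μ := volume)
    (s := Set.Icc (0 : Fin n ⊕ Fin n → ℝ) 1) (f := fun x => f.1 (covEquiv n x)) (C := B)
    (by simp [Real.volume_Icc_pi]) fun x hx =>
      hB _ ⟨⟨fun i => hx.1 _, fun i => hx.1 _⟩, ⟨fun i => hx.2 _, fun i => hx.2 _⟩⟩
  rwa [hv, mul_one] at h

/-- Stokes' theorem on `X`. -/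
theorem liouvilleIntegral_dirDeriv {n : ℕ} (w : Cov n) (f : smoothFun n) :
    liouvilleIntegral (dirDeriv w f) = 0 := by
  have hs : ContDiff ℝ ∞ (f.1 ∘ covEquiv n) := f.2.1.comp (covEquiv n).contDiff
  rw [liouvilleIntegral_eq, ← setIntegral_Icc_fderiv (isPeriodic_comp_covEquiv f)
    (hs.of_le (by exact_mod_cast le_top)) ((covEquiv n).symm w)]
  refine integral_congr_ae (.of_forall fun x => ?_)
  change fderiv ℝ f.1 (covEquiv n x) w = fderiv ℝ (f.1 ∘ covEquiv n) x _
  rw [ContinuousLinearEquiv.comp_right_fderiv]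
  simp

/-! ### The trace property for the star product -/

theorem dirDeriv_mul {n : ℕ} (w : Cov n) (f g : smoothFun n) :
    dirDeriv w (f * g) = dirDeriv w f * g + f * dirDeriv w g := by
  apply Subtype.ext
  funext u
  have h := ((f.2.1.differentiable (by simp) u).hasFDerivAt.mul
    (g.2.1.differentiable (by simp) u).hasFDerivAt).fderiv
  change fderiv ℝ (f.1 * g.1) u w = fderiv ℝ f.1 u w * g.1 u + f.1 u * fderiv ℝ g.1 u w
  rw [h]
  simp
  ring

theorem dirDeriv_comm {n : ℕ} (v w : Cov n) (f : smoothFun n) :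
    dirDeriv v (dirDeriv w f) = dirDeriv w (dirDeriv v f) := by
  apply Subtype.ext
  funext u
  have hd : Differentiable ℝ (fderiv ℝ f.1) :=
    (f.2.1.fderiv_right (m := ∞) (by simp)).differentiable (by simp)
  have h : ∀ a b : Cov n, fderiv ℝ (fun u => fderiv ℝ f.1 u a) u b =
      fderiv ℝ (fderiv ℝ f.1) u b a := fun a b => by
    rw [((hd u).hasFDerivAt.clm_apply (hasFDerivAt_const a u)).fderiv]
    simp
  change fderiv ℝ (fun u => fderiv ℝ f.1 u w) u v = fderiv ℝ (fun u => fderiv ℝ f.1 u v) u w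
  rw [h, h]
  exact (f.2.1.contDiffAt.isSymmSndFDerivAt (by
    rw [minSmoothness_of_isRCLikeNormedField]
    exact WithTop.coe_le_coe.mpr (le_top : (2 : ℕ∞) ≤ ⊤))).eq v w

theorem liouvilleIntegral_dirDeriv_mul {n : ℕ} (w : Cov n) (f g : smoothFun n) :
    liouvilleIntegral (dirDeriv w f * g) = -liouvilleIntegral (f * dirDeriv w g) := by
  have h := liouvilleIntegral_dirDeriv w (f * g)
  rw [dirDeriv_mul, liouvilleIntegral_add] at h
  linear_combination h

/-- The iterated derivative of `f` along `v i` for `i` in the list `L`. -/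
def listDeriv {n : ℕ} (v : Fin n → Cov n) (L : List (Fin n)) (f : smoothFun n) : smoothFun n :=
  L.foldr (fun i h => dirDeriv (v i) h) f

theorem listDeriv_cons {n : ℕ} (v : Fin n → Cov n) (i : Fin n) (L : List (Fin n))
    (f : smoothFun n) : listDeriv v (i :: L) f = dirDeriv (v i) (listDeriv v L f) := rfl

theorem dirDeriv_listDeriv {n : ℕ} (v : Fin n → Cov n) (w : Cov n) (L : List (Fin n))
    (f : smoothFun n) : dirDeriv w (listDeriv v L f) = listDeriv v L (dirDeriv w f) := by
  induction L with
  | nil => rfl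
  | cons i L ih => rw [listDeriv_cons, dirDeriv_comm, ih, listDeriv_cons]

/-- Two integrations by parts exchange the derivatives that fall on `f` and on `g`; the signs cancel. -/
theorem liouvilleIntegral_listDeriv {n : ℕ} (v w : Fin n → Cov n) (L : List (Fin n))
    (f g : smoothFun n) :
    liouvilleIntegral (listDeriv v L f * listDeriv w L g) =
      liouvilleIntegral (listDeriv w L f * listDeriv v L g) := by
  induction L generalizing f g with
  | nil => rfl
  | cons i L ih =>
    simp only [listDeriv_cons]
    rw [liouvilleIntegral_dirDeriv_mul, dirDeriv_comm, ← neg_eq_iff_eq_neg.mpr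
      (liouvilleIntegral_dirDeriv_mul (w i) _ _), neg_neg]
    simp only [dirDeriv_listDeriv]
    exact ih _ _

theorem liouvilleIntegral_starCoeff {n : ℕ} (l : ℕ) (f g : smoothFun n) :
    liouvilleIntegral (starCoeff l f g) = liouvilleIntegral (starCoeff l g f) := by
  rw [starCoeff, starCoeff, liouvilleIntegral_smul, liouvilleIntegral_smul]
  congr 1
  rw [← liouvilleLin_apply, ← liouvilleLin_apply, map_sum, map_sum]
  refine Finset.sum_congr rfl fun i _ => ?_
  simp only [liouvilleLin_apply]
  rw [mul_comm (List.foldr _ g _)]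
  exact liouvilleIntegral_listDeriv ey ex (List.ofFn i) f g

theorem isTraceMap_formalTrace (n : ℕ) : IsTraceMap (starProduct (n := n)) (formalTrace n) where
  map_add F G := by
    rw [formalTrace, formalTrace, formalTrace, ← mul_add, ← map_add]
    congr 2
    ext j
    simp [liouvilleIntegral_add]
  map_smul c F := by
    have h : (PowerSeries.mk fun j => liouvilleIntegral (PowerSeries.coeff j (c • F))) =
        c * PowerSeries.mk fun j => liouvilleIntegral (PowerSeries.coeff j F) := by
      ext j
      have h1 : PowerSeries.coeff j (c • F) = ∑ p ∈ Finset.HasAntidiagonal.antidiagonal j,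
          PowerSeries.coeff p.1 c • PowerSeries.coeff p.2 F := by
        rw [Algebra.smul_def, PowerSeries.coeff_mul]
        refine Finset.sum_congr rfl fun p _ => ?_
        rw [Algebra.smul_def]
        rfl
      simp [h1, PowerSeries.coeff_mul, ← liouvilleLin_apply]
    rw [formalTrace, h, map_mul, formalTrace, Algebra.smul_def, mul_left_comm]
    rfl
  range F j hj := by
    rw [formalTrace, HahnSeries.coeff_single_mul, PowerSeries.coeff_coe, if_pos (by omega)]
    simp
  continuous j := by
    refine ⟨(j + n).natAbs, 1, fun F B h => ?_⟩
    have hB : 0 ≤ B := (norm_nonneg _).trans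
      (h 0 (Nat.zero_le _) 0 (Nat.zero_le _) 0 (by simp [unitCube]))
    rw [formalTrace, HahnSeries.coeff_single_mul, PowerSeries.coeff_coe, one_mul, one_mul,
      sub_neg_eq_add]
    split_ifs
    · simpa using hB
    · rw [PowerSeries.coeff_mk]
      refine norm_liouvilleIntegral_le _ fun u hu => ?_
      simpa using h _ le_rfl 0 (Nat.zero_le _) u hu
  trace F G := by
    rw [formalTrace, formalTrace]
    refine congrArg (fun s => HahnSeries.single (-(n : ℤ)) (1 : ℂ) *
      HahnSeries.ofPowerSeries ℤ ℂ s) (PowerSeries.ext fun N => ?_)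
    rw [PowerSeries.coeff_mk, PowerSeries.coeff_mk, starProduct, starProduct, PowerSeries.coeff_mk, PowerSeries.coeff_mk,
      ← liouvilleLin_apply, ← liouvilleLin_apply, map_sum, map_sum]
    refine Finset.sum_congr rfl fun p _ => ?_
    rw [map_sum, map_sum, ← Finset.Nat.sum_antidiagonal_swap]
    refine Finset.sum_congr rfl fun q _ => ?_
    exact liouvilleIntegral_starCoeff p.1 (PowerSeries.coeff q.2 F) (PowerSeries.coeff q.1 G)
  leading _ _ _ := rfl

/-! ### The trapezoidal rule on `X` -/

/-- The average of a smooth function on `X` over the points `(i / k, j / k)` converges to its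
integral faster than any power of `1 / k`. -/
theorem exists_trapezoid_le {n : ℕ} (f : smoothFun n) (r : ℕ) : ∃ C : ℝ, ∀ k : ℕ, 0 < k →
    ‖((k : ℂ) ^ n)⁻¹ * ∑ m : Fin n → Fin k, ((k : ℂ) ^ n)⁻¹ * ∑ j : Fin n → Fin k,
        f.1 (gridPt k (finVec j), gridPt k (finVec m)) - liouvilleIntegral f‖ ≤
      C * ((k : ℝ)⁻¹) ^ r := by
  have hp := isPeriodic_comp_covEquiv f
  have hs : ContDiff ℝ ∞ (f.1 ∘ covEquiv n) := f.2.1.comp (covEquiv n).contDiff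
  set g := f.1 ∘ covEquiv n with hg
  set N := Fintype.card (Fin n ⊕ Fin n) with hN
  obtain ⟨C, hC⟩ := exists_fourierCoef_le (E := ℝ) (F := fun p => g p.1) (hs.comp contDiff_fst)
    (fun _ => hp) (isCompact_singleton (x := 0)) (N + r)
  have hC' : ∀ m, ‖fourierCoef g m‖ ≤ C * (symbolWeight m ^ (N + r))⁻¹ := hC 0 rfl
  have hC0 : 0 ≤ C := by
    have h := (norm_nonneg _).trans (hC' 0)
    simpa [symbolWeight] using h
  refine ⟨C * ∑' m : Fin n ⊕ Fin n → ℤ, (symbolWeight m ^ N)⁻¹, fun k hk => ?_⟩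
  have hk1 : (1 : ℝ) ≤ k := by exact_mod_cast hk
  have h0 : fourierCoef g 0 = liouvilleIntegral f := by
    rw [liouvilleIntegral_eq, fourierCoef]
    simp [phase, hg]
  have h1 := hasSum_aliasing hp hs hk 0
  have h2 : ((k : ℂ) ^ N)⁻¹ * ∑ j : Fin n ⊕ Fin n → Fin k,
      phase (-0) (gridPt k (finVec j)) * g (gridPt k (finVec j)) =
      ((k : ℂ) ^ n)⁻¹ * ∑ m : Fin n → Fin k, ((k : ℂ) ^ n)⁻¹ * ∑ j : Fin n → Fin k,
        f.1 (gridPt k (finVec j), gridPt k (finVec m)) := by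
    rw [← Finset.mul_sum, ← mul_assoc, hN, Fintype.card_sum, Fintype.card_fin, pow_add, mul_inv,
      Finset.sum_comm, ← Fintype.sum_prod_type']
    congr 1
    refine Fintype.sum_equiv (Equiv.sumArrowEquivProdArrow _ _ _) _ _ fun j => ?_
    simp only [phase]
    simp
    rfl
  rw [h2] at h1
  -- by aliasing, the error is the sum of the Fourier coefficients at the non-zero points of `kℤ²ⁿ`
  have h3 := (hasSum_ite_sub_hasSum h1 0)
  rw [smul_zero, add_zero, h0] at h3
  have h4 : HasSum (fun m : Fin n ⊕ Fin n → ℤ => C * (symbolWeight m ^ N)⁻¹ * ((k : ℝ)⁻¹) ^ r)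
      (C * (∑' m : Fin n ⊕ Fin n → ℤ, (symbolWeight m ^ N)⁻¹) * ((k : ℝ)⁻¹) ^ r) :=
    (summable_symbolWeight.hasSum.mul_left C).mul_right _
  rw [← h3.tsum_eq]
  refine tsum_of_norm_bounded h4 fun q => ?_
  have hw := one_le_symbolWeight q
  split_ifs with hq
  · rw [norm_zero]; positivity
  · rw [zero_add]
    refine (hC' _).trans ?_
    rw [mul_assoc, inv_pow, ← mul_inv, pow_add]
    refine mul_le_mul_of_nonneg_left (inv_anti₀ (by positivity) ?_) hC0
    -- a non-zero integer vector has `1 ≤ |q|²`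
    obtain ⟨i, hi⟩ := Function.ne_iff.mp hq
    have hS : 1 ≤ ∑ i, (q i : ℝ) ^ 2 := by
      have h5 : (1 : ℝ) ≤ (q i : ℝ) ^ 2 := by
        have : 0 < (q i) ^ 2 := by have : q i ≠ 0 := hi; positivity
        exact_mod_cast this
      exact h5.trans (Finset.single_le_sum (f := fun i => (q i : ℝ) ^ 2)
        (fun i _ => sq_nonneg _) (Finset.mem_univ i))
    have hkq : symbolWeight ((k : ℤ) • q) =
        1 + 4 * Real.pi ^ 2 * ((k : ℝ) ^ 2 * ∑ i, (q i : ℝ) ^ 2) := by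
      simp only [symbolWeight, Finset.mul_sum]
      simp [mul_pow]
    have hpi : (1 : ℝ) ≤ 4 * Real.pi ^ 2 := by nlinarith [Real.pi_gt_three]
    have hkk : (k : ℝ) ≤ (k : ℝ) ^ 2 := by nlinarith
    have hle1 : symbolWeight q ≤ symbolWeight ((k : ℤ) • q) := by
      rw [hkq, symbolWeight]
      gcongr
      nlinarith
    have hle2 : (k : ℝ) ≤ symbolWeight ((k : ℤ) • q) := by
      rw [hkq]
      have h6 : (k : ℝ) ≤ (k : ℝ) ^ 2 * ∑ i, (q i : ℝ) ^ 2 := by nlinarith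
      nlinarith
    have hpos : 0 ≤ symbolWeight ((k : ℤ) • q) ^ N := pow_nonneg (by linarith) _
    gcongr

/-! ### Integrals over Bohr–Sommerfeld leaves -/

section HalfPhase

variable {ι : Type}

theorem gridPt_sub {k : ℕ} (hk : 0 < k) (m q : ι → ℤ) :
    gridPt k (m - (k : ℤ) • q) = gridPt k m - intVec q := by
  have hk' : (k : ℝ) ≠ 0 := by exact_mod_cast hk.ne'
  ext i
  simp only [gridPt, intVec, Pi.sub_apply, Pi.smul_apply, smul_eq_mul]
  push_cast
  field_simp

variable [Fintype ι]

/-- The phase `e^{πi m·x}`, a square root of `phase m x`. -/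
def halfPhase (m : ι → ℤ) (x : ι → ℝ) : ℂ :=
  Complex.exp ((Real.pi * ∑ i, (m i : ℝ) * x i : ℝ) * Complex.I)

theorem norm_halfPhase (m : ι → ℤ) (x : ι → ℝ) : ‖halfPhase m x‖ = 1 :=
  Complex.norm_exp_ofReal_mul_I _

theorem halfPhase_add (m p : ι → ℤ) (x : ι → ℝ) :
    halfPhase (m + p) x = halfPhase m x * halfPhase p x := by
  simp only [halfPhase, ← Complex.exp_add, Pi.add_apply, Int.cast_add, add_mul,
    Finset.sum_add_distrib]
  congr 1; push_cast; ring

theorem halfPhase_add_right (m : ι → ℤ) (x y : ι → ℝ) :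
    halfPhase m (x + y) = halfPhase m x * halfPhase m y := by
  simp only [halfPhase, ← Complex.exp_add, Pi.add_apply, mul_add, Finset.sum_add_distrib]
  congr 1; push_cast; ring

theorem halfPhase_mul_self (m : ι → ℤ) (x : ι → ℝ) :
    halfPhase m x * halfPhase m x = phase m x := by
  rw [halfPhase, ← Complex.exp_add, phase]
  congr 1; push_cast; ring

theorem halfPhase_neg_mul (m : ι → ℤ) (x : ι → ℝ) : halfPhase (-m) x * halfPhase m x = 1 := by
  rw [← halfPhase_add, neg_add_cancel]; simp [halfPhase]

theorem halfPhase_neg_right (m : ι → ℤ) (x : ι → ℝ) : halfPhase m (-x) = halfPhase (-m) x := by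
  simp [halfPhase]

theorem conj_halfPhase (m : ι → ℤ) (x : ι → ℝ) :
    (starRingEnd ℂ) (halfPhase m x) = halfPhase (-m) x := by
  rw [halfPhase, ← Complex.exp_conj, halfPhase]
  simp

/-- On lattice vectors `e^{πi m·p}` is a sign. -/
theorem halfPhase_intVec_neg (m p : ι → ℤ) :
    halfPhase (-m) (intVec p) = halfPhase m (intVec p) := by
  have h1 := halfPhase_neg_mul m (intVec p)
  have h2 := (halfPhase_mul_self m (intVec p)).trans (phase_intVec m p)
  calc halfPhase (-m) (intVec p)
      = halfPhase (-m) (intVec p) * (halfPhase m (intVec p) * halfPhase m (intVec p)) := by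
        rw [h2, mul_one]
    _ = halfPhase m (intVec p) := by rw [← mul_assoc, h1, one_mul]

theorem contDiff_halfPhase (m : ι → ℤ) : ContDiff ℝ ∞ (halfPhase m) := by
  unfold halfPhase
  refine ContDiff.cexp (ContDiff.mul (Complex.ofRealCLM.contDiff.comp
    (contDiff_const.mul (ContDiff.sum fun i _ => contDiff_const.mul ?_))) contDiff_const)
  exact contDiff_apply ℝ ℝ i

theorem fderiv_halfPhase (m : ι → ℤ) (x v : ι → ℝ) :
    fderiv ℝ (halfPhase m) x v =
      (Real.pi * ∑ i, (m i : ℝ) * v i : ℝ) * Complex.I * halfPhase m x := by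
  let L : (ι → ℝ) →L[ℝ] ℝ := ∑ i, (m i : ℝ) • ContinuousLinearMap.proj i
  have hL : ∀ y, L y = ∑ i, (m i : ℝ) * y i := fun y => by simp [L]
  have h1 : HasFDerivAt (fun y => ((L y : ℝ) : ℂ)) (Complex.ofRealCLM.comp L) x :=
    (Complex.ofRealCLM.comp L).hasFDerivAt
  have h2 := (h1.const_mul ((Real.pi : ℝ) * Complex.I : ℂ)).cexp
  have h3 : halfPhase m = fun y => Complex.exp ((Real.pi : ℝ) * Complex.I * ((L y : ℝ) : ℂ)) := by
    funext y; rw [halfPhase, hL]; congr 1; push_cast; ring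
  rw [h3, h2.fderiv]
  simp only [smul_apply, ContinuousLinearMap.comp_apply, hL,
    Complex.ofRealCLM_apply, smul_eq_mul]
  push_cast; ring

theorem halfPhase_gridPt_comm {k : ℕ} (m j : ι → ℤ) :
    halfPhase m (gridPt k j) = halfPhase j (gridPt k m) := by
  simp only [halfPhase, gridPt]
  congr 3
  refine congrArg _ (Finset.sum_congr rfl fun i _ => ?_)
  ring

theorem finite_setOf_gridPt_mem {k : ℕ} (hk : 0 < k) {K : Set (ι → ℝ)}
    (hK : Bornology.IsBounded K) : {m : ι → ℤ | gridPt k m ∈ K}.Finite := by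
  obtain ⟨R, hR⟩ := hK.subset_closedBall 0
  obtain ⟨M, hM⟩ := exists_nat_ge (k * R)
  classical
  refine (Set.finite_Icc (fun _ : ι => -(M : ℤ)) fun _ => (M : ℤ)).subset fun m hm => ?_
  have hk' : (0 : ℝ) < k := by exact_mod_cast hk
  have h1 : ‖gridPt k m‖ ≤ R := by simpa using hR hm
  have h2 : ∀ i, |(m i : ℝ)| ≤ M := fun i => by
    have h3 : |(m i : ℝ) / k| ≤ R := (norm_le_pi_norm (gridPt k m) i).trans h1
    rw [abs_div, abs_of_pos hk', div_le_iff₀ hk'] at h3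
    linarith
  constructor <;> intro i
  · exact_mod_cast (abs_le.mp (h2 i)).1
  · exact_mod_cast (abs_le.mp (h2 i)).2

end HalfPhase

/-- The semi-character `α(λ)^k` as a half phase. -/
theorem neg_one_zpow_pow_eq_halfPhase {n : ℕ} (k : ℕ) (l : Lat n) :
    ((-1 : ℂ) ^ (∑ i, l.1 i * l.2 i)) ^ k = halfPhase ((k : ℤ) • l.2) (intVec l.1) := by
  rw [← Complex.exp_pi_mul_I, ← Complex.exp_int_mul, ← Complex.exp_nat_mul, halfPhase]
  congr 1
  simp only [intVec, Pi.smul_apply, smul_eq_mul]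
  push_cast
  simp only [Finset.sum_mul, Finset.mul_sum]
  exact Finset.sum_congr rfl fun i _ => by ring

/-- The trivializations of `L^{⊗k}` over the lifts of the leaf `y = m / k` are permuted by the lattice:
`λ` takes the trivialization over `y = m / k - λ₂` to the one over `y = m / k`. -/
theorem halfPhase_mul_automorphy_fst {n k : ℕ} (hk : 0 < k) (m : Fin n → ℤ) (l : Lat n)
    (x : Fin n → ℝ) :
    halfPhase (-m) x * automorphy k l (x, gridPt k m) =
      halfPhase (-(m - (k : ℤ) • l.2)) (x - intVec l.1) := by
  have hk' : (k : ℝ) ≠ 0 := by exact_mod_cast hk.ne'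
  have h1 : Complex.exp (-(k * Real.pi * sympForm (x, gridPt k m) l.toCov : ℝ) * Complex.I) =
      halfPhase (-m) (intVec l.1) * halfPhase ((k : ℤ) • l.2) x := by
    have h2 : (k : ℝ) * sympForm (x, gridPt k m) l.toCov =
        -(∑ i, ((-m) i : ℝ) * intVec l.1 i + ∑ i, (((k : ℤ) • l.2) i : ℝ) * x i) := by
      rw [sympForm, Finset.mul_sum, ← Finset.sum_add_distrib, ← Finset.sum_neg_distrib]
      refine Finset.sum_congr rfl fun i _ => ?_
      simp only [gridPt, Lat.toCov, intVec, Pi.smul_apply, Pi.neg_apply, smul_eq_mul]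
      push_cast
      field_simp
      ring
    rw [halfPhase, halfPhase, ← Complex.exp_add, mul_right_comm, h2]
    congr 1
    push_cast
    ring
  rw [automorphy, h1, neg_one_zpow_pow_eq_halfPhase, sub_eq_add_neg x, ← intVec_neg,
    halfPhase_add_right, intVec_neg, halfPhase_neg_right, neg_neg, sub_eq_add_neg, neg_add, neg_neg,
    halfPhase_add, halfPhase_add, halfPhase_intVec_neg ((k : ℤ) • l.2)]
  rw [halfPhase_intVec_neg m]
  ring

/-- The analogue of `halfPhase_mul_automorphy_fst` for the leaves `x = j / k`. -/
theorem halfPhase_mul_automorphy_snd {n k : ℕ} (hk : 0 < k) (j : Fin n → ℤ) (l : Lat n)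
    (y : Fin n → ℝ) :
    halfPhase j y * automorphy k l (gridPt k j, y) =
      halfPhase (j - (k : ℤ) • l.1) (y - intVec l.2) := by
  have hk' : (k : ℝ) ≠ 0 := by exact_mod_cast hk.ne'
  have h1 : Complex.exp (-(k * Real.pi * sympForm (gridPt k j, y) l.toCov : ℝ) * Complex.I) =
      halfPhase j (intVec l.2) * halfPhase (-((k : ℤ) • l.1)) y := by
    have h2 : (k : ℝ) * sympForm (gridPt k j, y) l.toCov =
        -(∑ i, ((j) i : ℝ) * intVec l.2 i + ∑ i, ((-((k : ℤ) • l.1)) i : ℝ) * y i) := by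
      rw [sympForm, Finset.mul_sum, ← Finset.sum_add_distrib, ← Finset.sum_neg_distrib]
      refine Finset.sum_congr rfl fun i _ => ?_
      simp only [gridPt, Lat.toCov, intVec, Pi.smul_apply, Pi.neg_apply, smul_eq_mul]
      push_cast
      field_simp
      ring
    rw [halfPhase, halfPhase, ← Complex.exp_add, mul_right_comm, h2]
    congr 1
    push_cast
    ring
  have h2 : halfPhase ((k : ℤ) • l.2) (intVec l.1) = halfPhase ((k : ℤ) • l.1) (intVec l.2) := by
    simp only [halfPhase, intVec, Pi.smul_apply, smul_eq_mul]
    push_cast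
    congr 3
    exact Finset.sum_congr rfl fun i _ => by ring
  rw [automorphy, h1, neg_one_zpow_pow_eq_halfPhase, sub_eq_add_neg y, ← intVec_neg,
    halfPhase_add_right, intVec_neg, halfPhase_neg_right, sub_eq_add_neg, neg_add, neg_neg,
    halfPhase_add, halfPhase_add, halfPhase_intVec_neg j, h2]
  ring

/-- The trivialization `x ↦ e^{-πi m·x} τ(x, m/k)` of `τ` over the leaf `y = m / k`. -/
def leafXFun {n : ℕ} (k : ℕ) (m : Fin n → ℤ) (τ : Cov n → ℂ) (x : Fin n → ℝ) : ℂ :=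
  halfPhase (-m) x * τ (x, gridPt k m)

/-- The trivialization `y ↦ e^{πi j·y} τ(j/k, y)` of `τ` over the leaf `x = j / k`. -/
def leafYFun {n : ℕ} (k : ℕ) (j : Fin n → ℤ) (τ : Cov n → ℂ) (y : Fin n → ℝ) : ℂ :=
  halfPhase j y * τ (gridPt k j, y)

/-- The integral of `τ` over the Bohr–Sommerfeld leaf `y = m / k`. -/
def leafX {n : ℕ} (k : ℕ) (m : Fin n → ℤ) (τ : Cov n → ℂ) : ℂ :=
  ∫ x in Set.Icc (0 : Fin n → ℝ) 1, leafXFun k m τ x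

/-- The integral of `τ` over the Bohr–Sommerfeld leaf `x = j / k`. -/
def leafY {n : ℕ} (k : ℕ) (j : Fin n → ℤ) (τ : Cov n → ℂ) : ℂ :=
  ∫ y in Set.Icc (0 : Fin n → ℝ) 1, leafYFun k j τ y

theorem contDiff_leafXFun {n : ℕ} (k : ℕ) (m : Fin n → ℤ) {τ : Cov n → ℂ} (hτ : ContDiff ℝ ∞ τ) :
    ContDiff ℝ ∞ (leafXFun k m τ) :=
  (contDiff_halfPhase _).mul (hτ.comp (contDiff_id.prodMk contDiff_const))

theorem contDiff_leafYFun {n : ℕ} (k : ℕ) (m : Fin n → ℤ) {τ : Cov n → ℂ} (hτ : ContDiff ℝ ∞ τ) :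
    ContDiff ℝ ∞ (leafYFun k m τ) :=
  (contDiff_halfPhase _).mul (hτ.comp (contDiff_const.prodMk contDiff_id))

theorem hasCompactSupport_slice_fst {n : ℕ} {τ : Cov n → ℂ} (hτ : HasCompactSupport τ)
    (y : Fin n → ℝ) : HasCompactSupport fun x => τ (x, y) :=
  HasCompactSupport.of_support_subset_isCompact (hτ.isCompact.image continuous_fst)
    fun x hx => ⟨(x, y), subset_tsupport _ hx, rfl⟩

theorem hasCompactSupport_slice_snd {n : ℕ} {τ : Cov n → ℂ} (hτ : HasCompactSupport τ)
    (x : Fin n → ℝ) : HasCompactSupport fun y => τ (x, y) :=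
  HasCompactSupport.of_support_subset_isCompact (hτ.isCompact.image continuous_snd)
    fun y hy => ⟨(x, y), subset_tsupport _ hy, rfl⟩

/-- Unfolding of the integral over a leaf of a sum over the lattice. The first component of a lattice
vector is transversal to the leaf and labels the lift `H q` of the leaf; the second component acts
by translations along the leaf. -/
theorem hasSum_setIntegral_finsum {n : ℕ} {H : (Fin n → ℤ) → (Fin n → ℝ) → ℂ}
    (hH : ∀ q, ContDiff ℝ ∞ (H q)) (hc : ∀ q, HasCompactSupport (H q))
    {S : Finset (Lat n)}
    (hS : ∀ x ∈ Set.Icc (0 : Fin n → ℝ) 1, ∀ p q, H q (x - intVec p) ≠ 0 → (q, p) ∈ S) :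
    HasSum (fun q => ∫ x, H q x)
      (∫ x in Set.Icc (0 : Fin n → ℝ) 1, ∑ᶠ l : Lat n, H l.1 (x - intVec l.2)) := by
  have hcont : ∀ l : Lat n, Continuous fun x => H l.1 (x - intVec l.2) := fun l =>
    (hH l.1).continuous.comp (by fun_prop)
  have h1 : (∫ x in Set.Icc (0 : Fin n → ℝ) 1, ∑ᶠ l : Lat n, H l.1 (x - intVec l.2)) =
      ∑ l ∈ S, ∫ x in Set.Icc (0 : Fin n → ℝ) 1, H l.1 (x - intVec l.2) := by
    rw [← integral_finsetSum]
    · refine setIntegral_congr_fun measurableSet_Icc fun x hx => ?_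
      exact finsum_eq_sum_of_support_subset _ fun l hl => hS x hx l.2 l.1 hl
    · exact fun l _ => (hcont l).continuousOn.integrableOn_compact isCompact_Icc
  have h2 : HasSum (fun l : Lat n => ∫ x in Set.Icc (0 : Fin n → ℝ) 1, H l.1 (x - intVec l.2))
      (∑ l ∈ S, ∫ x in Set.Icc (0 : Fin n → ℝ) 1, H l.1 (x - intVec l.2)) := by
    refine hasSum_sum_of_ne_finset_zero fun l hl => ?_
    rw [setIntegral_congr_fun measurableSet_Icc (g := fun _ => 0), integral_zero]
    intro x hx
    by_contra h
    exact hl (hS x hx l.2 l.1 h)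
  rw [h1]
  refine h2.prod_fiberwise fun q => ?_
  have h3 := hasSum_unfold ((hH q).continuous.integrable_of_hasCompactSupport (hc q))
  rw [← (Equiv.neg _).hasSum_iff] at h3
  refine h3.congr_fun fun p => ?_
  simp [intVec_neg, sub_eq_add_neg]

/-- The leaf integral of a push-forward is the sum of the integrals of `ψ` over all the lifts of the
leaf to the universal cover. -/
theorem hasSum_leafX_pushForward {n k : ℕ} (hk : 0 < k) (m : Fin n → ℤ) {ψ : Cov n → ℂ}
    (hs : ContDiff ℝ ∞ ψ) (hc : HasCompactSupport ψ) :
    HasSum (fun q : Fin n → ℤ => ∫ x, leafXFun k (m - (k : ℤ) • q) ψ x)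
      (leafX k m (pushForward k ψ hs hc).1) := by
  have hK : IsCompact (Set.Icc (0 : Fin n → ℝ) 1 ×ˢ {gridPt k m}) :=
    isCompact_Icc.prod isCompact_singleton
  have hfin := (locallyFinite_translates hc k).finite_nonempty_inter_compact hK
  have hval : ∀ (x : Fin n → ℝ) (l : Lat n), halfPhase (-m) x *
      (automorphy k l (x, gridPt k m) * ψ ((x, gridPt k m) - l.toCov)) =
        leafXFun k (m - (k : ℤ) • l.2) ψ (x - intVec l.1) := fun x l => by
    rw [← mul_assoc, halfPhase_mul_automorphy_fst hk, leafXFun, gridPt_sub hk]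
    rfl
  have h := hasSum_setIntegral_finsum (H := fun q => leafXFun k (m - (k : ℤ) • q) ψ)
    (S := (hfin.toFinset).map (Equiv.prodComm _ _).toEmbedding)
    (fun q => contDiff_leafXFun _ _ hs)
    (fun q => (hasCompactSupport_slice_fst hc _).mul_left) fun x hx p q hne => by
      have h1 := hval x (p, q)
      simp only at h1
      rw [← h1] at hne
      simp only [Finset.mem_map_equiv, Set.Finite.mem_toFinset]
      exact ⟨(x, gridPt k m), right_ne_zero_of_mul hne, hx, rfl⟩
  convert h using 1
  refine integral_congr_ae (.of_forall fun x => ?_)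
  change halfPhase (-m) x * ∑ᶠ l : Lat n, _ = _
  rw [mul_finsum, ← finsum_comp_equiv (Equiv.prodComm (Fin n → ℤ) (Fin n → ℤ))]
  exact finsum_congr fun l => hval x l.swap

theorem hasSum_leafY_pushForward {n k : ℕ} (hk : 0 < k) (j : Fin n → ℤ) {ψ : Cov n → ℂ}
    (hs : ContDiff ℝ ∞ ψ) (hc : HasCompactSupport ψ) :
    HasSum (fun p : Fin n → ℤ => ∫ y, leafYFun k (j - (k : ℤ) • p) ψ y)
      (leafY k j (pushForward k ψ hs hc).1) := by
  have hK : IsCompact ({gridPt k j} ×ˢ Set.Icc (0 : Fin n → ℝ) 1) :=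
    isCompact_singleton.prod isCompact_Icc
  have hfin := (locallyFinite_translates hc k).finite_nonempty_inter_compact hK
  have hval : ∀ (y : Fin n → ℝ) (l : Lat n), halfPhase j y *
      (automorphy k l (gridPt k j, y) * ψ ((gridPt k j, y) - l.toCov)) =
        leafYFun k (j - (k : ℤ) • l.1) ψ (y - intVec l.2) := fun y l => by
    rw [← mul_assoc, halfPhase_mul_automorphy_snd hk, leafYFun, gridPt_sub hk]
    rfl
  have h := hasSum_setIntegral_finsum (H := fun p => leafYFun k (j - (k : ℤ) • p) ψ)
    (S := hfin.toFinset) (fun q => contDiff_leafYFun _ _ hs)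
    (fun q => (hasCompactSupport_slice_snd hc _).mul_left) fun y hy q p hne => by
      have h1 := hval y (p, q)
      simp only at h1
      rw [← h1] at hne
      simp only [Set.Finite.mem_toFinset]
      exact ⟨(gridPt k j, y), right_ne_zero_of_mul hne, rfl, hy⟩
  convert h using 1
  refine integral_congr_ae (.of_forall fun y => ?_)
  change halfPhase j y * ∑ᶠ l : Lat n, _ = _
  rw [mul_finsum]
  exact finsum_congr fun l => hval y l

/-! ### The Bohr–Sommerfeld bases in terms of leaf integrals -/

/-- `ϑ^m` is integration over the leaf `y = m / k`. -/
theorem theta_eq {n k : ℕ} (hk : 0 < k) (m : Fin n → Fin k) (τ : smoothSection n k) :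
    theta m τ = (((2 * k : ℝ) ^ (-(n : ℝ) / 2) : ℝ) : ℂ) *
      (starRingEnd ℂ) (leafX k (finVec m) τ.1) := by
  have hk' : (k : ℝ) ≠ 0 := by exact_mod_cast hk.ne'
  rw [theta, weilBrezin, leafX]
  congr 2
  refine integral_congr_ae (.of_forall fun x => ?_)
  have h1 : ∀ i, (0 : Fin n → ℝ) i + ((intRep m i : ℤ) : ℝ) / k = gridPt k (finVec m) i :=
    fun i => zero_add _
  have h2 : (k * Real.pi * ∑ i, x i * gridPt k (finVec m) i : ℝ) =
      Real.pi * ∑ i, (finVec m i : ℝ) * x i := by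
    rw [mul_right_comm, Finset.mul_sum, mul_comm]
    congr 1
    refine Finset.sum_congr rfl fun i _ => ?_
    rw [gridPt]; field_simp
  simp only [h1, h2]
  change halfPhase (finVec m) x * τ.1 (x, gridPt k (finVec m)) * _ = leafXFun k (finVec m) τ.1 x
  have h3 : Complex.exp (-(2 * Real.pi * ∑ i, (intRep m i : ℝ) * x i : ℝ) * Complex.I) =
      phase (-finVec m) x := (phase_neg _ _).symm
  rw [h3, ← halfPhase_mul_self, leafXFun]
  linear_combination (halfPhase (-finVec m) x * τ.1 (x, gridPt k (finVec m))) *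
    halfPhase_neg_mul (finVec m) x

section WeilBrezin

variable {n k : ℕ}

/-- `τ̃(x, y) = e^{kπi x·y} τ(x, y)`, which is periodic in `x`. -/
def untwist (τ : smoothSection n k) (u : (Fin n → ℝ) × (Fin n → ℝ)) : ℂ :=
  Complex.exp ((k * Real.pi * ∑ i, u.1 i * u.2 i : ℝ) * Complex.I) * τ.1 u

theorem contDiff_untwist (τ : smoothSection n k) : ContDiff ℝ ∞ (untwist τ) := by
  unfold untwist
  refine ContDiff.mul (ContDiff.cexp (ContDiff.mul (Complex.ofRealCLM.contDiff.comp
    (contDiff_const.mul (ContDiff.sum fun i _ => ?_))) contDiff_const)) τ.2.1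
  exact ((contDiff_apply ℝ ℝ i).comp contDiff_fst).mul ((contDiff_apply ℝ ℝ i).comp contDiff_snd)

theorem untwist_add_fst (τ : smoothSection n k) (p : Fin n → ℤ) (x y : Fin n → ℝ) :
    untwist τ (x + intVec p, y) = untwist τ (x, y) := by
  have h := τ.2.2 (p, 0) (x, y)
  have h1 : ((x, y) : Cov n) + Lat.toCov (p, 0) = (x + intVec p, y) := by
    ext i <;> simp [Lat.toCov, intVec]
  rw [h1] at h
  rw [untwist, untwist, h, automorphy, ← mul_assoc]
  congr 1
  simp only [Pi.zero_apply, mul_zero, Finset.sum_const_zero, zpow_zero, one_pow, one_mul]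
  rw [← Complex.exp_add, ← add_mul, ← Complex.ofReal_neg, ← Complex.ofReal_add]
  congr 3
  simp only [sympForm, Lat.toCov, intVec, Pi.add_apply, Pi.zero_apply, Int.cast_zero, mul_zero,
    sub_zero, add_mul, Finset.sum_add_distrib]
  simp only [mul_comm (y _)]
  ring

/-- Translation in `y` shifts the Fourier coefficients in `x`, so that a single Weil–Brezin
coefficient on `ℝⁿ` contains those on `[0,1]ⁿ` for all indices in a residue class modulo `k`. -/
theorem untwist_add_snd (τ : smoothSection n k) (q : Fin n → ℤ) (x y : Fin n → ℝ) :
    untwist τ (x, y + intVec q) = phase ((k : ℤ) • q) x * untwist τ (x, y) := by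
  have h := τ.2.2 (0, q) (x, y)
  have h1 : ((x, y) : Cov n) + Lat.toCov (0, q) = (x, y + intVec q) := by
    ext i <;> simp [Lat.toCov, intVec]
  rw [h1] at h
  rw [untwist, untwist, h, automorphy, ← mul_assoc, ← mul_assoc (phase _ _)]
  congr 1
  simp only [Pi.zero_apply, zero_mul, Finset.sum_const_zero, zpow_zero, one_pow, one_mul]
  rw [phase, ← Complex.exp_add, ← Complex.exp_add, ← add_mul, ← add_mul, ← Complex.ofReal_neg,
    ← Complex.ofReal_add, ← Complex.ofReal_add]
  congr 3
  simp only [sympForm, Lat.toCov, intVec, Pi.add_apply, Pi.zero_apply, Int.cast_zero, mul_zero,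
    zero_sub, mul_add, Finset.sum_add_distrib, Pi.smul_apply, smul_eq_mul, Int.cast_mul,
    Int.cast_natCast, mul_assoc, ← Finset.mul_sum, Finset.sum_neg_distrib]
  simp only [mul_comm (x _)]
  ring

theorem weilBrezin_eq (τ : smoothSection n k) (m : Fin n → ℤ) (y : Fin n → ℝ) :
    weilBrezin τ m y = fourierCoef (fun x => untwist τ (x, y + gridPt k m)) m := by
  rw [weilBrezin, fourierCoef]
  simp only [phase_neg]
  rfl

/-- The integral of the `m`-th Weil–Brezin coefficient is a discrete Fourier transform of integrals
over the Bohr–Sommerfeld leaves `x = j / k`. -/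
theorem integral_weilBrezin (hk : 0 < k) (τ : smoothSection n k) (m : Fin n → ℤ) :
    ∫ y, weilBrezin τ m y = ((k : ℂ) ^ n)⁻¹ * ∑ j : Fin n → Fin k,
      phase (-m) (gridPt k (finVec j)) * leafY k (finVec j) τ.1 := by
  have hk' : (k : ℝ) ≠ 0 := by exact_mod_cast hk.ne'
  let c : (Fin n → ℤ) → (Fin n → ℝ) → ℂ := fun l y => fourierCoef (fun x => untwist τ (x, y)) l
  have hF := contDiff_untwist τ
  have hper : ∀ y, IsPeriodic fun x => untwist τ (x, y) := fun y p x => untwist_add_fst τ p x y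
  have hcc : ∀ l, Continuous (c l) := fun l =>
    continuous_parametric_integral_of_continuous
      (f := fun (y x : Fin n → ℝ) => untwist τ (x, y) * phase (-l) x)
      ((hF.continuous.comp (by fun_prop : Continuous fun p : (Fin n → ℝ) × (Fin n → ℝ) =>
        (p.2, p.1))).mul ((contDiff_phase (-l)).continuous.comp continuous_snd)) isCompact_Icc
  have hshift : ∀ q y, c m (y + intVec q) = c (m - (k : ℤ) • q) y := fun q y => by
    simp only [c, fourierCoef]
    refine integral_congr_ae (.of_forall fun x => ?_)
    simp only [untwist_add_snd]
    rw [neg_sub, sub_eq_add_neg, phase_add]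
    ring
  have hinj : Function.Injective fun q : Fin n → ℤ => m - (k : ℤ) • q := fun q q' h => by
    funext i
    have := congrFun h i
    simpa [hk.ne'] using this
  obtain ⟨C, hC⟩ := exists_fourierCoef_le hF hper (isCompact_Icc (a := (0 : Fin n → ℝ)) (b := 1))
    (Fintype.card (Fin n))
  have hb : Summable fun q : Fin n → ℤ =>
      C * (symbolWeight (m - (k : ℤ) • q) ^ Fintype.card (Fin n))⁻¹ :=
    (summable_symbolWeight.mul_left C).comp_injective hinj
  have hint : Integrable (c m) := integrable_of_summable_cubes (hcc m) hb fun q y hy => by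
    rw [hshift]; exact hC y hy _
  -- the integral over `ℝⁿ`, cut into unit cubes
  have h1 : HasSum (fun q : Fin n → ℤ => ∫ y in Set.Icc (0 : Fin n → ℝ) 1, c (m - (k : ℤ) • q) y)
      (∫ y, c m y) := by
    simpa only [hshift] using hasSum_unfold hint
  -- for fixed `y`, aliasing evaluates the sum over the residue class of `m`
  have h2 : ∀ y, HasSum (fun q : Fin n → ℤ => c (m - (k : ℤ) • q) y)
      (((k : ℂ) ^ n)⁻¹ * ∑ j : Fin n → Fin k,
        phase (-m) (gridPt k (finVec j)) * leafYFun k (finVec j) τ.1 y) := fun y => by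
    have h := hasSum_aliasing (hper y)
      (hF.comp (contDiff_id.prodMk contDiff_const)) hk m
    rw [← (Equiv.neg _).hasSum_iff] at h
    have hval : ∀ j : Fin n → Fin k, untwist τ (gridPt k (finVec j), y) =
        leafYFun k (finVec j) τ.1 y := fun j => by
      rw [untwist, leafYFun, halfPhase]
      congr 4
      rw [mul_right_comm, Finset.mul_sum, mul_comm]
      congr 1
      refine Finset.sum_congr rfl fun i _ => ?_
      simp only [gridPt]; field_simp
    simp only [hval, Fintype.card_fin] at h
    refine h.congr_fun fun q => ?_
    simp [c, sub_eq_add_neg]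
  have h3 : HasSum (fun q : Fin n → ℤ => ∫ y in Set.Icc (0 : Fin n → ℝ) 1, c (m - (k : ℤ) • q) y)
      (∫ y in Set.Icc (0 : Fin n → ℝ) 1, (((k : ℂ) ^ n)⁻¹ * ∑ j : Fin n → Fin k,
        phase (-m) (gridPt k (finVec j)) * leafYFun k (finVec j) τ.1 y)) := by
    refine hasSum_integral_of_dominated_convergence
      (fun q _ => C * (symbolWeight (m - (k : ℤ) • q) ^ Fintype.card (Fin n))⁻¹)
      (fun q => (hcc _).aestronglyMeasurable)
      (fun q => (ae_restrict_iff' measurableSet_Icc).mpr (.of_forall fun y hy => hC y hy _))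
      (.of_forall fun y => hb) ?_ (.of_forall h2)
    exact integrableOn_const (by simp [Real.volume_Icc_pi])
  have h4 : ∫ y, weilBrezin τ m y = ∫ y, c m y := by
    simp only [weilBrezin_eq]
    exact integral_add_right_eq_self (c m) (gridPt k m)
  rw [h4, h1.unique h3, integral_const_mul, integral_finsetSum]
  · simp only [integral_const_mul, leafY]
  · exact fun j _ => (((contDiff_leafYFun k _ τ.2.1).continuous.const_mul
      _).continuousOn.integrableOn_compact isCompact_Icc)

/-- `ϑ̌^m` is a combination of the integrations over the leaves `x = j / k`. -/
theorem thetaCheck_eq (hk : 0 < k) (m : Fin n → Fin k) (τ : smoothSection n k) :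
    thetaCheck m τ = (((2 : ℝ) ^ (-(n : ℝ) / 2) : ℝ) : ℂ) * (starRingEnd ℂ)
      (((k : ℂ) ^ n)⁻¹ * ∑ j : Fin n → Fin k,
        phase (-finVec m) (gridPt k (finVec j)) * leafY k (finVec j) τ.1) := by
  rw [thetaCheck, integral_conj]
  exact congrArg (fun z => _ * (starRingEnd ℂ) z) (integral_weilBrezin hk τ (finVec m))

end WeilBrezin

/-! ### The pairing of the two Bohr–Sommerfeld bases -/

theorem mulSection_pushForward {n k : ℕ} (g : smoothFun n) {ψ : Cov n → ℂ}
    (hs : ContDiff ℝ ∞ ψ) (hc : HasCompactSupport ψ) :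
    mulSection g (pushForward k ψ hs hc) =
      pushForward k (fun u => g.1 u * ψ u) (g.2.1.mul hs) hc.mul_left := by
  apply Subtype.ext
  funext u
  change g.1 u * ∑ᶠ l : Lat n, automorphy k l u * ψ (u - l.toCov) =
    ∑ᶠ l : Lat n, automorphy k l u * (g.1 (u - l.toCov) * ψ (u - l.toCov))
  rw [mul_finsum]
  refine finsum_congr fun l => ?_
  have h := g.2.2 l (u - l.toCov)
  rw [sub_add_cancel] at h
  rw [h]
  ring

section Pairing

variable {n : ℕ}

/-- The character `e^{2πi ξ·a}`. -/
def pairPhase (ξ a : Fin n → ℝ) : ℂ :=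
  Complex.exp ((2 * Real.pi * ∑ i, ξ i * a i : ℝ) * Complex.I)

theorem norm_pairPhase (ξ a : Fin n → ℝ) : ‖pairPhase ξ a‖ = 1 :=
  Complex.norm_exp_ofReal_mul_I _

theorem continuous_pairPhase (a : Fin n → ℝ) : Continuous fun ξ => pairPhase ξ a := by
  unfold pairPhase
  fun_prop

theorem cutoffChar_eq (χ : Cutoff n) (ζ u : Cov n) :
    cutoffChar χ ζ u = χ.toFun u * (pairPhase ζ.1 u.1 * pairPhase ζ.2 u.2) := by
  rw [cutoffChar, pairPhase, pairPhase, ← Complex.exp_add]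
  congr 2
  push_cast
  ring

/-- The localization of the trivialized function `f` to a lift of the leaf `y = m / k`. -/
def cutLeafX (k : ℕ) (f : Cov n → ℂ) (χ : Cutoff n) (m : Fin n → ℤ) (x : Fin n → ℝ) : ℂ :=
  halfPhase m x * (f (x, gridPt k m) * χ.toFun (x, gridPt k m))

/-- The localization of the trivialization to a lift of the leaf `x = j / k`. -/
def cutLeafY (k : ℕ) (χ : Cutoff n) (j : Fin n → ℤ) (y : Fin n → ℝ) : ℂ :=
  halfPhase j y * χ.toFun (gridPt k j, y)

theorem Cutoff.contDiff_ofReal (χ : Cutoff n) : ContDiff ℝ ∞ fun u => (χ.toFun u : ℂ) :=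
  Complex.ofRealCLM.contDiff.comp χ.smooth

theorem Cutoff.hasCompactSupport_ofReal (χ : Cutoff n) :
    HasCompactSupport fun u => (χ.toFun u : ℂ) :=
  χ.compact.comp_left (g := fun t : ℝ => (t : ℂ)) Complex.ofReal_zero

theorem contDiff_cutLeafX (k : ℕ) {f : Cov n → ℂ} (hf : ContDiff ℝ ∞ f) (χ : Cutoff n)
    (m : Fin n → ℤ) : ContDiff ℝ ∞ (cutLeafX k f χ m) :=
  (contDiff_halfPhase m).mul ((hf.mul χ.contDiff_ofReal).comp
    (contDiff_id.prodMk contDiff_const))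

theorem contDiff_cutLeafY (k : ℕ) (χ : Cutoff n) (j : Fin n → ℤ) :
    ContDiff ℝ ∞ (cutLeafY k χ j) :=
  (contDiff_halfPhase j).mul (χ.contDiff_ofReal.comp (contDiff_const.prodMk contDiff_id))

theorem hasCompactSupport_cutLeafX (k : ℕ) (f : Cov n → ℂ) (χ : Cutoff n) (m : Fin n → ℤ) :
    HasCompactSupport (cutLeafX k f χ m) :=
  ((hasCompactSupport_slice_fst χ.hasCompactSupport_ofReal (gridPt k m)).mul_left).mul_left

theorem hasCompactSupport_cutLeafY (k : ℕ) (χ : Cutoff n) (j : Fin n → ℤ) :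
    HasCompactSupport (cutLeafY k χ j) :=
  (hasCompactSupport_slice_snd χ.hasCompactSupport_ofReal (gridPt k j)).mul_left

theorem Cutoff.exists_finset_leafX (χ : Cutoff n) {k : ℕ} (hk : 0 < k) (m : Fin n → ℤ) :
    ∃ Q : Finset (Fin n → ℤ), ∀ q ∉ Q, ∀ x, χ.toFun (x, gridPt k (m - (k : ℤ) • q)) = 0 := by
  have hfin := finite_setOf_gridPt_mem hk (χ.compact.isCompact.image continuous_snd).isBounded
  have hinj : Function.Injective fun q : Fin n → ℤ => m - (k : ℤ) • q := fun q q' h => by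
    funext i
    have := congrFun h i
    simpa [hk.ne'] using this
  refine ⟨(hfin.preimage hinj.injOn).toFinset, fun q hq x => ?_⟩
  by_contra h
  exact hq ((Set.Finite.mem_toFinset _).mpr ⟨_, subset_tsupport _ h, rfl⟩)

theorem Cutoff.exists_finset_leafY (χ : Cutoff n) {k : ℕ} (hk : 0 < k) (j : Fin n → ℤ) :
    ∃ P : Finset (Fin n → ℤ), ∀ p ∉ P, ∀ y, χ.toFun (gridPt k (j - (k : ℤ) • p), y) = 0 := by
  have hfin := finite_setOf_gridPt_mem hk (χ.compact.isCompact.image continuous_fst).isBounded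
  have hinj : Function.Injective fun q : Fin n → ℤ => j - (k : ℤ) • q := fun q q' h => by
    funext i
    have := congrFun h i
    simpa [hk.ne'] using this
  refine ⟨(hfin.preimage hinj.injOn).toFinset, fun q hq x => ?_⟩
  by_contra h
  exact hq ((Set.Finite.mem_toFinset _).mpr ⟨_, subset_tsupport _ h, rfl⟩)

/-- The normalization of `ϑ^m`. -/
def thetaNorm (n k : ℕ) : ℂ := (((2 * k : ℝ) ^ (-(n : ℝ) / 2) : ℝ) : ℂ)

/-- The normalization of the conjugate of `σ̌^m`. -/
def sigmaCheckNorm (n k : ℕ) : ℂ :=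
  (basisNorm n k : ℂ) * (((2 : ℝ) ^ (-(n : ℝ) / 2) : ℝ) : ℂ) * ((k : ℂ) ^ n)⁻¹

/-- A localization of `f ϑ^m` is a finite sum of densities on lifts of the leaf `y = m / k`. Its Fourier
transform at `(ξ, η)` is a sum of characters of `η` times rapidly decaying functions of `ξ`. -/
theorem localFourier_mul_theta {k : ℕ} (hk : 0 < k) (f : smoothFun n) (m : Fin n → Fin k)
    (χ : Cutoff n) {Q : Finset (Fin n → ℤ)}
    (hQ : ∀ q ∉ Q, ∀ x, χ.toFun (x, gridPt k (finVec m - (k : ℤ) • q)) = 0) (ζ : Cov n) :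
    localFourier χ (fun τ => theta m (mulSection (conjFun f) τ)) ζ =
      thetaNorm n k * ∑ q ∈ Q, pairPhase (-ζ.2) (gridPt k (finVec m - (k : ℤ) • q)) *
        coordFourier (cutLeafX k f.1 χ (finVec m - (k : ℤ) • q)) ζ.1 := by
  rw [localFourier, mulSection_pushForward, theta_eq hk]
  have h := (hasSum_leafX_pushForward hk (finVec m)
    ((conjFun f).2.1.mul (contDiff_cutoffChar χ ζ))
    (hasCompactSupport_cutoffChar χ ζ).mul_left).unique
    (hasSum_sum_of_ne_finset_zero (s := Q) fun q hq => by
      simp only [leafXFun, cutoffChar, hQ q hq, Complex.ofReal_zero, zero_mul, mul_zero,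
        integral_zero])
  rw [h, map_sum, thetaNorm]
  congr 1
  refine Finset.sum_congr rfl fun q _ => ?_
  rw [coordFourier, ← integral_conj, ← integral_const_mul]
  refine integral_congr_ae (.of_forall fun x => ?_)
  set l := finVec m - (k : ℤ) • q
  simp only [leafXFun, cutLeafX, cutoffChar_eq, map_mul, conj_halfPhase, neg_neg,
    Complex.conj_ofReal]
  have h1 : (starRingEnd ℂ) ((conjFun f).1 (x, gridPt k l)) = f.1 (x, gridPt k l) :=
    Complex.conj_conj _
  have h2 : ∀ a b : Fin n → ℝ, (starRingEnd ℂ) (pairPhase a b) =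
      Complex.exp (-(2 * Real.pi * ∑ i, a i * b i : ℝ) * Complex.I) := fun a b => by
    rw [pairPhase, ← Complex.exp_conj, map_mul, Complex.conj_ofReal, Complex.conj_I, mul_neg, neg_mul]
  have h3 : ∀ a b : Fin n → ℝ, pairPhase (-a) b =
      Complex.exp (-(2 * Real.pi * ∑ i, a i * b i : ℝ) * Complex.I) := fun a b => by
    rw [pairPhase]; simp
  rw [h1, h2, h2, h3]
  ring

/-- A localization of `σ̌^m` is a finite sum of densities on lifts of the leaves `x = j / k`. Its Fourier
transform at `(ξ, η)` is a sum of characters of `ξ` times rapidly decaying functions of `η`. -/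
theorem conj_localFourier_sigmaCheck {k : ℕ} (hk : 0 < k) (m : Fin n → Fin k)
    (χ : Cutoff n) {P : (Fin n → Fin k) → Finset (Fin n → ℤ)}
    (hP : ∀ j, ∀ p ∉ P j, ∀ y, χ.toFun (gridPt k (finVec j - (k : ℤ) • p), y) = 0) (ζ : Cov n) :
    (starRingEnd ℂ) (localFourier (k := k) χ (sigmaCheck m) ζ) =
      sigmaCheckNorm n k * ∑ j : Fin n → Fin k, phase (-finVec m) (gridPt k (finVec j)) *
        ∑ p ∈ P j, pairPhase ζ.1 (gridPt k (finVec j - (k : ℤ) • p)) *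
          coordFourier (cutLeafY k χ (finVec j - (k : ℤ) • p)) (-ζ.2) := by
  rw [localFourier, sigmaCheck, thetaCheck_eq hk, map_mul, map_mul, Complex.conj_ofReal,
    Complex.conj_ofReal, Complex.conj_conj, sigmaCheckNorm, ← mul_assoc, ← mul_assoc]
  congr 1
  refine Finset.sum_congr rfl fun j _ => ?_
  congr 1
  rw [(hasSum_leafY_pushForward hk (finVec j) (contDiff_cutoffChar χ ζ)
    (hasCompactSupport_cutoffChar χ ζ)).unique
    (hasSum_sum_of_ne_finset_zero (s := P j) fun p hp => by
      simp only [leafYFun, cutoffChar, hP j p hp, Complex.ofReal_zero, zero_mul, mul_zero,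
        integral_zero])]
  refine Finset.sum_congr rfl fun p _ => ?_
  rw [coordFourier, ← integral_const_mul]
  refine integral_congr_ae (.of_forall fun y => ?_)
  have h3 : ∀ a b : Fin n → ℝ, pairPhase a b =
      Complex.exp (-(2 * Real.pi * ∑ i, (-a) i * b i : ℝ) * Complex.I) := fun a b => by
    rw [pairPhase]; simp
  simp only [leafYFun, cutLeafY, cutoffChar_eq]
  rw [← h3]
  ring

theorem phase_gridPt_shift {k : ℕ} (hk : 0 < k) (m j p q : Fin n → ℤ) :
    phase (m - (k : ℤ) • q) (gridPt k (j - (k : ℤ) • p)) = phase m (gridPt k j) := by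
  have hk' : (k : ℝ) ≠ 0 := by exact_mod_cast hk.ne'
  have h1 : phase (-((k : ℤ) • q)) (gridPt k j) = phase (-q) (intVec j) := by
    rw [phase, phase]
    congr 3
    refine congrArg _ (Finset.sum_congr rfl fun i _ => ?_)
    simp only [gridPt, intVec, Pi.neg_apply, Pi.smul_apply, smul_eq_mul]
    push_cast
    field_simp
  rw [gridPt_sub hk, sub_eq_add_neg (gridPt k j), ← intVec_neg, isPeriodic_phase, sub_eq_add_neg,
    phase_add, h1, phase_intVec, mul_one]

/-- The pairing of `f ϑ^m` and `σ̌^{m'}`, by Fourier inversion along the two families of leaves. -/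
theorem hasPairing_theta_sigmaCheck {k : ℕ} (hk : 0 < k) (f : smoothFun n)
    (m m' : Fin n → Fin k) :
    HasPairing (fun τ => theta m (mulSection (conjFun f) τ)) (sigmaCheck m')
      (thetaNorm n k * sigmaCheckNorm n k * ∑ j : Fin n → Fin k,
        phase (finVec m - finVec m') (gridPt k (finVec j)) *
          f.1 (gridPt k (finVec j), gridPt k (finVec m))) := by
  intro χ₁ χ₂ hχ
  obtain ⟨Q, hQ⟩ := χ₁.exists_finset_leafX hk (finVec m)
  choose P hP using fun j : Fin n → Fin k => χ₂.exists_finset_leafY hk (finVec j)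
  let lx : (Fin n → ℤ) → (Fin n → ℤ) := fun q => finVec m - (k : ℤ) • q
  let ly : (Fin n → Fin k) → (Fin n → ℤ) → (Fin n → ℤ) := fun j p => finVec j - (k : ℤ) • p
  let A : (Fin n → ℤ) → (Fin n → ℤ) → (Fin n → ℝ) → ℂ := fun a b ξ =>
    pairPhase ξ (gridPt k b) * coordFourier (cutLeafX k f.1 χ₁ a) ξ
  let B : (Fin n → ℤ) → (Fin n → ℤ) → (Fin n → ℝ) → ℂ := fun a b η =>
    pairPhase η (gridPt k a) * coordFourier (cutLeafY k χ₂ b) η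
  have hbdd : ∀ {g : (Fin n → ℝ) → ℂ} (a : Fin n → ℝ), Integrable g →
      Integrable fun ξ => pairPhase ξ a * g ξ := fun a hg =>
    hg.bdd_mul (c := 1) (continuous_pairPhase a).aestronglyMeasurable
      (.of_forall fun ξ => (norm_pairPhase ξ a).le)
  have hA : ∀ a b, Integrable (A a b) ∧ ∫ ξ, A a b ξ = cutLeafX k f.1 χ₁ a (gridPt k b) :=
    fun a b => by
      have h := integrable_coordFourier_and_inversion (contDiff_cutLeafX k f.2.1 χ₁ a)
        (hasCompactSupport_cutLeafX k f.1 χ₁ a)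
      exact ⟨hbdd _ h.1, h.2 _⟩
  have hB : ∀ a b, Integrable (fun η => B a b (-η)) ∧
      ∫ η, B a b (-η) = cutLeafY k χ₂ b (gridPt k a) := fun a b => by
    have h := integrable_coordFourier_and_inversion (contDiff_cutLeafY k χ₂ b)
      (hasCompactSupport_cutLeafY k χ₂ b)
    refine ⟨(hbdd (gridPt k a) h.1).comp_neg, ?_⟩
    rw [integral_neg_eq_self (B a b)]
    exact h.2 _
  -- the integrand is a sum of products of a function of `ξ` and a function of `η`
  have hprod : ∀ ζ : Cov n, localFourier χ₁ (fun τ => theta m (mulSection (conjFun f) τ)) ζ *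
      (starRingEnd ℂ) (localFourier χ₂ (sigmaCheck m') ζ) =
      thetaNorm n k * sigmaCheckNorm n k * ∑ j : Fin n → Fin k,
        phase (-finVec m') (gridPt k (finVec j)) * ∑ p ∈ P j, ∑ q ∈ Q,
          A (lx q) (ly j p) ζ.1 * B (lx q) (ly j p) (-ζ.2) := fun ζ => by
    rw [localFourier_mul_theta hk f m χ₁ hQ, conj_localFourier_sigmaCheck hk m' χ₂ hP,
      mul_mul_mul_comm]
    congr 1
    rw [Finset.mul_sum]
    refine Finset.sum_congr rfl fun j _ => ?_
    rw [mul_left_comm, Finset.mul_sum]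
    congr 1
    refine Finset.sum_congr rfl fun p _ => ?_
    rw [Finset.sum_mul]
    refine Finset.sum_congr rfl fun q _ => ?_
    simp only [A, B, lx, ly]
    ring
  have hI : ∀ j p q, Integrable fun ζ : Cov n =>
      A (lx q) (ly j p) ζ.1 * B (lx q) (ly j p) (-ζ.2) := fun j p q =>
    (hA _ _).1.mul_prod (hB _ _).1
  have hI2 : ∀ j, Integrable fun ζ : Cov n => phase (-finVec m') (gridPt k (finVec j)) *
      ∑ p ∈ P j, ∑ q ∈ Q, A (lx q) (ly j p) ζ.1 * B (lx q) (ly j p) (-ζ.2) := fun j =>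
    (integrable_finsetSum _ fun p _ => integrable_finsetSum _ fun q _ => hI j p q).const_mul _
  simp only [hprod]
  refine ⟨(integrable_finsetSum _ fun j _ => hI2 j).const_mul _, ?_⟩
  rw [integral_const_mul, integral_finsetSum _ fun j _ => hI2 j]
  congr 1
  refine Finset.sum_congr rfl fun j _ => ?_
  rw [integral_const_mul, integral_finsetSum _ fun p _ =>
    integrable_finsetSum _ fun q _ => hI j p q]
  -- Fourier inversion gives the values at the intersection points of the leaves
  have hterm : ∀ p q, ∫ ζ : Cov n, A (lx q) (ly j p) ζ.1 * B (lx q) (ly j p) (-ζ.2) =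
      phase (finVec m) (gridPt k (finVec j)) * f.1 (gridPt k (finVec j), gridPt k (finVec m)) *
        ((χ₁.toFun ((gridPt k (finVec j), gridPt k (finVec m)) - Lat.toCov (p, q)) *
          χ₂.toFun ((gridPt k (finVec j), gridPt k (finVec m)) - Lat.toCov (p, q)) : ℝ) : ℂ) :=
    fun p q => by
      have h1 : (gridPt k (ly j p), gridPt k (lx q)) =
          (gridPt k (finVec j), gridPt k (finVec m)) - Lat.toCov (p, q) := by
        simp only [lx, ly, gridPt_sub hk]
        rfl
      have h2 : f.1 (gridPt k (ly j p), gridPt k (lx q)) =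
          f.1 (gridPt k (finVec j), gridPt k (finVec m)) := by
        rw [h1, ← f.2.2 (p, q), sub_add_cancel]
      rw [show (volume : Measure (Cov n)) = Measure.prod volume volume from rfl,
        integral_prod_mul (A (lx q) (ly j p)) fun η => B (lx q) (ly j p) (-η), (hA _ _).2,
        (hB _ _).2, cutLeafX, cutLeafY, h2, h1, ← phase_gridPt_shift hk (finVec m) (finVec j) p q,
        ← halfPhase_mul_self, halfPhase_gridPt_comm (ly j p)]
      push_cast
      ring
  have hsum : ∑ p ∈ P j, ∑ q ∈ Q,
      χ₁.toFun ((gridPt k (finVec j), gridPt k (finVec m)) - Lat.toCov (p, q)) *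
        χ₂.toFun ((gridPt k (finVec j), gridPt k (finVec m)) - Lat.toCov (p, q)) = 1 := by
    rw [← hχ (gridPt k (finVec j), gridPt k (finVec m)), ← Finset.sum_product',
      finsum_eq_sum_of_support_subset]
    intro l hl
    have hl' : (gridPt k (finVec j), gridPt k (finVec m)) - l.toCov =
        (gridPt k (ly j l.1), gridPt k (lx l.2)) := by
      simp only [lx, ly, gridPt_sub hk]
      rfl
    simp only [Function.mem_support, hl'] at hl
    simp only [Finset.coe_product, Set.mem_prod, Finset.mem_coe]
    constructor
    · by_contra h
      exact hl (by rw [hP j l.1 h, mul_zero])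
    · by_contra h
      exact hl (by rw [hQ l.2 h, zero_mul])
  have hsumI : ∀ p ∈ P j, ∫ ζ : Cov n, ∑ q ∈ Q,
      A (lx q) (ly j p) ζ.1 * B (lx q) (ly j p) (-ζ.2) = ∑ q ∈ Q,
      ∫ ζ : Cov n, A (lx q) (ly j p) ζ.1 * B (lx q) (ly j p) (-ζ.2) :=
    fun p _ => integral_finsetSum _ fun q _ => hI j p q
  rw [Finset.sum_congr rfl hsumI]
  simp only [hterm, ← Finset.mul_sum, ← Complex.ofReal_sum]
  rw [hsum, sub_eq_add_neg, phase_add]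
  push_cast
  ring

theorem HasPairing.sum {k : ℕ} {I : Type} {s : Finset I} {u : I → smoothSection n k → ℂ}
    {v : smoothSection n k → ℂ} {c : I → ℂ} (a : I → ℂ)
    (h : ∀ i ∈ s, HasPairing (u i) v (c i)) :
    HasPairing (fun τ => ∑ i ∈ s, a i * u i τ) v (∑ i ∈ s, a i * c i) := by
  intro χ₁ χ₂ hχ
  have h1 : ∀ ζ, localFourier χ₁ (fun τ => ∑ i ∈ s, a i * u i τ) ζ *
      (starRingEnd ℂ) (localFourier χ₂ v ζ) = ∑ i ∈ s, a i * (localFourier χ₁ (u i) ζ *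
      (starRingEnd ℂ) (localFourier χ₂ v ζ)) := fun ζ => by
    simp only [localFourier, Finset.sum_mul, mul_assoc]
  have h2 := fun i (hi : i ∈ s) => ((h i hi χ₁ χ₂ hχ).1).const_mul (a i)
  simp only [h1]
  refine ⟨integrable_finsetSum _ h2, ?_⟩
  rw [integral_finsetSum _ h2]
  exact Finset.sum_congr rfl fun i hi => by rw [integral_const_mul, (h i hi χ₁ χ₂ hχ).2]

end Pairing

/-! ### Partitions of unity adapted to the leaves -/

section Partition

variable {n : ℕ}

theorem automorphy_zero (l : Lat n) (u : Cov n) : automorphy 0 l u = 1 := by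
  simp [automorphy]

theorem automorphy_mul_sub {k : ℕ} (τ : smoothSection n k) (l : Lat n) (u : Cov n) :
    automorphy k l u * τ.1 (u - l.toCov) = τ.1 u := by
  have h := τ.2.2 l (u - l.toCov)
  rw [sub_add_cancel, automorphy_sub_self] at h
  exact h.symm

theorem finite_support_translates {ψ : Cov n → ℂ} (hc : HasCompactSupport ψ) (u : Cov n) :
    (Function.support fun l : Lat n => ψ (u - l.toCov)).Finite := by
  have h := (locallyFinite_translates hc 0).point_finite u
  refine h.subset fun l hl => ?_
  simpa [automorphy_zero] using hl

theorem finite_support_translates_real {ψ : Cov n → ℝ} (hc : HasCompactSupport ψ) (u : Cov n) :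
    (Function.support fun l : Lat n => ψ (u - l.toCov)).Finite := by
  refine (finite_support_translates (hc.comp_left (g := fun t : ℝ => (t : ℂ))
    Complex.ofReal_zero) u).subset fun l hl => ?_
  simpa using hl

/-- The periodization of a smooth function with compact support is smooth. -/
theorem contDiff_periodization {ψ : Cov n → ℝ} (hs : ContDiff ℝ ∞ ψ) (hc : HasCompactSupport ψ) :
    ContDiff ℝ ∞ fun u => ∑ᶠ l : Lat n, ψ (u - l.toCov) := by
  have hc' : HasCompactSupport fun u => (ψ u : ℂ) :=
    hc.comp_left (g := fun t : ℝ => (t : ℂ)) Complex.ofReal_zero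
  have h := (pushForward 0 (fun u => (ψ u : ℂ)) (Complex.ofRealCLM.contDiff.comp hs) hc').2.1
  have h2 := Complex.reCLM.contDiff.comp h
  refine (congrArg (ContDiff ℝ ∞) (funext fun u => ?_)).mpr h2
  change _ = Complex.reAddGroupHom (∑ᶠ l : Lat n, automorphy 0 l u * (ψ (u - l.toCov) : ℂ))
  rw [Complex.reAddGroupHom.map_finsum]
  · simp [automorphy_zero]
  · have h3 : (Function.support fun l : Lat n =>
        automorphy 0 l u * (ψ (u - l.toCov) : ℂ)).Finite := by
      simpa only [automorphy_zero, one_mul] using finite_support_translates hc' u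
    exact h3

theorem periodization_sub {ψ : Cov n → ℝ} (u : Cov n) (m : Lat n) :
    ∑ᶠ l : Lat n, ψ (u - m.toCov - l.toCov) = ∑ᶠ l : Lat n, ψ (u - l.toCov) := by
  refine Eq.trans (finsum_congr fun l => ?_)
    (finsum_comp_equiv (f := fun l : Lat n => ψ (u - l.toCov)) (Equiv.addRight m))
  rw [Equiv.coe_addRight, Lat.toCov_add, sub_sub, add_comm m.toCov]

/-- The bump function around the leaf `y = a`, of width `4 / (5k)`. -/
def leafBump (k : ℕ) (hk : 0 < k) (a : Fin n → ℝ) : Cutoff n :=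
  let b₁ : ContDiffBump (0 : Fin n → ℝ) := ⟨1, 2, one_pos, one_lt_two⟩
  let b₂ : ContDiffBump a := ⟨3 / 5 / k, 4 / 5 / k, by positivity, by
    have : (0 : ℝ) < k := by exact_mod_cast hk
    gcongr; norm_num⟩
  { toFun := fun u => b₁ u.1 * b₂ u.2
    smooth := (b₁.contDiff.comp contDiff_fst).mul (b₂.contDiff.comp contDiff_snd)
    compact := by
      refine HasCompactSupport.of_support_subset_isCompact
        (b₁.hasCompactSupport.isCompact.prod b₂.hasCompactSupport.isCompact) fun u hu => ?_
      exact ⟨subset_tsupport _ (left_ne_zero_of_mul hu),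
        subset_tsupport _ (right_ne_zero_of_mul hu)⟩ }

theorem leafBump_nonneg (k : ℕ) (hk : 0 < k) (a : Fin n → ℝ) (u : Cov n) :
    0 ≤ (leafBump k hk a).toFun u :=
  mul_nonneg (ContDiffBump.nonneg _) (ContDiffBump.nonneg _)

theorem leafBump_eq_one (k : ℕ) (hk : 0 < k) (a : Fin n → ℝ) {u : Cov n} (h1 : ‖u.1‖ ≤ 1)
    (h2 : ‖u.2 - a‖ ≤ 3 / 5 / k) : (leafBump k hk a).toFun u = 1 := by
  simp only [leafBump]
  rw [ContDiffBump.one_of_mem_closedBall, ContDiffBump.one_of_mem_closedBall, one_mul]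
  · simpa [dist_eq_norm] using h2
  · simpa using h1

theorem norm_lt_of_leafBump_ne_zero {k : ℕ} {hk : 0 < k} {a : Fin n → ℝ} {u : Cov n}
    (h : (leafBump k hk a).toFun u ≠ 0) : ‖u.2 - a‖ < 4 / 5 / k := by
  have h1 := right_ne_zero_of_mul h
  by_contra hle
  exact h1 (ContDiffBump.zero_of_le_dist _ (by simpa [dist_eq_norm] using hle))

/-- Every point lies close to one of the leaves `y = m / k`, up to a lattice translation. -/
theorem exists_near_leaf {k : ℕ} (hk : 0 < k) (u : Cov n) : ∃ (m : Fin n → Fin k) (l : Lat n),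
    ‖(u - l.toCov).1‖ ≤ 1 ∧ ‖(u - l.toCov).2 - gridPt k (finVec m)‖ ≤ 3 / 5 / k := by
  have hk' : (0 : ℝ) < k := by exact_mod_cast hk
  have hkz : (0 : ℤ) < k := by exact_mod_cast hk
  let q : Fin n → ℤ := fun i => round (k * u.2 i)
  refine ⟨fun i => ⟨(q i % k).toNat, ?_⟩, (fun i => ⌊u.1 i⌋, fun i => q i / k), ?_, ?_⟩
  · have h1 := Int.emod_nonneg (q i) hkz.ne'
    have h2 := Int.emod_lt_of_pos (q i) hkz
    omega
  · refine (pi_norm_le_iff_of_nonneg zero_le_one).mpr fun i => ?_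
    have h1 := Int.fract_nonneg (u.1 i)
    have h2 := Int.fract_lt_one (u.1 i)
    rw [Real.norm_eq_abs, abs_le]
    constructor <;> simp [Lat.toCov] <;> linarith
  · refine (pi_norm_le_iff_of_nonneg (by positivity)).mpr fun i => ?_
    have h1 := abs_sub_round (k * u.2 i)
    have h2 : ((q i % k).toNat : ℤ) = q i % k := Int.toNat_of_nonneg (Int.emod_nonneg _ hkz.ne')
    have h3 : ((q i : ℤ) : ℝ) = ((q i % k : ℤ) : ℝ) + k * ((q i / k : ℤ) : ℝ) := by
      exact_mod_cast (Int.emod_add_mul_ediv (q i) k).symm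
    have h4 : (u - Lat.toCov (fun i => ⌊u.1 i⌋, fun i => q i / k)).2 i -
        gridPt k (finVec fun i => (⟨(q i % k).toNat, by
          have h1 := Int.emod_nonneg (q i) hkz.ne'
          have h2 := Int.emod_lt_of_pos (q i) hkz
          omega⟩ : Fin k)) i = (k * u.2 i - q i) / k := by
      simp only [gridPt, finVec, Lat.toCov, Prod.snd_sub, Pi.sub_apply, h2, h3]
      field_simp
      ring
    rw [Pi.sub_apply, h4, Real.norm_eq_abs, abs_div, abs_of_pos hk']
    gcongr
    exact h1.trans (by norm_num)

/-- A smooth partition of unity on `X`, given by functions on the universal cover, each of them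
supported near a single leaf. -/
theorem exists_leaf_partition (n : ℕ) {k : ℕ} (hk : 0 < k) :
    ∃ χ : (Fin n → Fin k) → Cutoff n,
      (∀ m u, (χ m).toFun u ≠ 0 → ‖u.2 - gridPt k (finVec m)‖ < 4 / 5 / k) ∧
      ∀ u, ∑ m, ∑ᶠ l : Lat n, (χ m).toFun (u - l.toCov) = 1 := by
  let B : (Fin n → Fin k) → Cutoff n := fun m => leafBump k hk (gridPt k (finVec m))
  let N : Cov n → ℝ := fun u => ∑ m, ∑ᶠ l : Lat n, (B m).toFun (u - l.toCov)
  have hN : ContDiff ℝ ∞ N :=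
    ContDiff.sum fun m _ => contDiff_periodization (B m).smooth (B m).compact
  have hinv : ∀ u (l : Lat n), N (u - l.toCov) = N u := fun u l =>
    Finset.sum_congr rfl fun m _ => periodization_sub u l
  have hpos : ∀ u, 0 < N u := fun u => by
    obtain ⟨m, l, h1, h2⟩ := exists_near_leaf hk u
    have h0 : ∀ m, 0 ≤ ∑ᶠ l : Lat n, (B m).toFun (u - l.toCov) := fun m =>
      finsum_nonneg fun l => leafBump_nonneg _ _ _ _
    refine lt_of_lt_of_le ?_ (Finset.single_le_sum (fun m _ => h0 m) (Finset.mem_univ m))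
    refine lt_of_lt_of_le one_pos ?_
    rw [← leafBump_eq_one k hk _ h1 h2]
    exact single_le_finsum l (finite_support_translates_real (B m).compact u)
      fun l => leafBump_nonneg _ _ _ _
  refine ⟨fun m => ⟨fun u => (B m).toFun u * (N u)⁻¹,
    (B m).smooth.mul (hN.inv fun u => (hpos u).ne'), (B m).compact.mul_right⟩,
    fun m u h => norm_lt_of_leafBump_ne_zero (left_ne_zero_of_mul h), fun u => ?_⟩
  have h1 : ∀ m, ∑ᶠ l : Lat n, (B m).toFun (u - l.toCov) * (N (u - l.toCov))⁻¹ =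
      (∑ᶠ l : Lat n, (B m).toFun (u - l.toCov)) * (N u)⁻¹ := fun m => by
    simp only [hinv]
    exact (finsum_mul _ _).symm
  simp only [h1, ← Finset.sum_mul]
  exact mul_inv_cancel₀ (hpos u).ne'

/-- The pairs of cutoffs that test the pairing of distributional sections exist: take a partition of
unity for `χ₁`, and for `χ₂` a function that is `1` on its support. -/
theorem exists_cutoff_pair (n : ℕ) : ∃ χ₁ χ₂ : Cutoff n,
    ∀ p : Cov n, ∑ᶠ l : Lat n, χ₁.toFun (p - l.toCov) * χ₂.toFun (p - l.toCov) = 1 := by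
  obtain ⟨χ, -, hχ⟩ := exists_leaf_partition n one_pos
  let χ₁ : Cutoff n := ⟨fun u => ∑ m, (χ m).toFun u, ContDiff.sum fun m _ => (χ m).smooth, by
    have : ∀ s : Finset (Fin n → Fin 1), HasCompactSupport fun u => ∑ m ∈ s, (χ m).toFun u := by
      intro s
      classical
      induction s using Finset.induction_on with
      | empty => simp only [Finset.sum_empty]; exact HasCompactSupport.zero
      | insert a s ha ih =>
        simp only [Finset.sum_insert ha]
        exact (χ a).compact.add ih
    exact this _⟩
  obtain ⟨R, hR⟩ := χ₁.compact.isCompact.isBounded.subset_closedBall 0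
  let b : ContDiffBump (0 : Cov n) := ⟨max R 1, max R 1 + 1, by positivity, by linarith⟩
  refine ⟨χ₁, ⟨b, b.contDiff, b.hasCompactSupport⟩, fun p => ?_⟩
  have h1 : ∀ u, χ₁.toFun u * b u = χ₁.toFun u := fun u => by
    by_cases hu : χ₁.toFun u = 0
    · rw [hu, zero_mul]
    · have h2 := hR (subset_tsupport _ hu)
      rw [b.one_of_mem_closedBall (Metric.closedBall_subset_closedBall (le_max_left _ _) h2),
        mul_one]
  simp only [h1]
  rw [← hχ p, ← finsum_sum_comm]
  exact fun m _ => finite_support_translates_real (χ m).compact p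

/-- This needs the existence of a pair of cutoffs: without one, `HasPairing` would be vacuous. -/
theorem HasPairing.unique {k : ℕ} {u v : smoothSection n k → ℂ} {c c' : ℂ}
    (h : HasPairing u v c) (h' : HasPairing u v c') : c = c' := by
  obtain ⟨χ₁, χ₂, hχ⟩ := exists_cutoff_pair n
  exact (h χ₁ χ₂ hχ).2.symm.trans (h' χ₁ χ₂ hχ).2

theorem contDiff_cutoff_mul {k : ℕ} (χ : Cutoff n) (τ : smoothSection n k) :
    ContDiff ℝ ∞ fun u => (χ.toFun u : ℂ) * τ.1 u := χ.contDiff_ofReal.mul τ.2.1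

theorem hasCompactSupport_cutoff_mul {k : ℕ} (χ : Cutoff n) (τ : smoothSection n k) :
    HasCompactSupport fun u => (χ.toFun u : ℂ) * τ.1 u := χ.hasCompactSupport_ofReal.mul_right

theorem sum_pushForward_cutoff {k : ℕ} {I : Type} [Fintype I] {χ : I → Cutoff n}
    (hχ : ∀ u, ∑ m, ∑ᶠ l : Lat n, (χ m).toFun (u - l.toCov) = 1) (τ : smoothSection n k) :
    ∑ m, pushForward k (fun u => ((χ m).toFun u : ℂ) * τ.1 u) (contDiff_cutoff_mul (χ m) τ)
      (hasCompactSupport_cutoff_mul (χ m) τ) = τ := by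
  apply Subtype.ext
  funext u
  have h1 : ∀ m, ∑ᶠ l : Lat n, automorphy k l u * (((χ m).toFun (u - l.toCov) : ℂ) *
      τ.1 (u - l.toCov)) = ((∑ᶠ l : Lat n, (χ m).toFun (u - l.toCov) : ℝ) : ℂ) * τ.1 u :=
    fun m => by
      have h2 : ((∑ᶠ l : Lat n, (χ m).toFun (u - l.toCov) : ℝ) : ℂ) =
          ∑ᶠ l : Lat n, ((χ m).toFun (u - l.toCov) : ℂ) :=
        Complex.ofRealHom.toAddMonoidHom.map_finsum
          (finite_support_translates_real (χ m).compact u)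
      rw [h2, finsum_mul]
      refine finsum_congr fun l => ?_
      rw [← automorphy_mul_sub τ l u]
      ring
  rw [AddSubmonoidClass.coe_finsetSum, Finset.sum_apply]
  change ∑ m, ∑ᶠ l : Lat n, automorphy k l u * (((χ m).toFun (u - l.toCov) : ℂ) *
      τ.1 (u - l.toCov)) = τ.1 u
  simp only [h1, ← Finset.sum_mul, ← Complex.ofReal_sum]
  rw [hχ, Complex.ofReal_one, one_mul]

end Partition

/-! ### Averaging along the polarization -/

section Average

variable {n k : ℕ}

/-- Parallel transport of `τ` by time `t` along `∂/∂x i`,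
`(U_t τ)(u) = e^{-kπi t y_i} τ(u + t ∂/∂x i)`. -/
def transport (k : ℕ) (i : Fin n) (τ : Cov n → ℂ) (p : Cov n × ℝ) : ℂ :=
  Complex.exp (-(k * Real.pi * (p.2 * p.1.2 i) : ℝ) * Complex.I) * τ (p.1 + p.2 • ex i)

theorem contDiff_transport (i : Fin n) {τ : Cov n → ℂ} (hτ : ContDiff ℝ ∞ τ) :
    ContDiff ℝ ∞ (transport k i τ) := by
  unfold transport
  have h : ContDiff ℝ ∞ fun p : Cov n × ℝ => (p.2 * p.1.2 i : ℝ) :=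
    contDiff_snd.mul ((contDiff_apply ℝ ℝ i).comp (contDiff_snd.comp contDiff_fst))
  exact ((((Complex.ofRealCLM.contDiff.comp (contDiff_const.mul h)).neg).mul
    contDiff_const).cexp).mul
      (hτ.comp (contDiff_fst.add (contDiff_snd.smul contDiff_const)))

theorem sympForm_ex (u : Cov n) (i : Fin n) : sympForm u (ex i) = u.2 i := by
  simp [sympForm, ex, Pi.single_apply]

theorem sympForm_ex_left (l : Lat n) (i : Fin n) : sympForm (ex i) l.toCov = -(l.2 i : ℝ) := by
  simp [sympForm, ex, Pi.single_apply, Lat.toCov]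

theorem transport_add_lattice (τ : smoothSection n k) (i : Fin n) (l : Lat n) (u : Cov n) (t : ℝ) :
    transport k i τ.1 (u + l.toCov, t) = automorphy k l u * transport k i τ.1 (u, t) := by
  have h1 : u + l.toCov + t • ex i = u + t • ex i + l.toCov := by abel
  have h2 : Complex.exp (-(k * Real.pi * (t * (u + l.toCov).2 i) : ℝ) * Complex.I) *
      Complex.exp (-(k * Real.pi * sympForm (u + t • ex i) l.toCov : ℝ) * Complex.I) =
      Complex.exp (-(k * Real.pi * sympForm u l.toCov : ℝ) * Complex.I) *
      Complex.exp (-(k * Real.pi * (t * u.2 i) : ℝ) * Complex.I) := by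
    rw [← Complex.exp_add, ← Complex.exp_add, sympForm_add_left, sympForm_smul_left,
      sympForm_ex_left]
    congr 1
    simp only [Lat.toCov, Prod.snd_add, Pi.add_apply]
    push_cast
    ring
  simp only [transport]
  rw [h1, τ.2.2 l, automorphy, automorphy]
  linear_combination ((-1 : ℂ) ^ (∑ i, l.1 i * l.2 i)) ^ k * τ.1 (u + t • ex i) * h2

theorem covDeriv_ex (τ : smoothSection n k) (i : Fin n) (u : Cov n) :
    (covDeriv (ex i) τ).1 u =
      fderiv ℝ τ.1 u (ex i) - (k * Real.pi * u.2 i : ℝ) * Complex.I * τ.1 u := by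
  rw [← sympForm_ex]; rfl

/-- The average `∫₀¹ w(t) U_t τ dt` of the transports of `τ` along `∂/∂x i`. -/
def average (w : ℝ → ℂ) (hw : ContDiff ℝ ∞ w) (i : Fin n) (τ : smoothSection n k) :
    smoothSection n k :=
  ⟨fun u => ∫ t in Set.Icc (0 : ℝ) 1, w t * transport k i τ.1 (u, t),
    contDiff_setIntegral (F := fun p : Cov n × ℝ => w p.2 * transport k i τ.1 p)
      ((hw.comp contDiff_snd).mul (contDiff_transport i τ.2.1)) isCompact_Icc,
    fun l u => by
      rw [← integral_const_mul]
      refine integral_congr_ae (.of_forall fun t => ?_)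
      simp only [transport_add_lattice]
      ring⟩

theorem average_apply (w : ℝ → ℂ) (hw : ContDiff ℝ ∞ w) (i : Fin n) (τ : smoothSection n k)
    (u : Cov n) :
    (average w hw i τ).1 u = ∫ t in Set.Icc (0 : ℝ) 1, w t * transport k i τ.1 (u, t) := rfl

/-- Transport commutes with the covariant derivatives along the polarization. -/
theorem fderiv_transport_fst (τ : smoothSection n k) (i j : Fin n) (u : Cov n) (t : ℝ) :
    fderiv ℝ (transport k i τ.1) (u, t) (ex j, 0) -
      (k * Real.pi * u.2 j : ℝ) * Complex.I * transport k i τ.1 (u, t) =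
      transport k i (covDeriv (ex j) τ).1 (u, t) := by
  let L : Cov n →L[ℝ] ℝ := (ContinuousLinearMap.proj i).comp (ContinuousLinearMap.snd ℝ _ _)
  have hL : L (ex j) = 0 := by simp [L, ex]
  have h1 : HasFDerivAt (fun v : Cov n => ((v.2 i : ℝ) : ℂ)) (Complex.ofRealCLM.comp L) u :=
    (Complex.ofRealCLM.comp L).hasFDerivAt
  have h2 := (h1.const_mul (-(k * Real.pi * t : ℝ) * Complex.I : ℂ)).cexp
  have h3 : HasFDerivAt (fun v : Cov n => τ.1 (v + t • ex i)) (fderiv ℝ τ.1 (u + t • ex i)) u :=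
    (hasFDerivAt_comp_add_right (t • ex i)).2
      (τ.2.1.differentiable (by simp) _).hasFDerivAt
  have h4 := h2.mul h3
  have h5 : HasFDerivAt (fun v => transport k i τ.1 (v, t))
      ((fderiv ℝ (transport k i τ.1) (u, t)).comp (ContinuousLinearMap.inl ℝ _ _)) u :=
    HasFDerivAt.comp u (f := fun v : Cov n => (v, t))
      ((contDiff_transport i τ.2.1).differentiable (by simp) (u, t)).hasFDerivAt
      ((hasFDerivAt_id u).prodMk (hasFDerivAt_const t u))
  have e : (fun v => transport k i τ.1 (v, t)) =
      (fun v : Cov n => Complex.exp (-(k * Real.pi * t : ℝ) * Complex.I * ((v.2 i : ℝ) : ℂ))) *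
        fun v => τ.1 (v + t • ex i) := by
    funext v
    simp only [transport, Pi.mul_apply]
    congr 2
    push_cast
    ring
  rw [e] at h5
  have h6 := congrArg (fun M : Cov n →L[ℝ] ℂ => M (ex j)) (h5.unique h4)
  simp only [ContinuousLinearMap.comp_apply, ContinuousLinearMap.inl_apply, add_apply, smul_apply,
    hL, Complex.ofRealCLM_apply, Complex.ofReal_zero, smul_eq_mul, mul_zero,
    add_zero] at h6
  rw [h6]
  have h7 : (u + t • ex i).2 j = u.2 j := by simp [ex]
  simp only [transport, covDeriv_ex, h7]
  have h8 : (-(k * Real.pi * t : ℝ) * Complex.I * ((u.2 i : ℝ) : ℂ) : ℂ) =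
      -(k * Real.pi * (t * u.2 i) : ℝ) * Complex.I := by push_cast; ring
  rw [h8]
  ring

/-- `d/dt U_t τ = U_t ∇_i τ`. -/
theorem hasDerivAt_transport (τ : smoothSection n k) (i : Fin n) (u : Cov n) (t : ℝ) :
    HasDerivAt (fun t => transport k i τ.1 (u, t))
      (transport k i (covDeriv (ex i) τ).1 (u, t)) t := by
  have h1 : HasDerivAt (fun s : ℝ => ((s : ℝ) : ℂ)) 1 t := Complex.ofRealCLM.hasDerivAt
  have h2 := (h1.const_mul (-(k * Real.pi * u.2 i : ℝ) * Complex.I : ℂ)).cexp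
  have h3 : HasDerivAt (fun s : ℝ => τ.1 (u + s • ex i)) (fderiv ℝ τ.1 (u + t • ex i) (ex i)) t := by
    have h4 : HasDerivAt (fun s : ℝ => u + s • ex i) (ex i) t := by
      simpa using ((hasDerivAt_id t).smul_const (ex i : Cov n)).const_add u
    exact (τ.2.1.differentiable (by simp) _).hasFDerivAt.comp_hasDerivAt t h4
  have h5 := h2.mul h3
  have e : (fun t => transport k i τ.1 (u, t)) =
      (fun s : ℝ => Complex.exp (-(k * Real.pi * u.2 i : ℝ) * Complex.I * ((s : ℝ) : ℂ))) *
        fun s => τ.1 (u + s • ex i) := by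
    funext v
    simp only [transport, Pi.mul_apply]
    congr 2
    push_cast
    ring
  rw [e]
  refine h5.congr_deriv ?_
  have h7 : (u + t • ex i).2 i = u.2 i := by simp [ex]
  have h8 : (-(k * Real.pi * u.2 i : ℝ) * Complex.I * ((t : ℝ) : ℂ) : ℂ) =
      -(k * Real.pi * (t * u.2 i) : ℝ) * Complex.I := by push_cast; ring
  simp only [transport, covDeriv_ex, h7, h8]
  ring

theorem covDeriv_average (w : ℝ → ℂ) (hw : ContDiff ℝ ∞ w) (i j : Fin n) (τ : smoothSection n k) :
    covDeriv (ex j) (average w hw i τ) = average w hw i (covDeriv (ex j) τ) := by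
  apply Subtype.ext
  funext u
  have hF : ContDiff ℝ ∞ fun p : Cov n × ℝ => w p.2 * transport k i τ.1 p :=
    (hw.comp contDiff_snd).mul (contDiff_transport i τ.2.1)
  have h1 : fderiv ℝ (average w hw i τ).1 u (ex j) =
      ∫ t in Set.Icc (0 : ℝ) 1, w t * fderiv ℝ (transport k i τ.1) (u, t) (ex j, 0) := by
    change fderiv ℝ (fun u => ∫ t in Set.Icc (0 : ℝ) 1, w t * transport k i τ.1 (u, t)) u (ex j) = _
    rw [fderiv_setIntegral (F := fun p : Cov n × ℝ => w p.2 * transport k i τ.1 p)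
      (hF.of_le (by exact_mod_cast le_top)) isCompact_Icc]
    refine integral_congr_ae (.of_forall fun t => ?_)
    have h2 := ((((hw.differentiable (by simp) t).hasFDerivAt.comp (u, t)
      (hasFDerivAt_snd (E := Cov n)))).mul
      ((contDiff_transport (k := k) i τ.2.1).differentiable (by simp) (u, t)).hasFDerivAt).fderiv
    have h3 : (fun p : Cov n × ℝ => w p.2 * transport k i τ.1 p) =
      (w ∘ Prod.snd) * transport k i τ.1 := rfl
    simp only [h3]
    rw [h2]
    simp
  rw [covDeriv_ex, h1, average_apply, average_apply, ← integral_const_mul, ← integral_sub]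
  · refine integral_congr_ae (.of_forall fun t => ?_)
    simp only [← fderiv_transport_fst]
    ring
  · refine Continuous.integrableOn_Icc ?_
    exact hw.continuous.mul ((((contDiff_transport (k := k) i τ.2.1).continuous_fderiv
      (by simp)).comp (by fun_prop)).clm_apply continuous_const)
  · refine Continuous.integrableOn_Icc ?_
    exact continuous_const.mul (hw.continuous.mul
      ((contDiff_transport (k := k) i τ.2.1).continuous.comp (by fun_prop)))

theorem setIntegral_Icc_deriv {g g' : ℝ → ℂ} (h : ∀ t, HasDerivAt g (g' t) t)
    (hc : Continuous g') : ∫ t in Set.Icc (0 : ℝ) 1, g' t = g 1 - g 0 := by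
  rw [integral_Icc_eq_integral_Ioc, ← intervalIntegral.integral_of_le zero_le_one]
  exact intervalIntegral.integral_eq_sub_of_hasDerivAt (fun t _ => h t)
    (hc.intervalIntegrable _ _)

/-- The plain average `A_i τ = ∫₀¹ U_t τ dt`. -/
def avg (i : Fin n) (τ : smoothSection n k) : smoothSection n k :=
  average (fun _ => 1) contDiff_const i τ

theorem phase_comp_snd_mem (q : Fin n → ℤ) :
    (fun u : Cov n => phase q u.2) ∈ smoothFun n :=
  ⟨(contDiff_phase q).comp contDiff_snd, fun l u => isPeriodic_phase q l.2 u.2⟩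

/-- The holonomy `e^{-2πi k y_i}` of `L^{⊗k}` along the circles in the direction `∂/∂x i`. -/
def holonomy (n k : ℕ) (i : Fin n) : smoothFun n :=
  ⟨fun u => phase (-((k : ℤ) • (Pi.single i 1 : Fin n → ℤ))) u.2, phase_comp_snd_mem _⟩

theorem holonomy_apply (i : Fin n) (u : Cov n) :
    (holonomy n k i).1 u = Complex.exp (-(2 * Real.pi * k * u.2 i : ℝ) * Complex.I) := by
  change phase (-((k : ℤ) • Pi.single i 1)) u.2 = _
  rw [phase_neg]
  congr 3
  simp [Pi.single_apply]
  ring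

theorem transport_zero (i : Fin n) (τ : smoothSection n k) (u : Cov n) :
    transport k i τ.1 (u, 0) = τ.1 u := by simp [transport]

/-- Transport once around the circle is multiplication by the holonomy. -/
theorem transport_one (i : Fin n) (τ : smoothSection n k) (u : Cov n) :
    transport k i τ.1 (u, 1) = (holonomy n k i).1 u * τ.1 u := by
  have h1 : u + (1 : ℝ) • ex i = u + Lat.toCov (Pi.single i 1, 0) := by
    rw [one_smul]
    congr 1
    ext j
    · simp [ex, Lat.toCov, Pi.single_apply]
    · simp [ex, Lat.toCov]
  have h2 : (Lat.toCov (Pi.single i 1, 0) : Cov n) = ex i := by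
    ext j
    · simp [ex, Lat.toCov, Pi.single_apply]
    · simp [ex, Lat.toCov]
  simp only [transport]
  rw [h1, τ.2.2, automorphy, h2, sympForm_ex, holonomy_apply, ← mul_assoc]
  congr 1
  simp only [Pi.zero_apply, mul_zero, Finset.sum_const_zero, zpow_zero, one_pow, one_mul]
  rw [← Complex.exp_add]
  congr 1
  push_cast
  ring

theorem continuous_transport (i : Fin n) (τ : smoothSection n k) (u : Cov n) :
    Continuous fun t => transport k i τ.1 (u, t) :=
  (contDiff_transport (k := k) i τ.2.1).continuous.comp (by fun_prop)

/-- `(e^{-2πi k y_i} - 1) τ` is a covariant derivative along `∂/∂x i`. -/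
theorem covDeriv_avg_self (i : Fin n) (τ : smoothSection n k) :
    covDeriv (ex i) (avg i τ) = mulSection (holonomy n k i - 1) τ := by
  rw [avg, covDeriv_average]
  apply Subtype.ext
  funext u
  rw [average_apply]
  simp only [one_mul]
  rw [setIntegral_Icc_deriv (fun t => hasDerivAt_transport τ i u t)
    (continuous_transport i _ u), transport_zero, transport_one]
  change _ = ((holonomy n k i).1 u - 1) * τ.1 u
  ring

/-- `A_i τ - τ` is a covariant derivative along `∂/∂x i`. -/
theorem exists_covDeriv_eq_avg_sub (i : Fin n) (τ : smoothSection n k) :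
    ∃ σ, covDeriv (ex i) σ = avg i τ - τ := by
  have hw : ContDiff ℝ ∞ fun t : ℝ => (1 - t : ℂ) :=
    contDiff_const.sub Complex.ofRealCLM.contDiff
  -- integration by parts: `∫₀¹ (1 - t) (d/dt) U_t τ dt = ∫₀¹ U_t τ dt - τ`
  refine ⟨average (fun t => 1 - t) hw i τ, ?_⟩
  rw [covDeriv_average]
  apply Subtype.ext
  funext u
  change ∫ t in Set.Icc (0 : ℝ) 1, (1 - t : ℂ) * transport k i (covDeriv (ex i) τ).1 (u, t) =
    (∫ t in Set.Icc (0 : ℝ) 1, 1 * transport k i τ.1 (u, t)) - τ.1 u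
  have h1 : ∀ t : ℝ, HasDerivAt (fun t : ℝ => (1 - t : ℂ) * transport k i τ.1 (u, t))
      ((1 - t : ℂ) * transport k i (covDeriv (ex i) τ).1 (u, t) - 1 * transport k i τ.1 (u, t)) t :=
    fun t => by
      have h2 : HasDerivAt (fun s : ℝ => (1 - s : ℂ)) (-1) t := by
        simpa using (Complex.ofRealCLM.hasDerivAt (x := t)).const_sub 1
      refine (h2.mul (hasDerivAt_transport τ i u t)).congr_deriv ?_
      ring
  have hc1 : Continuous fun t : ℝ =>
      (1 - t : ℂ) * transport k i (covDeriv (ex i) τ).1 (u, t) :=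
    hw.continuous.mul (continuous_transport i _ u)
  have hc2 : Continuous fun t : ℝ => 1 * transport k i τ.1 (u, t) :=
    continuous_const.mul (continuous_transport i τ u)
  have h3 := setIntegral_Icc_deriv h1 (hc1.sub hc2)
  rw [integral_sub hc1.integrableOn_Icc hc2.integrableOn_Icc] at h3
  simp only [Complex.ofReal_one, sub_self, zero_mul, Complex.ofReal_zero, sub_zero, one_mul,
    transport_zero, zero_sub] at h3 ⊢
  linear_combination h3

end Average

/-! ### Integration over the Bohr–Sommerfeld leaves -/

section Leaves

variable {n k : ℕ}

theorem isPeriodic_leafXFun (hk : 0 < k) (m : Fin n → ℤ) (τ : smoothSection n k) :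
    IsPeriodic (leafXFun k m τ.1) := fun p x => by
  have h1 : ((x + intVec p, gridPt k m) : Cov n) = (x, gridPt k m) + Lat.toCov (p, 0) := by
    ext i <;> simp [Lat.toCov, intVec]
  have h2 := halfPhase_mul_automorphy_fst hk m (p, 0) x
  simp only [smul_zero, sub_zero] at h2
  have h3 := halfPhase_neg_mul (-m) (intVec p)
  have h4 : x - intVec p = x + -intVec p := sub_eq_add_neg _ _
  rw [neg_neg] at h3
  rw [h4, halfPhase_add_right, halfPhase_neg_right, neg_neg] at h2
  rw [leafXFun, leafXFun, h1, τ.2.2, halfPhase_add_right]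
  linear_combination halfPhase (-m) (intVec p) * τ.1 (x, gridPt k m) * h2 +
    halfPhase (-m) x * τ.1 (x, gridPt k m) * h3

/-- In the trivialization over a Bohr–Sommerfeld leaf the connection is the ordinary derivative. -/
theorem fderiv_leafXFun (hk : 0 < k) (m : Fin n → ℤ) (τ : smoothSection n k) (i : Fin n)
    (x : Fin n → ℝ) :
    fderiv ℝ (leafXFun k m τ.1) x (Pi.single i 1) = leafXFun k m (covDeriv (ex i) τ).1 x := by
  have hk' : (k : ℝ) ≠ 0 := by exact_mod_cast hk.ne'
  have h1 : HasFDerivAt (fun x : Fin n → ℝ => τ.1 (x, gridPt k m))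
      ((fderiv ℝ τ.1 (x, gridPt k m)).comp (ContinuousLinearMap.inl ℝ _ _)) x :=
    HasFDerivAt.comp x (f := fun x : Fin n → ℝ => (x, gridPt k m))
      (τ.2.1.differentiable (by simp) (x, gridPt k m)).hasFDerivAt
      ((hasFDerivAt_id x).prodMk (hasFDerivAt_const _ x))
  have h2 := (((contDiff_halfPhase (-m)).differentiable (by simp) x).hasFDerivAt.mul h1).fderiv
  have h3 : leafXFun k m τ.1 = halfPhase (-m) * fun x => τ.1 (x, gridPt k m) := rfl
  have h4 : (k * Real.pi * gridPt k m i : ℝ) = Real.pi * m i := by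
    simp only [gridPt]
    field_simp
  rw [h3, h2, leafXFun, covDeriv_ex]
  simp only [add_apply, smul_apply, ContinuousLinearMap.comp_apply, ContinuousLinearMap.inl_apply,
    fderiv_halfPhase, smul_eq_mul, Pi.neg_apply, Int.cast_neg, Pi.single_apply, mul_ite, mul_one,
    mul_zero, Finset.sum_ite_eq', Finset.mem_univ, if_true, h4]
  change _ * fderiv ℝ τ.1 (x, gridPt k m) (ex i) + _ = _
  push_cast
  ring

theorem leafX_covDeriv (hk : 0 < k) (m : Fin n → ℤ) (τ : smoothSection n k) (i : Fin n) :
    leafX k m (covDeriv (ex i) τ).1 = 0 := by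
  rw [leafX]
  simp only [← fderiv_leafXFun hk]
  exact setIntegral_Icc_fderiv (isPeriodic_leafXFun hk m τ)
    ((contDiff_leafXFun k m τ.2.1).of_le (by exact_mod_cast le_top)) _

theorem integrableOn_leafXFun (m : Fin n → ℤ) (τ : smoothSection n k) :
    IntegrableOn (leafXFun k m τ.1) (Set.Icc 0 1) :=
  (contDiff_leafXFun k m τ.2.1).continuous.continuousOn.integrableOn_compact isCompact_Icc

theorem leafX_add (m : Fin n → ℤ) (τ σ : smoothSection n k) :
    leafX k m (τ + σ).1 = leafX k m τ.1 + leafX k m σ.1 := by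
  rw [leafX, leafX, leafX, ← integral_add (integrableOn_leafXFun m τ) (integrableOn_leafXFun m σ)]
  refine integral_congr_ae (.of_forall fun x => ?_)
  simp [leafXFun, mul_add]

theorem leafX_smul (m : Fin n → ℤ) (c : ℂ) (τ : smoothSection n k) :
    leafX k m (c • τ).1 = c * leafX k m τ.1 := by
  rw [leafX, leafX, ← integral_const_mul]
  refine integral_congr_ae (.of_forall fun x => ?_)
  simp [leafXFun]
  ring

theorem gridPt_finVec_mem (m : Fin n → Fin k) : gridPt k (finVec m) ∈ Set.Icc (0 : Fin n → ℝ) 1 := by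
  refine ⟨fun i => ?_, fun i => ?_⟩
  · simp only [gridPt, finVec, Pi.zero_apply]
    positivity
  · simp only [gridPt, finVec, Pi.one_apply]
    have h1 : ((m i : ℕ) : ℝ) ≤ k := by exact_mod_cast (m i).2.le
    exact div_le_one_of_le₀ (by exact_mod_cast h1) (Nat.cast_nonneg _)

theorem volume_real_Icc : volume.real (Set.Icc (0 : Fin n → ℝ) 1) = 1 := by
  simp [measureReal_def, Real.volume_Icc_pi]

theorem norm_leafX_le (m : Fin n → Fin k) (τ : smoothSection n k) {B : ℝ}
    (hB : ∀ u ∈ unitCube n, ‖τ.1 u‖ ≤ B) : ‖leafX k (finVec m) τ.1‖ ≤ B := by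
  have h := norm_setIntegral_le_of_norm_le_const (μ := volume) (s := Set.Icc (0 : Fin n → ℝ) 1)
    (f := leafXFun k (finVec m) τ.1) (C := B) isCompact_Icc.measure_lt_top fun x hx => by
      rw [leafXFun, norm_mul, norm_halfPhase, one_mul]
      exact hB _ ⟨⟨hx.1, (gridPt_finVec_mem m).1⟩, ⟨hx.2, (gridPt_finVec_mem m).2⟩⟩
  rwa [volume_real_Icc, mul_one] at h

/-- Integration over the Bohr–Sommerfeld leaf `y = m / k`, as an element of the quantum space. -/
def leafState (hk : 0 < k) (m : Fin n → Fin k) : quantumSpace n k :=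
  ⟨⟨{ toFun := fun τ => (starRingEnd ℂ) (leafX k (finVec m) τ.1)
      map_add' := fun τ σ => by rw [leafX_add, map_add]
      map_smul' := fun c τ => by rw [leafX_smul, map_mul, smul_eq_mul] },
    ⟨0, 1, fun τ B hB => by
      change ‖(starRingEnd ℂ) (leafX k (finVec m) τ.1)‖ ≤ 1 * B
      rw [one_mul, RCLike.norm_conj]
      exact norm_leafX_le m τ fun u hu => by simpa using hB 0 le_rfl u hu⟩⟩,
    fun i τ => by
      change (starRingEnd ℂ) (leafX k (finVec m) (covDeriv (ex i) τ).1) = 0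
      rw [leafX_covDeriv hk, map_zero]⟩

theorem leafState_apply (hk : 0 < k) (m : Fin n → Fin k) (τ : smoothSection n k) :
    (leafState hk m).1.1 τ = (starRingEnd ℂ) (leafX k (finVec m) τ.1) := rfl

theorem quantumSpace_apply_avg (s : quantumSpace n k) (i : Fin n) (τ : smoothSection n k) :
    s.1.1 (avg i τ) = s.1.1 τ := by
  obtain ⟨σ, hσ⟩ := exists_covDeriv_eq_avg_sub i τ
  have h := s.2 i σ
  rw [hσ, map_sub] at h
  exact sub_eq_zero.mp h

/-- Elements of the quantum space are annihilated by `e^{-2πi k y_i} - 1`, whose zeros are the leaves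
with trivial holonomy. -/
theorem quantumSpace_apply_holonomy (s : quantumSpace n k) (i : Fin n) (τ : smoothSection n k) :
    s.1.1 (mulSection (holonomy n k i - 1) τ) = 0 := by
  rw [← covDeriv_avg_self]
  exact s.2 i _

/-- The section `τ` averaged along the directions in `L`. -/
def avgList (L : List (Fin n)) (τ : smoothSection n k) : smoothSection n k := L.foldr avg τ

theorem quantumSpace_apply_avgList (s : quantumSpace n k) (L : List (Fin n))
    (τ : smoothSection n k) : s.1.1 (avgList L τ) = s.1.1 τ := by
  induction L with
  | nil => rfl
  | cons i L ih => exact (quantumSpace_apply_avg s i _).trans ih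

/-- Near a leaf the holonomy is a function of the distance `z` to the leaf, and it is `1` on the leaf. -/
theorem holonomy_gridPt (hk : 0 < k) (i : Fin n) (m : Fin n → ℤ) {x y z : Fin n → ℝ}
    (hy : y = gridPt k m + z) :
    (holonomy n k i).1 (x, y) = Complex.exp (-(2 * Real.pi * k * z i : ℝ) * Complex.I) := by
  have hk' : (k : ℝ) ≠ 0 := by exact_mod_cast hk.ne'
  rw [holonomy_apply, Complex.exp_eq_exp_iff_exists_int]
  refine ⟨-m i, ?_⟩
  have h1 : (2 * Real.pi * k * y i : ℝ) = 2 * Real.pi * m i + 2 * Real.pi * k * z i := by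
    rw [hy, Pi.add_apply, gridPt]
    field_simp
  simp only [h1]
  push_cast
  ring

theorem avg_eq_zero_on_leaf {τ : smoothSection n k} {m : Fin n → ℤ}
    (h : ∀ x, τ.1 (x, gridPt k m) = 0) (i : Fin n) (x : Fin n → ℝ) :
    (avg i τ).1 (x, gridPt k m) = 0 := by
  rw [avg, average_apply]
  refine integral_eq_zero_of_ae (.of_forall fun t => ?_)
  have h1 : ((x, gridPt k m) : Cov n) + t • ex i = (x + t • Pi.single i 1, gridPt k m) := by
    ext j <;> simp [ex]
  simp only [transport, h1, h, mul_zero, Pi.zero_apply]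

theorem covDeriv_avgList_eq_zero_on_leaf (hk : 0 < k) (τ : smoothSection n k) (m : Fin n → ℤ)
    (L : List (Fin n)) (i : Fin n) (hi : i ∈ L) (x : Fin n → ℝ) :
    (covDeriv (ex i) (avgList L τ)).1 (x, gridPt k m) = 0 := by
  induction L generalizing x with
  | nil => simp at hi
  | cons j L ih =>
    change (covDeriv (ex i) (avg j (avgList L τ))).1 (x, gridPt k m) = 0
    rcases eq_or_ne i j with rfl | hij
    · rw [covDeriv_avg_self]
      change ((holonomy n k i).1 (x, gridPt k m) - 1) * _ = 0
      rw [holonomy_gridPt hk i m (z := 0) (by simp)]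
      simp
    · rw [avg, covDeriv_average]
      exact avg_eq_zero_on_leaf (fun x => ih ((List.mem_cons.mp hi).resolve_left hij) x) j x

/-- Averaged in all directions, a section is covariantly constant along the leaves. -/
theorem leafXFun_avgList (hk : 0 < k) (τ : smoothSection n k) (m : Fin n → ℤ) (x : Fin n → ℝ) :
    leafXFun k m (avgList (List.finRange n) τ).1 x =
      leafX k m (avgList (List.finRange n) τ).1 := by
  set σ := avgList (List.finRange n) τ
  have h1 : ∀ x, fderiv ℝ (leafXFun k m σ.1) x = 0 := fun x => by
    refine ContinuousLinearMap.coe_injective (LinearMap.pi_ext' fun i => ?_)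
    refine LinearMap.ext_ring ?_
    change fderiv ℝ (leafXFun k m σ.1) x (Pi.single i 1) = 0
    rw [fderiv_leafXFun hk, leafXFun,
      covDeriv_avgList_eq_zero_on_leaf hk τ m _ i (List.mem_finRange i), mul_zero]
  have h2 : ∀ y, leafXFun k m σ.1 y = leafXFun k m σ.1 x := fun y =>
    is_const_of_fderiv_eq_zero ((contDiff_leafXFun k m σ.2.1).differentiable (by simp)) h1 y x
  rw [leafX]
  simp only [h2]
  rw [setIntegral_const, volume_real_Icc, one_smul]

theorem avgList_eq_zero_on_leaf (hk : 0 < k) {τ : smoothSection n k} {m : Fin n → Fin k}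
    (h : leafX k (finVec m) τ.1 = 0) (x : Fin n → ℝ) :
    (avgList (List.finRange n) τ).1 (x, gridPt k (finVec m)) = 0 := by
  have h1 := quantumSpace_apply_avgList (leafState hk m) (List.finRange n) τ
  rw [leafState_apply, leafState_apply, h, map_zero, map_eq_zero,
    ← leafXFun_avgList hk τ (finVec m) x, leafXFun] at h1
  refine (mul_eq_zero.mp h1).resolve_left fun h2 => ?_
  have h3 := norm_halfPhase (-finVec m) x
  rw [h2, norm_zero] at h3
  exact zero_ne_one h3

end Leaves

/-! ### Division by the holonomy -/

section Division

variable {n k : ℕ}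

/-- Hadamard's lemma: a smooth function vanishing on the leaf `y = g` is a combination of the
functions `y_i - g_i`. -/
theorem exists_eq_sum_of_eq_zero {ψ : Cov n → ℂ} (hψ : ContDiff ℝ ∞ ψ) {g : Fin n → ℝ}
    (h : ∀ x, ψ (x, g) = 0) : ∃ G : Fin n → Cov n → ℂ, (∀ i, ContDiff ℝ ∞ (G i)) ∧
      ∀ u, ψ u = ∑ i, ((u.2 i - g i : ℝ) : ℂ) * G i u := by
  let γ : Cov n × ℝ → Cov n := fun p => (p.1.1, g + p.2 • (p.1.2 - g))
  have hγ : ContDiff ℝ ∞ γ := by fun_prop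
  have hF : ∀ v : Cov n, ContDiff ℝ ∞ fun p : Cov n × ℝ => fderiv ℝ ψ (γ p) v := fun v =>
    ((hψ.fderiv_right (m := ∞) (by simp)).comp hγ).clm_apply contDiff_const
  refine ⟨fun i u => ∫ t in Set.Icc (0 : ℝ) 1, fderiv ℝ ψ (γ (u, t)) (ey i),
    fun i => contDiff_setIntegral (F := fun p : Cov n × ℝ => fderiv ℝ ψ (γ p) (ey i)) (hF _)
      isCompact_Icc, fun u => ?_⟩
  have hcont : ∀ v : Cov n, Continuous fun t : ℝ => fderiv ℝ ψ (γ (u, t)) v := fun v =>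
    (hF v).continuous.comp (by fun_prop)
  have h1 : ∀ t, HasDerivAt (fun t => ψ (γ (u, t))) (fderiv ℝ ψ (γ (u, t)) (0, u.2 - g)) t :=
    fun t => by
      have h2 : HasDerivAt (fun t : ℝ => γ (u, t)) (0, u.2 - g) t := by
        refine (hasDerivAt_const t u.1).prodMk ?_
        simpa using ((hasDerivAt_id t).smul_const (u.2 - g)).const_add g
      exact (hψ.differentiable (by simp) _).hasFDerivAt.comp_hasDerivAt t h2
  have h3 := setIntegral_Icc_deriv h1 (hcont _)
  have h4 : γ (u, 1) = u := by simp [γ]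
  have h5 : γ (u, 0) = (u.1, g) := by simp [γ]
  rw [h4, h5, h, sub_zero] at h3
  rw [← h3]
  have h6 : ((0, u.2 - g) : Cov n) = ∑ i, (u.2 i - g i) • ey i := by
    ext j
    · simp [ey, Prod.fst_sum]
    · simp [ey, Prod.snd_sum, Finset.sum_apply, Pi.single_apply]
  simp only [← integral_const_mul]
  rw [← integral_finsetSum (f := fun i t => ((u.2 i - g i : ℝ) : ℂ) * fderiv ℝ ψ (γ (u, t)) (ey i)) _
    fun i _ => (continuous_const.mul (hcont (ey i))).integrableOn_Icc]
  refine integral_congr_ae (.of_forall fun t => ?_)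
  simp only [h6, map_sum, map_smul, Complex.real_smul]

/-- Near `0`, the function `t` is a smooth multiple of `e^{-2πikt} - 1`. -/
theorem exists_eq_exp_sub_one_mul (hk : 0 < k) : ∃ l : ℝ → ℂ, ContDiff ℝ ∞ l ∧
    ∀ t : ℝ, |t| ≤ 9 / 10 / k →
      (t : ℂ) = (Complex.exp (-(2 * Real.pi * k * t : ℝ) * Complex.I) - 1) * l t := by
  have hk' : (0 : ℝ) < k := by exact_mod_cast hk
  let c : ℂ := -(2 * Real.pi * k : ℝ) * Complex.I
  have hc : c ≠ 0 := by
    have : (2 * Real.pi * k : ℝ) ≠ 0 := by positivity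
    exact mul_ne_zero (neg_ne_zero.mpr (by exact_mod_cast this)) Complex.I_ne_zero
  -- `θ t = (e^{ct} - 1) / t`, extended smoothly to `t = 0`; it vanishes at non-zero multiples of `1 / k`
  let θ : ℝ → ℂ := fun t => ∫ s in Set.Icc (0 : ℝ) 1, c * Complex.exp (c * t * s)
  have hθ : ContDiff ℝ ∞ θ := by
    refine contDiff_setIntegral (F := fun p : ℝ × ℝ => c * Complex.exp (c * p.1 * p.2)) ?_
      isCompact_Icc
    exact contDiff_const.mul ((contDiff_const.mul (Complex.ofRealCLM.contDiff.comp
      contDiff_fst)).mul (Complex.ofRealCLM.contDiff.comp contDiff_snd)).cexp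
  have hmul : ∀ t : ℝ, t * θ t = Complex.exp (c * t) - 1 := fun t => by
    have h1 : ∀ s : ℝ, HasDerivAt (fun s : ℝ => Complex.exp (c * t * s))
        (t * (c * Complex.exp (c * t * s))) s := fun s => by
      have h2 : HasDerivAt (fun s : ℝ => ((s : ℝ) : ℂ)) 1 s := Complex.ofRealCLM.hasDerivAt
      refine ((h2.const_mul (c * t)).cexp).congr_deriv ?_
      ring
    have h3 := setIntegral_Icc_deriv h1 (by fun_prop)
    rw [integral_const_mul] at h3
    simpa using h3
  have hexp : ∀ t : ℝ, Complex.exp (-(2 * Real.pi * k * t : ℝ) * Complex.I) =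
      Complex.exp (c * t) := fun t => by
    congr 1
    simp only [c]
    push_cast
    ring
  have hne : ∀ t : ℝ, |t| < 1 / k → θ t ≠ 0 := fun t ht h0 => by
    have h1 := hmul t
    rw [h0, mul_zero] at h1
    obtain ⟨z, hz⟩ := Complex.exp_eq_one_iff.mp (sub_eq_zero.mp h1.symm)
    have h2 : -(k * t : ℝ) = (z : ℝ) := by
      have h3 : (2 * Real.pi * Complex.I) * ((-(k * t : ℝ) : ℝ) : ℂ) =
          (2 * Real.pi * Complex.I) * ((z : ℝ) : ℂ) := by
        simp only [c] at hz
        push_cast at hz ⊢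
        linear_combination hz
      exact_mod_cast mul_left_cancel₀ Complex.two_pi_I_ne_zero h3
    have h4 : |(z : ℝ)| < 1 := by
      rw [← h2, abs_neg, abs_mul, abs_of_pos hk']
      rw [lt_div_iff₀ hk'] at ht
      linarith
    have h5 : z = 0 := by
      have : |z| < 1 := by exact_mod_cast h4
      exact Int.abs_lt_one_iff.mp this
    have h6 : t = 0 := by
      rw [h5, Int.cast_zero, neg_eq_zero] at h2
      exact (mul_eq_zero.mp h2).resolve_left hk'.ne'
    rw [h6] at h0
    apply hc
    simpa [θ] using h0
  let b : ContDiffBump (0 : ℝ) := ⟨9 / 10 / k, 19 / 20 / k, by positivity,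
    div_lt_div_of_pos_right (by norm_num) hk'⟩
  refine ⟨fun t => (b t : ℂ) * (θ t)⁻¹, contDiff_iff_contDiffAt.mpr fun t => ?_, fun t ht => ?_⟩
  · by_cases ht : |t| < 1 / k
    · exact (Complex.ofRealCLM.contDiff.comp b.contDiff).contDiffAt.mul (hθ.contDiffAt.inv (hne t ht))
    · have h1 : {s : ℝ | 19 / 20 / k < |s|} ∈ nhds t :=
        (isOpen_lt continuous_const continuous_abs).mem_nhds
          (lt_of_lt_of_le (div_lt_div_of_pos_right (by norm_num) hk' : 19 / 20 / (k : ℝ) < 1 / k) (not_lt.mp ht))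
      refine (contDiffAt_const (c := (0 : ℂ))).congr_of_eventuallyEq ?_
      filter_upwards [h1] with s hs
      rw [b.zero_of_le_dist (by simpa using hs.le), Complex.ofReal_zero, zero_mul]
  · have h1 : |t| < 1 / k := lt_of_le_of_lt ht (div_lt_div_of_pos_right (by norm_num) hk')
    have h2 : b t = 1 := b.one_of_mem_closedBall (by simpa using ht)
    simp only [h2, hexp, ← hmul, Complex.ofReal_one]
    field_simp [hne t h1]

theorem pushForward_sum {I : Type} [Fintype I] {φ : I → Cov n → ℂ} (hs : ∀ i, ContDiff ℝ ∞ (φ i))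
    (hc : ∀ i, HasCompactSupport (φ i)) {ψ : Cov n → ℂ} (hψ : ContDiff ℝ ∞ ψ)
    (hψc : HasCompactSupport ψ) (h : ∀ u, ψ u = ∑ i, φ i u) :
    pushForward k ψ hψ hψc = ∑ i, pushForward k (φ i) (hs i) (hc i) := by
  apply Subtype.ext
  funext u
  rw [AddSubmonoidClass.coe_finsetSum, Finset.sum_apply]
  change ∑ᶠ l : Lat n, automorphy k l u * ψ (u - l.toCov) =
    ∑ i, ∑ᶠ l : Lat n, automorphy k l u * φ i (u - l.toCov)
  rw [← finsum_sum_comm]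
  · simp only [h, Finset.mul_sum]
  · exact fun i _ => (finite_support_translates (hc i) u).subset fun l hl => right_ne_zero_of_mul hl

/-- Elements of the quantum space annihilate the sections that are supported near a leaf with trivial
holonomy and vanish on it. -/
theorem quantumSpace_apply_pushForward (hk : 0 < k) (s : quantumSpace n k) (m : Fin n → ℤ)
    {ψ : Cov n → ℂ} (hψ : ContDiff ℝ ∞ ψ) (hc : HasCompactSupport ψ)
    (hleaf : ∀ x, ψ (x, gridPt k m) = 0)
    (hsupp : ∀ u, ψ u ≠ 0 → ‖u.2 - gridPt k m‖ < 4 / 5 / k) :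
    s.1.1 (pushForward k ψ hψ hc) = 0 := by
  have hk' : (0 : ℝ) < k := by exact_mod_cast hk
  obtain ⟨G, hG, hGsum⟩ := exists_eq_sum_of_eq_zero hψ hleaf
  obtain ⟨l, hl, hlmul⟩ := exists_eq_exp_sub_one_mul hk
  obtain ⟨R, hR⟩ := hc.isCompact.isBounded.subset_closedBall 0
  -- a cutoff that is `1` on the support of `ψ` and lives where `l` inverts the holonomy
  let b₁ : ContDiffBump (0 : Fin n → ℝ) := ⟨max R 1, max R 1 + 1, by positivity, by linarith⟩
  let b₂ : ContDiffBump (gridPt k m) := ⟨4 / 5 / k, 9 / 10 / k, by positivity,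
    div_lt_div_of_pos_right (by norm_num) hk'⟩
  let ρ : Cov n → ℂ := fun u => ((b₁ u.1 * b₂ u.2 : ℝ) : ℂ)
  have hρ : ContDiff ℝ ∞ ρ := Complex.ofRealCLM.contDiff.comp
    ((b₁.contDiff.comp contDiff_fst).mul (b₂.contDiff.comp contDiff_snd))
  have hρc : HasCompactSupport ρ := by
    refine HasCompactSupport.of_support_subset_isCompact
      (b₁.hasCompactSupport.isCompact.prod b₂.hasCompactSupport.isCompact) fun u hu => ?_
    have hu' : b₁ u.1 * b₂ u.2 ≠ 0 := fun h0 => hu (by simp only [ρ, h0, Complex.ofReal_zero])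
    exact ⟨subset_tsupport _ (left_ne_zero_of_mul hu'),
      subset_tsupport _ (right_ne_zero_of_mul hu')⟩
  have hρψ : ∀ u, ρ u * ψ u = ψ u := fun u => by
    by_cases hu : ψ u = 0
    · rw [hu, mul_zero]
    · have h1 : u ∈ Metric.closedBall 0 R := hR (subset_tsupport _ hu)
      have h2 : ‖u.1‖ ≤ max R 1 :=
        (norm_fst_le u).trans ((mem_closedBall_zero_iff.mp h1).trans (le_max_left _ _))
      have h3 : b₁ u.1 = 1 := b₁.one_of_mem_closedBall (mem_closedBall_zero_iff.mpr h2)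
      have h4 : b₂ u.2 = 1 := b₂.one_of_mem_closedBall
        (by simpa [dist_eq_norm] using (hsupp u hu).le)
      simp only [ρ, h3, h4, mul_one, Complex.ofReal_one, one_mul]
  have hz : ∀ i : Fin n, ContDiff ℝ ∞ fun u : Cov n => u.2 i - gridPt k m i := fun i =>
    ((contDiff_apply ℝ ℝ i).comp contDiff_snd).sub contDiff_const
  let φ : Fin n → Cov n → ℂ := fun i u => ρ u * (l (u.2 i - gridPt k m i) * G i u)
  have hφ : ∀ i, ContDiff ℝ ∞ (φ i) := fun i => hρ.mul ((hl.comp (hz i)).mul (hG i))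
  have hφc : ∀ i, HasCompactSupport (φ i) := fun i => hρc.mul_right
  have hsum : ∀ u, ψ u = ∑ i, (holonomy n k i - 1).1 u * φ i u := fun u => by
    have h1 : ∀ i, (holonomy n k i - 1).1 u =
        Complex.exp (-(2 * Real.pi * k * (u.2 i - gridPt k m i) : ℝ) * Complex.I) - 1 := fun i => by
      rw [← Pi.sub_apply u.2, ← holonomy_gridPt hk i m (x := u.1) (y := u.2) (by simp)]
      rfl
    rw [← hρψ u]
    by_cases hu : ρ u = 0
    · simp [φ, hu]
    · have h2 : ‖u.2 - gridPt k m‖ ≤ 9 / 10 / k := by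
        by_contra h3
        refine hu ?_
        have h4 : b₂ u.2 = 0 := b₂.zero_of_le_dist (by simpa [dist_eq_norm] using (not_le.mp h3).le)
        simp only [ρ, h4, mul_zero, Complex.ofReal_zero]
      rw [hGsum u, Finset.mul_sum]
      refine Finset.sum_congr rfl fun i _ => ?_
      have h5 := hlmul (u.2 i - gridPt k m i) ((norm_le_pi_norm (u.2 - gridPt k m) i).trans h2)
      rw [h1, h5]
      simp only [φ]
      ring
  rw [pushForward_sum (fun i => (holonomy n k i - 1).2.1.mul (hφ i))
    (fun i => (hφc i).mul_left) hψ hc hsum, map_sum]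
  refine Finset.sum_eq_zero fun i _ => ?_
  rw [← mulSection_pushForward (holonomy n k i - 1) (hφ i) (hφc i)]
  exact quantumSpace_apply_holonomy s i _

/-- Elements of the quantum space only depend on the integrals over the Bohr–Sommerfeld leaves. -/
theorem quantumSpace_apply_eq_zero (hk : 0 < k) (s : quantumSpace n k) {τ : smoothSection n k}
    (h : ∀ m : Fin n → Fin k, leafX k (finVec m) τ.1 = 0) : s.1.1 τ = 0 := by
  -- replace `τ` by its average, which vanishes on the leaves, and localize near them
  obtain ⟨χ, hχ, hsum⟩ := exists_leaf_partition n hk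
  rw [← quantumSpace_apply_avgList s (List.finRange n), ← sum_pushForward_cutoff hsum
    (avgList (List.finRange n) τ), map_sum]
  refine Finset.sum_eq_zero fun m _ => ?_
  refine quantumSpace_apply_pushForward hk s (finVec m) _ _ (fun x => ?_) fun u hu => ?_
  · rw [avgList_eq_zero_on_leaf hk (h m), mul_zero]
  · exact hχ m u fun h0 => hu (by rw [h0, Complex.ofReal_zero, zero_mul])

end Division

/-! ### The quantum space and its Toeplitz operators -/

section Quantum

variable {n k : ℕ}

/-- A smooth bump around the leaf `y = m / k`, trivialized along the leaf, has integral `1` over that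
leaf and vanishes on the others. -/
theorem exists_dual_section (hk : 0 < k) (m : Fin n → Fin k) : ∃ τ : smoothSection n k,
    ∀ m' : Fin n → Fin k, leafX k (finVec m') τ.1 = if m' = m then 1 else 0 := by
  have hk' : (0 : ℝ) < k := by exact_mod_cast hk
  let a : ContDiffBump (0 : Fin n → ℝ) := ⟨1, 2, one_pos, one_lt_two⟩
  let b : ContDiffBump (gridPt k (finVec m)) := ⟨1 / 2 / k, 1 / k, by positivity,
    div_lt_div_of_pos_right (by norm_num) hk'⟩
  let w : Cov n → ℝ := fun u => a.normed volume u.1 * b u.2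
  let ψ : Cov n → ℂ := fun u => (w u : ℂ) * halfPhase (finVec m) u.1
  have hψ : ContDiff ℝ ∞ ψ := (Complex.ofRealCLM.contDiff.comp
    ((a.contDiff_normed.comp contDiff_fst).mul (b.contDiff.comp contDiff_snd))).mul
      ((contDiff_halfPhase _).comp contDiff_fst)
  have hw : HasCompactSupport w := by
    refine HasCompactSupport.of_support_subset_isCompact
      ((a.hasCompactSupport_normed (μ := volume)).isCompact.prod b.hasCompactSupport.isCompact)
      fun u hu => ?_
    exact ⟨subset_tsupport _ (left_ne_zero_of_mul hu), subset_tsupport _ (right_ne_zero_of_mul hu)⟩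
  have hψc : HasCompactSupport ψ :=
    (hw.comp_left (g := fun t : ℝ => (t : ℂ)) Complex.ofReal_zero).mul_right
  have h1 : ∀ q : Fin n → ℤ, ∫ x, leafXFun k q ψ x = if q = finVec m then 1 else 0 := fun q => by
    split_ifs with hq
    · have h2 : ∀ x, leafXFun k q ψ x = (a.normed volume x : ℂ) := fun x => by
        have h3 : b (gridPt k (finVec m)) = 1 := b.one_of_mem_closedBall
          (Metric.mem_closedBall_self b.rIn_pos.le)
        have h4 := halfPhase_neg_mul (finVec m) x
        simp only [leafXFun, ψ, w, hq, h3, mul_one]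
        linear_combination (a.normed volume x : ℂ) * h4
      simp only [h2]
      rw [integral_complex_ofReal, a.integral_normed, Complex.ofReal_one]
    · obtain ⟨i, hi⟩ := Function.ne_iff.mp hq
      have h2 : b (gridPt k q) = 0 := b.zero_of_le_dist <| by
        refine le_trans ?_ (dist_le_pi_dist _ _ i)
        change 1 / (k : ℝ) ≤ _
        rw [Real.dist_eq, gridPt, gridPt, ← sub_div, abs_div, abs_of_pos hk']
        refine div_le_div_of_nonneg_right ?_ hk'.le
        exact_mod_cast Int.one_le_abs (sub_ne_zero.mpr hi)
      simp [leafXFun, ψ, w, h2]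
  refine ⟨pushForward k ψ hψ hψc, fun m' => ?_⟩
  refine (hasSum_leafX_pushForward hk (finVec m') hψ hψc).unique ?_
  simp only [h1]
  have h5 : ∀ q : Fin n → ℤ, finVec m' - (k : ℤ) • q = finVec m → q = 0 := fun q hq => by
    funext i
    have h6 := congrFun hq i
    simp only [finVec, Pi.sub_apply, Pi.smul_apply, smul_eq_mul] at h6
    have h7 := (m i).2
    have h8 := (m' i).2
    have h9 : |(k : ℤ) * q i| < k := abs_lt.mpr ⟨by omega, by omega⟩
    rw [abs_mul, Nat.abs_cast] at h9
    refine Int.abs_lt_one_iff.mp (lt_of_mul_lt_mul_left (a := (k : ℤ)) ?_ (by positivity))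
    rwa [mul_one]
  have h6 : (finVec m' - (k : ℤ) • 0 = finVec m) ↔ m' = m := by
    rw [smul_zero, sub_zero]
    refine ⟨fun h => funext fun i => Fin.ext ?_, fun h => by rw [h]⟩
    have h7 := congrFun h i
    simpa [finVec] using h7
  simp only [← h6]
  exact hasSum_single 0 fun q hq => if_neg fun h => hq (h5 q h)

/-- A section that is dual to the state supported on the leaf `y = m / k`. -/
def dualSection (hk : 0 < k) (m : Fin n → Fin k) : smoothSection n k :=
  (exists_dual_section hk m).choose

theorem leafX_dualSection (hk : 0 < k) (m m' : Fin n → Fin k) :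
    leafX k (finVec m') (dualSection hk m).1 = if m' = m then 1 else 0 :=
  (exists_dual_section hk m).choose_spec m'

/-- Subtracting from `τ` the dual sections with the coefficients `leafX k (finVec m) τ` leaves a section
that every state annihilates. -/
theorem quantumSpace_apply_eq_sum (hk : 0 < k) (s : quantumSpace n k) (τ : smoothSection n k) :
    s.1.1 τ = ∑ m, s.1.1 (dualSection hk m) * (leafState hk m).1.1 τ := by
  let σ : smoothSection n k := ∑ m, leafX k (finVec m) τ.1 • dualSection hk m
  have h1 : ∀ m : Fin n → Fin k, leafX k (finVec m) (τ - σ).1 = 0 := fun m => by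
    have h2 : (leafState hk m).1.1 (τ - σ) = 0 := by
      rw [map_sub, map_sum]
      simp [leafState_apply, leafX_dualSection]
    rwa [leafState_apply, map_eq_zero] at h2
  have h3 := quantumSpace_apply_eq_zero hk s h1
  rw [map_sub, sub_eq_zero, map_sum] at h3
  rw [h3]
  refine Finset.sum_congr rfl fun m _ => ?_
  rw [map_smulₛₗ, smul_eq_mul, leafState_apply, mul_comm]

theorem quantumSpace_ext {s t : quantumSpace n k} (h : ∀ τ, s.1.1 τ = t.1.1 τ) : s = t :=
  Subtype.ext (Subtype.ext (LinearMap.ext h))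

theorem sum_smul_leafState_apply (hk : 0 < k) (c : (Fin n → Fin k) → ℂ) (τ : smoothSection n k) :
    (∑ m, c m • leafState hk m : quantumSpace n k).1.1 τ = ∑ m, c m * (leafState hk m).1.1 τ := by
  simp [LinearMap.sum_apply]

/-- The states supported on the leaves `y = m / k` form a basis of the quantum space. -/
def leafEquiv (hk : 0 < k) : quantumSpace n k ≃ₗ[ℂ] ((Fin n → Fin k) → ℂ) where
  toFun s m := s.1.1 (dualSection hk m)
  map_add' s t := rfl
  map_smul' c s := rfl
  invFun c := ∑ m, c m • leafState hk m
  left_inv s := quantumSpace_ext fun τ => by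
    rw [sum_smul_leafState_apply, ← quantumSpace_apply_eq_sum]
  right_inv c := by
    funext m
    change (∑ m, c m • leafState hk m : quantumSpace n k).1.1 (dualSection hk m) = c m
    rw [sum_smul_leafState_apply]
    simp [leafState_apply, leafX_dualSection]

theorem leafEquiv_symm_apply (hk : 0 < k) (c : (Fin n → Fin k) → ℂ) :
    (leafEquiv hk).symm c = ∑ m, c m • leafState hk m := rfl

theorem leafEquiv_apply (hk : 0 < k) (s : quantumSpace n k) (m : Fin n → Fin k) :
    leafEquiv hk s m = s.1.1 (dualSection hk m) := rfl

/-- The matrix of the Toeplitz operator of `f` in the basis of states supported on the leaves. -/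
def toeplitzMatrix (k : ℕ) (f : smoothFun n) : Matrix (Fin n → Fin k) (Fin n → Fin k) ℂ :=
  fun m' m => ((k : ℂ) ^ n)⁻¹ * ∑ j : Fin n → Fin k,
    phase (finVec m - finVec m') (gridPt k (finVec j)) *
      f.1 (gridPt k (finVec j), gridPt k (finVec m))

/-- The normalizations of the bases, of the Weil–Brezin coefficients and of the half-forms combine
to the weight `k⁻ⁿ` of the points of the grid. -/
theorem norm_factors_mul (hk : 0 < k) :
    (halfFormPairing n k : ℂ) * basisNorm n k * thetaNorm n k * sigmaCheckNorm n k =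
      ((k : ℂ) ^ n)⁻¹ := by
  have hk' : (0 : ℝ) < k := by exact_mod_cast hk
  have h2 : (0 : ℝ) < 2 := two_pos
  have h3 : halfFormPairing n k * basisNorm n k * (2 * k : ℝ) ^ (-(n : ℝ) / 2) *
      (basisNorm n k * (2 : ℝ) ^ (-(n : ℝ) / 2)) = 1 := by
    rw [halfFormPairing, basisNorm, Real.mul_rpow h2.le hk'.le]
    calc _ = ((2 : ℝ) ^ ((n : ℝ) / 2) * (2 : ℝ) ^ ((n : ℝ) / 4) * (2 : ℝ) ^ (-(n : ℝ) / 2) *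
          (2 : ℝ) ^ ((n : ℝ) / 4) * (2 : ℝ) ^ (-(n : ℝ) / 2)) *
          ((k : ℝ) ^ (-(n : ℝ) / 2) * (k : ℝ) ^ ((n : ℝ) / 2) * (k : ℝ) ^ (-(n : ℝ) / 2) *
          (k : ℝ) ^ ((n : ℝ) / 2)) := by ring
      _ = 1 := by
        simp only [← Real.rpow_add h2, ← Real.rpow_add hk']
        ring_nf
        simp
  rw [thetaNorm, sigmaCheckNorm]
  have h4 := congrArg (fun t : ℝ => (t : ℂ)) h3
  simp only [Complex.ofReal_mul, Complex.ofReal_one] at h4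
  linear_combination ((k : ℂ) ^ n)⁻¹ * h4

theorem thetaNorm_ne_zero (hk : 0 < k) : thetaNorm n k ≠ 0 := by
  have hk' : (0 : ℝ) < k := by exact_mod_cast hk
  exact Complex.ofReal_ne_zero.mpr (Real.rpow_pos_of_pos (by positivity) _).ne'

theorem theta_eq_leafState (hk : 0 < k) (m : Fin n → Fin k) (τ : smoothSection n k) :
    theta m τ = thetaNorm n k * (leafState hk m).1.1 τ := theta_eq hk m τ

/-- The pairing of `f s` with `σ̌^{m'}`, for the expansion of `s` in the basis of leaf states. -/
theorem hasPairing_mulDist (hk : 0 < k) (f : smoothFun n) (s : quantumSpace n k)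
    (m' : Fin n → Fin k) :
    HasPairing (fun τ => (mulDist f s.1).1 τ) (sigmaCheck m')
      (∑ m, s.1.1 (dualSection hk m) * (thetaNorm n k)⁻¹ * (thetaNorm n k * sigmaCheckNorm n k *
        ∑ j : Fin n → Fin k, phase (finVec m - finVec m') (gridPt k (finVec j)) *
          f.1 (gridPt k (finVec j), gridPt k (finVec m)))) := by
  have h := HasPairing.sum (s := Finset.univ)
    (fun m : Fin n → Fin k => s.1.1 (dualSection hk m) * (thetaNorm n k)⁻¹)
    fun m _ => hasPairing_theta_sigmaCheck hk f m m'
  refine (congrArg (fun u => HasPairing u (sigmaCheck m') _) (funext fun τ => ?_)).mpr h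
  change s.1.1 (mulSection (conjFun f) τ) = _
  rw [quantumSpace_apply_eq_sum hk]
  refine Finset.sum_congr rfl fun m _ => ?_
  rw [theta_eq_leafState hk, mul_assoc, inv_mul_cancel_left₀ (thetaNorm_ne_zero hk)]

/-- The pairings in the definition of a Toeplitz operator exist and are unique, hence so does the
operator, and its matrix is `toeplitzMatrix`. -/
theorem isToeplitz_iff (hk : 0 < k) (f : smoothFun n) (A : Module.End ℂ (quantumSpace n k)) :
    IsToeplitz f A ↔ A = (leafEquiv hk).symm.conj (toeplitzMatrix k f).toLin' := by
  have hθ := thetaNorm_ne_zero (n := n) hk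
  have key : ∀ (s : quantumSpace n k) (τ : smoothSection n k),
      (((leafEquiv hk).symm.conj (toeplitzMatrix k f).toLin') s).1.1 τ =
        ∑ m', (halfFormPairing n k : ℂ) * (∑ m, s.1.1 (dualSection hk m) * (thetaNorm n k)⁻¹ *
          (thetaNorm n k * sigmaCheckNorm n k * ∑ j : Fin n → Fin k,
            phase (finVec m - finVec m') (gridPt k (finVec j)) *
              f.1 (gridPt k (finVec j), gridPt k (finVec m)))) * sigma m' τ := fun s τ => by
    rw [LinearEquiv.conj_apply_apply, LinearEquiv.symm_symm, leafEquiv_symm_apply,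
      sum_smul_leafState_apply]
    refine Finset.sum_congr rfl fun m' _ => ?_
    rw [Matrix.toLin'_apply, Matrix.mulVec, dotProduct, sigma, theta_eq_leafState hk,
      Finset.mul_sum, Finset.sum_mul, Finset.sum_mul]
    refine Finset.sum_congr rfl fun m _ => ?_
    rw [leafEquiv_apply, toeplitzMatrix, ← norm_factors_mul hk]
    field_simp
  refine ⟨fun h => LinearMap.ext fun s => quantumSpace_ext fun τ => ?_, ?_⟩
  · obtain ⟨c, hc, hA⟩ := h s
    rw [hA, key]
    refine Finset.sum_congr rfl fun m' _ => ?_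
    rw [(hc m').unique (hasPairing_mulDist hk f s m')]
  · rintro rfl s
    exact ⟨_, fun m' => hasPairing_mulDist hk f s m', key s⟩

theorem toeplitz_eq (hk : 0 < k) (f : smoothFun n) :
    toeplitz k f = (leafEquiv hk).symm.conj (toeplitzMatrix k f).toLin' :=
  (isToeplitz_iff hk f _).mp (Classical.epsilon_spec
    (p := fun A : Module.End ℂ (quantumSpace n k) => IsToeplitz f A)
    ⟨_, (isToeplitz_iff hk f _).mpr rfl⟩)

/-- On the diagonal the phases are `1`: the trace is a Riemann sum on the grid of mesh `1 / k`. -/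
theorem trace_toeplitz (hk : 0 < k) (f : smoothFun n) :
    LinearMap.trace ℂ (quantumSpace n k) (toeplitz k f) =
      ∑ m : Fin n → Fin k, ((k : ℂ) ^ n)⁻¹ * ∑ j : Fin n → Fin k,
        f.1 (gridPt k (finVec j), gridPt k (finVec m)) := by
  rw [toeplitz_eq hk]
  refine ((LinearMap.trace_conj' (M := (Fin n → Fin k) → ℂ) (N := quantumSpace n k)
    (toeplitzMatrix k f).toLin' (leafEquiv hk).symm).trans (Matrix.trace_toLin'_eq _)).trans ?_
  rw [Matrix.trace]
  refine Finset.sum_congr rfl fun m _ => ?_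
  rw [Matrix.diag_apply, toeplitzMatrix]
  simp [phase]

theorem exists_trace_toeplitz_sub_le (f : smoothFun n) (r : ℕ) : ∃ C : ℝ, ∀ k : ℕ, 0 < k →
    ‖LinearMap.trace ℂ (quantumSpace n k) (toeplitz k f) - (k : ℂ) ^ n * liouvilleIntegral f‖
      ≤ (k : ℝ) ^ n * (C * ((k : ℝ)⁻¹) ^ r) := by
  obtain ⟨C, hC⟩ := exists_trapezoid_le f r
  refine ⟨C, fun k hk => ?_⟩
  have hk' : ((k : ℂ) ^ n) ≠ 0 := pow_ne_zero _ (by exact_mod_cast hk.ne')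
  have h := mul_le_mul_of_nonneg_left (hC k hk) (by positivity : (0 : ℝ) ≤ (k : ℝ) ^ n)
  refine le_trans (le_of_eq ?_) h
  have h1 : (k : ℝ) ^ n = ‖(k : ℂ) ^ n‖ := by simp
  rw [h1, ← norm_mul, mul_sub, mul_inv_cancel_left₀ hk', trace_toeplitz hk]

theorem coeff_formalTrace_C (f : smoothFun n) (j : ℤ) :
    (formalTrace n (PowerSeries.C f)).coeff j =
      if j = -(n : ℤ) then liouvilleIntegral f else 0 := by
  have h : (PowerSeries.mk fun j => liouvilleIntegral (PowerSeries.coeff j (PowerSeries.C f))) =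
      PowerSeries.C (liouvilleIntegral f) := by
    ext j
    rw [PowerSeries.coeff_mk, PowerSeries.coeff_C, PowerSeries.coeff_C]
    split_ifs
    · rfl
    · simp [liouvilleIntegral]
  rw [formalTrace, h, HahnSeries.ofPowerSeries_C, HahnSeries.C_apply,
    HahnSeries.single_mul_single, add_zero, one_mul, HahnSeries.coeff_single]
  congr

theorem hasAsymptoticExpansion_trace_toeplitz (f : smoothFun n) :
    HasAsymptoticExpansion n (fun k => LinearMap.trace ℂ (quantumSpace n k) (toeplitz k f))
      (formalTrace n (PowerSeries.C f)) := by
  refine ⟨fun j hj => by rw [coeff_formalTrace_C, if_neg hj.ne], fun N => ?_⟩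
  simp only [coeff_formalTrace_C, ite_mul, zero_mul, Finset.sum_ite_eq', Finset.mem_Ico, le_refl,
    true_and]
  split_ifs with hN
  · obtain ⟨C, hC⟩ := exists_trace_toeplitz_sub_le f (N + n).toNat
    refine Asymptotics.IsBigO.of_bound C ?_
    filter_upwards [Filter.eventually_gt_atTop 0] with k hk
    have hk' : (k : ℝ) ≠ 0 := by exact_mod_cast hk.ne'
    have h1 : ((k : ℝ)⁻¹) ^ N = (k : ℝ) ^ n * ((k : ℝ)⁻¹) ^ (N + n).toNat := by
      have h2 : ((N + n).toNat : ℤ) = N + n := Int.toNat_of_nonneg (by omega)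
      rw [← zpow_natCast ((k : ℝ)⁻¹), h2, zpow_add₀ (inv_ne_zero hk'), zpow_natCast, inv_pow]
      field_simp
    have h3 := hC k hk
    rw [Real.norm_of_nonneg (by positivity), h1]
    have h4 : liouvilleIntegral f * ((k : ℂ)⁻¹) ^ (-(n : ℤ)) = (k : ℂ) ^ n * liouvilleIntegral f := by
      rw [zpow_neg, zpow_natCast, inv_pow, inv_inv, mul_comm]
    rw [h4]
    linarith
  · -- below the leading order it remains to bound the trace itself by `k ^ n`
    obtain ⟨C, hC⟩ := exists_trace_toeplitz_sub_le f 0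
    refine Asymptotics.IsBigO.of_bound (C + ‖liouvilleIntegral f‖) ?_
    filter_upwards [Filter.eventually_gt_atTop 0] with k hk
    have hk1 : (1 : ℝ) ≤ k := by exact_mod_cast hk
    have h1 : (k : ℝ) ^ n ≤ ((k : ℝ)⁻¹) ^ N := by
      rw [inv_zpow', ← zpow_natCast]
      exact zpow_le_zpow_right₀ hk1 (by omega)
    have h3 := hC k hk
    have h4 := norm_add_le (LinearMap.trace ℂ (quantumSpace n k) (toeplitz k f) -
      (k : ℂ) ^ n * liouvilleIntegral f) ((k : ℂ) ^ n * liouvilleIntegral f)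
    have h5 : ‖(k : ℂ) ^ n * liouvilleIntegral f‖ = (k : ℝ) ^ n * ‖liouvilleIntegral f‖ := by simp
    rw [sub_add_cancel, h5] at h4
    have h6 : 0 ≤ C + ‖liouvilleIntegral f‖ := by
      have h7 := (norm_nonneg _).trans (hC 1 one_pos)
      simp only [Nat.cast_one, one_pow, pow_zero, mul_one, one_mul] at h7
      positivity
    rw [sub_zero, Real.norm_of_nonneg (by positivity)]
    calc _ ≤ (C + ‖liouvilleIntegral f‖) * (k : ℝ) ^ n := by
          rw [pow_zero, mul_one] at h3
          linarith
      _ ≤ _ := mul_le_mul_of_nonneg_left h1 h6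

end Quantum

end TorusQuant
end

open TorusQuant
theorem theorem1p3 (n : ℕ) :
    -- the quantum spaces are finite dimensional and the Toeplitz operators are well defined
    (∀ k : ℕ, 0 < k → FiniteDimensional ℂ (quantumSpace n k) ∧
      ∀ f : smoothFun n, (∃! A : Module.End ℂ (quantumSpace n k), IsToeplitz f A) ∧
        IsToeplitz f (toeplitz k f)) ∧
    -- `tr(Q_f^ħ) = ħ⁻ⁿ (∫_X f e^ω + O(ħ^∞))` with `ħ = 1/k`
    (∀ (f : smoothFun n) (r : ℕ), ∃ C : ℝ, ∀ k : ℕ, 0 < k →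
      ‖LinearMap.trace ℂ (quantumSpace n k) (toeplitz k f) - (k : ℂ) ^ n * liouvilleIntegral f‖
        ≤ (k : ℝ) ^ n * (C * ((k : ℝ)⁻¹) ^ r)) ∧
    -- the asymptotic expansion of the trace is `Tr(f) = ∫_X f e^{ω/ħ}`
    (∀ f : smoothFun n,
      HasAsymptoticExpansion n
        (fun k => LinearMap.trace ℂ (quantumSpace n k) (toeplitz k f))
        (formalTrace n (PowerSeries.C f))) ∧
    -- and `Tr` is a trace map for the star product
    IsTraceMap (starProduct (n := n)) (formalTrace n) := by
  refine ⟨fun k hk => ⟨LinearEquiv.finiteDimensional (leafEquiv hk).symm, fun f => ⟨?_, ?_⟩⟩,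
    exists_trace_toeplitz_sub_le, hasAsymptoticExpansion_trace_toeplitz,
    isTraceMap_formalTrace n⟩
  · simp only [isToeplitz_iff hk]
    exact existsUnique_eq
  · exact (isToeplitz_iff hk f _).mpr (toeplitz_eq hk f)
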